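/- Setting. A particle of mass $m>0$ and charge $e\in\mathbb R$ moves in $\mathbb R^3$ in an electromagnetic field with vector potential $\mathbf A(\mathbf q,t)$ and scalar potential $\phi(\mathbf q,t)$, both $C^\infty$ on an open set $\Omega\subseteq\mathbb R^3\times\mathbb R$ of points $(\mathbf q,t)$. The Hamiltonian is $H=\frac1{2m}\|\mathbf p-e\mathbf A(\mathbf q,t)\|_2^2+e\phi(\mathbf q,t)$, and $H_1=\|\mathbf p\|_2^2/(2m)$, $f=\frac{e^2}{2m}\|\mathbf A\|_2^2+e\phi$. Vectors are row vectors, $[\mathbf A']_{ij}=\partial A_i/\partial q_j$. An explicit Runge–Kutta method consists of $s$, $(a_{ij})_{1\le j<i\le s}$, $(b_i)_{1\le i\le s}$. One step of length $h$ for $\dot x=F(x,t)$ from $x$ at time $t$ is $x+h\sum_i b_i k_i$, where $k_i=F\big(x+h\sum_{j<i}a_{ij}k_j,\ t+h\sum_{j<i}a_{ij}\big)$. The method has order $p$ (meaning at least $p$) if, for every smooth system of any dimension and every initial condition, the error of one step is $O(h^{p+1})$ as $h\to0$. The maps. Put $\psi_1(t_1,t_0)[\mathbf q,\mathbf p]=[\mathbf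 q+\frac{t_1-t_0}m\mathbf p,\ \mathbf p]$. For a Runge–Kutta method as above and $h=t_1-t_0$, put $\mathbf x_i=\mathbf q+h\sum_{j<i}a_{ij}\mathbf k_j$, $\tau_i=t_0+h\sum_{j<i}a_{ij}$, $\mathbf J_i=\mathbf I+h\sum_{j<i}a_{ij}\mathbf k'_j$ and $$\mathbf k_i=-\tfrac em\mathbf A(\mathbf x_i,\tau_i),\qquad \mathbf k'_i=-\tfrac em\mathbf A'(\mathbf x_i,\tau_i)\,\mathbf J_i,\qquad \nabla l_i=\nabla f(\mathbf x_i,\tau_i)\,\mathbf J_i .$$ Then $\psi_2(t_1,t_0)[\mathbf q,\mathbf p]=[\mathbf Q,\mathbf P]$ with $$\mathbf Q=\mathbf q+h\sum_i b_i\mathbf k_i,\qquad \mathbf P=\Big(\mathbf p-h\sum_i b_i\nabla l_i\Big)\Big(\mathbf I+h\sum_i b_i\mathbf k'_i\Big)^{-1};$$ it is defined at $[\mathbf q,\mathbf p]$ when all $(\mathbf x_i,\tau_i)$ lie in $\Omega$ and the matrix to be inverted is invertible. With one and the same Runge–Kutta method in all $\psi_2$, and $h=t_1-t_0$, let $$\Theta_2(t_1,t_0)=\psi_1(t_1,t_0+\tfrac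 h2)\circ\psi_2(t_1,t_0)\circ\psi_1(t_0+\tfrac h2,t_0),$$ $$\Theta_{p+2}(t_1,t_0)=\Theta_p(t_1,t_0+(1-\gamma_p)h)\circ\Theta_p(t_0+(1-\gamma_p)h,t_0+\gamma_ph)\circ\Theta_p(t_0+\gamma_ph,t_0),\qquad \gamma_p=\frac1{2-2^{1/(p+1)}},$$ for even $p\ge2$. $\Theta_p(t_1,t_0)$ is defined at a state when all its $\psi_2$ substeps are. Theorem. (0) For every $p$ there is an explicit Runge–Kutta method of order $p$. The map $\psi_1$ is the exact flow of $H_1$. For every even $p\ge2$: (1) (Alternating composition.) With $l=3^{p/2-1}$ there are real numbers $\alpha_0=0,\alpha_1,\dots,\alpha_{l+1}=1$ and $\beta_0=0,\beta_1,\dots,\beta_l=1$, depending only on $p$, such that for every explicit Runge–Kutta method, every particle and all $t,h$, with $s_i=t+\alpha_ih$ and $\tau_i=t+\beta_ih$, $$\Theta_p(t+h,t)=\psi_1(s_{l+1},s_l)\circ\psi_2(\tau_l,\tau_{l-1})\circ\psi_1(s_l,s_{l-1})\circ\cdots\circ\psi_2(\tau_1,\tau_0)\circ\psi_1(s_1,s_0).$$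 (2) (Explicitness.) For every explicit Runge–Kutta method there are two finite formulas, the same for all particles, fields, times and states, which give the new position and the new momentum wherever $\Theta_p(t_1,t_0)$ is defined, and which are built from $\mathbf q,\mathbf p,t_0,t_1,m,e$ and real constants by arithmetic, vector and matrix operations (including inversion of $3\times3$ matrices), and evaluation of $\mathbf A$, $\mathbf A'$ and $\nabla\phi$ at points and times already computed. (3) (Symplecticity.) For every explicit Runge–Kutta method, every particle and all $t_1,t_0$, near every state at which it is defined the map $\Theta_p(t_1,t_0)$ is $C^\infty$, and its derivative at that state preserves the canonical symplectic form of $\mathbb R^3\times\mathbb R^3$. (4) (Local error.) Suppose that the explicit Runge–Kutta method has order $p$. For every particle and every compact set $K$ of triples $(t,\mathbf q,\mathbf p)$ with $(\mathbf q,t)\in\Omega$ there are $h_0>0$ and $C$ such that for every $(t,\mathbf q,\mathbf p)\in K$: Hamilton's equations $\dot{\mathbf q}=\partial H/\partial\mathbf p$, $\dot{\mathbf p}=-\partial H/\partial\mathbf q$ have a solution on $[t-h_0,t+h_0]$ that takes the value $[\mathbf q,\mathbf p]$ at time $t$ and stays over $\Omega$; and for every $|h|\le h_0$ the map $\Theta_p(t+h,t)$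 is defined at $[\mathbf q,\mathbf p]$, and every solution $\zeta$ between the times $t$ and $t+h$ with $\zeta(t)=[\mathbf q,\mathbf p]$ that stays over $\Omega$ satisfies $$\big\|\Theta_p(t+h,t)[\mathbf q,\mathbf p]-\zeta(t+h)\big\|\le C|h|^{p+1}.$$ (5) (Fourth order.) The classical Runge–Kutta method ($s=4$, $b=(\frac16,\frac26,\frac26,\frac16)$, $a_{21}=a_{32}=\frac12$, $a_{43}=1$, other $a_{ij}=0$) has order $4$, and with it, for $\gamma=1/(2-2^{1/3})$, the map $[\mathbf q_n,\mathbf p_n]\mapsto[\mathbf q_{n+1},\mathbf p_{n+1}]$ given by $$\begin{aligned} \mathbf q_{n,1}&=\mathbf q_n+\tfrac{\gamma h}2\mathbf p_n/m, & [\mathbf q_{n,2},\mathbf p_{n,2}]&=\psi_2(t+\gamma h,t)[\mathbf q_{n,1},\mathbf p_n],\\ \mathbf q_{n,3}&=\mathbf q_{n,2}+\tfrac{h-\gamma h}2\mathbf p_{n,2}/m, & [\mathbf q_{n,4},\mathbf p_{n,4}]&=\psi_2(t+(1-\gamma)h,t+\gamma h)[\mathbf q_{n,3},\mathbf p_{n,2}],\\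 \mathbf q_{n,5}&=\mathbf q_{n,4}+\tfrac{h-\gamma h}2\mathbf p_{n,4}/m, & [\mathbf q_{n,6},\mathbf p_{n+1}]&=\psi_2(t+h,t+(1-\gamma)h)[\mathbf q_{n,5},\mathbf p_{n,4}],\\ \mathbf q_{n+1}&=\mathbf q_{n,6}+\tfrac{\gamma h}2\mathbf p_{n+1}/m \end{aligned}$$ is $\Theta_4(t+h,t)$. -/

import Mathlib

open Set Filter Topology Asymptotics
open scoped ContDiff

namespace ESSRK

/-! ### Phase space, Hamilton's equations, symplectic maps -/

/-- Vectors of `ℝ³`, read as row vectors. The norm Lean puts on this type is the maximum norm; it is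
only used to measure errors up to constants. Euclidean squares are written as dot products. -/
abbrev Vec : Type := Fin 3 → ℝ

/-- Real `3 × 3` matrices. -/
abbrev Mat : Type := Matrix (Fin 3) (Fin 3) ℝ

/-- Phase space; a state is a pair `(q, p)` of position and momentum. -/
abbrev Phase : Type := Vec × Vec

/-- The row vector of partial derivatives of a scalar function. -/
noncomputable def grad (g : Vec → ℝ) (x : Vec) : Vec :=
  fun i => fderiv ℝ g x (Pi.single i 1)

/-- The Jacobian matrix, with `(i, j)` entry `∂ Gᵢ / ∂ qⱼ`. -/
noncomputable def jac (G : Vec → Vec) (x : Vec) : Mat :=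
  Matrix.of fun i j => fderiv ℝ (fun y => G y i) x (Pi.single j 1)

/-- `ζ` solves Hamilton's equations `q' = ∂H/∂p`, `p' = -∂H/∂q` on the set `S` of times. -/
def IsTrajectory (H : Vec → Vec → ℝ → ℝ) (S : Set ℝ) (ζ : ℝ → Phase) : Prop :=
  ∀ τ ∈ S, HasDerivWithinAt ζ
    (grad (fun p => H (ζ τ).1 p τ) (ζ τ).2, -grad (fun q => H q (ζ τ).2 τ) (ζ τ).1) S τ

/-- The canonical symplectic form on phase space. -/
def symplecticForm (u v : Phase) : ℝ := u.1 ⬝ᵥ v.2 - u.2 ⬝ᵥ v.1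

/-- `Φ` is smooth near `z` and its derivative at `z` preserves the canonical symplectic form. -/
def IsSymplecticAt (Φ : Phase → Phase) (z : Phase) : Prop :=
  ContDiffAt ℝ ∞ Φ z ∧
    ∀ u v : Phase, symplecticForm (fderiv ℝ Φ z u) (fderiv ℝ Φ z v) = symplecticForm u v

/-! ### The charged particle -/

/-- A particle of mass `m` and charge `e` in an electromagnetic field given by potentials that are
smooth on an open set `Ω` of points `(q, t)` of space-time. Values off `Ω` carry no meaning. -/
structure ChargedParticle where
  m : ℝ
  e : ℝ
  A : Vec → ℝ → Vec
  φ : Vec → ℝ → ℝ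
  Ω : Set (Vec × ℝ)
  m_pos : 0 < m
  isOpen_Ω : IsOpen Ω
  smooth_A : ContDiffOn ℝ ∞ (fun x : Vec × ℝ => A x.1 x.2) Ω
  smooth_φ : ContDiffOn ℝ ∞ (fun x : Vec × ℝ => φ x.1 x.2) Ω

namespace ChargedParticle

/-- The Hamiltonian `H = ‖p - e A(q,t)‖² / (2m) + e φ(q,t)`. -/
noncomputable def H (S : ChargedParticle) (q p : Vec) (t : ℝ) : ℝ :=
  (1 / (2 * S.m)) * ((p - S.e • S.A q t) ⬝ᵥ (p - S.e • S.A q t)) + S.e * S.φ q t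

/-- The kinetic part `H₁ = ‖p‖² / (2m)` of the Hamiltonian. -/
noncomputable def H₁ (S : ChargedParticle) (_q p : Vec) (_t : ℝ) : ℝ := (p ⬝ᵥ p) / (2 * S.m)

/-- `f = e² ‖A‖² / (2m) + e φ`, the momentum-free part of `H₂ = H - H₁`. -/
noncomputable def f (S : ChargedParticle) (q : Vec) (t : ℝ) : ℝ :=
  S.e ^ 2 * (S.A q t ⬝ᵥ S.A q t) / (2 * S.m) + S.e * S.φ q t

/-- The position component `-(e/m) A(q,t)` of the vector field of `H₂`. -/
noncomputable def velocity (S : ChargedParticle) (q : Vec) (t : ℝ) : Vec :=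
  (-(S.e / S.m)) • S.A q t

end ChargedParticle

/-! ### Explicit Runge–Kutta methods -/

/-- The coefficients of an explicit Runge–Kutta method with `s` stages, numbered from `0`. Only the
entries `a i j` with `j < i < s` and `b i` with `i < s` are ever used. -/
structure RKTableau where
  s : ℕ
  a : ℕ → ℕ → ℝ
  b : ℕ → ℝ

namespace RKTableau

/-- The stages `kᵢ = F (x + h ∑_{j<i} aᵢⱼ kⱼ, t + h ∑_{j<i} aᵢⱼ)` for the equation `x' = F(x,t)`. -/
noncomputable def stage {E : Type*} [AddCommGroup E] [Module ℝ E] (T : RKTableau)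
    (F : E → ℝ → E) (t h : ℝ) (x : E) (i : ℕ) : E :=
  F (x + h • ∑ j : Fin i, T.a i j • stage T F t h x j) (t + h * ∑ j : Fin i, T.a i j)
termination_by i
decreasing_by exact j.2

/-- One step `x + h ∑ bᵢ kᵢ` of length `h`, started from `x` at time `t`. -/
noncomputable def step {E : Type*} [AddCommGroup E] [Module ℝ E] (T : RKTableau)
    (F : E → ℝ → E) (t h : ℝ) (x : E) : E :=
  x + h • ∑ i ∈ Finset.range T.s, T.b i • T.stage F t h x i

/-- The method has order (at least) `p`: for every smooth system of ordinary differential equations,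
of any dimension, the error of one step is `O(h^(p+1))`. -/
def HasOrder (T : RKTableau) (p : ℕ) : Prop :=
  ∀ (n : ℕ) (U : Set ((Fin n → ℝ) × ℝ)) (F : (Fin n → ℝ) → ℝ → (Fin n → ℝ)),
    IsOpen U → ContDiffOn ℝ ∞ (fun x : (Fin n → ℝ) × ℝ => F x.1 x.2) U →
    ∀ (t : ℝ) (y : ℝ → (Fin n → ℝ)), (y t, t) ∈ U →
      (∀ᶠ τ in 𝓝 t, HasDerivAt y (F (y τ) τ) τ) →
      (fun h : ℝ => T.step F t h (y t) - y (t + h)) =O[𝓝 0] fun h : ℝ => h ^ (p + 1)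

/-! ### The shadowed Runge–Kutta map `ψ₂` -/

/-- The time `t + h ∑_{j<i} aᵢⱼ` of stage `i`. -/
noncomputable def stageTime (T : RKTableau) (t h : ℝ) (i : ℕ) : ℝ :=
  t + h * ∑ j : Fin i, T.a i j

/-- The vectors `kᵢ(q)`. -/
noncomputable def k (T : RKTableau) (S : ChargedParticle) (t h : ℝ) (q : Vec) (i : ℕ) : Vec :=
  T.stage S.velocity t h q i

/-- The point `q + h ∑_{j<i} aᵢⱼ kⱼ(q)` of stage `i`. -/
noncomputable def stagePoint (T : RKTableau) (S : ChargedParticle) (t h : ℝ) (q : Vec) (i : ℕ) :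
    Vec :=
  q + h • ∑ j : Fin i, T.a i j • T.k S t h q j

/-- The matrices
`k'ᵢ = -(e/m) A'(q + h ∑_{j<i} aᵢⱼ kⱼ, t + h ∑_{j<i} aᵢⱼ) (I + h ∑_{j<i} aᵢⱼ k'ⱼ)`. -/
noncomputable def k' (T : RKTableau) (S : ChargedParticle) (t h : ℝ) (q : Vec) (i : ℕ) : Mat :=
  (-(S.e / S.m)) •
    (jac (fun x => S.A x (T.stageTime t h i)) (T.stagePoint S t h q i) *
      (1 + h • ∑ j : Fin i, T.a i j • k' T S t h q j))
termination_by i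
decreasing_by exact j.2

/-- The row vectors
`∇lᵢ = ∇f(q + h ∑_{j<i} aᵢⱼ kⱼ, t + h ∑_{j<i} aᵢⱼ) (I + h ∑_{j<i} aᵢⱼ k'ⱼ)`. -/
noncomputable def gradL (T : RKTableau) (S : ChargedParticle) (t h : ℝ) (q : Vec) (i : ℕ) : Vec :=
  Matrix.vecMul (grad (fun x => S.f x (T.stageTime t h i)) (T.stagePoint S t h q i))
    (1 + h • ∑ j : Fin i, T.a i j • T.k' S t h q j)

/-- The matrix `I + h ∑ bᵢ k'ᵢ(q)` that the momentum update inverts. -/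
noncomputable def updateMat (T : RKTableau) (S : ChargedParticle) (t h : ℝ) (q : Vec) : Mat :=
  1 + h • ∑ i ∈ Finset.range T.s, T.b i • T.k' S t h q i

end RKTableau

/-- `ψ₁(t₁, t₀)`: the kinetic shift over the time `h = t₁ - t₀`. -/
noncomputable def psi₁ (S : ChargedParticle) (t₁ t₀ : ℝ) (z : Phase) : Phase :=
  (z.1 + ((t₁ - t₀) / S.m) • z.2, z.2)

/-- `ψ₂(t₁, t₀)`: Runge–Kutta for the position, shadowed update for the momentum, over the time
`h = t₁ - t₀`. It is meaningful where `Psi₂Defined` holds. -/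
noncomputable def psi₂ (T : RKTableau) (S : ChargedParticle) (t₁ t₀ : ℝ) (z : Phase) : Phase :=
  (z.1 + (t₁ - t₀) • ∑ i ∈ Finset.range T.s, T.b i • T.k S t₀ (t₁ - t₀) z.1 i,
    Matrix.vecMul
      (z.2 - (t₁ - t₀) • ∑ i ∈ Finset.range T.s, T.b i • T.gradL S t₀ (t₁ - t₀) z.1 i)
      (T.updateMat S t₀ (t₁ - t₀) z.1)⁻¹)

/-- `ψ₂(t₁, t₀)` can be evaluated at `z`: the fields are only evaluated inside their domain `Ω`, and
the matrix to be inverted is invertible. -/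
def Psi₂Defined (T : RKTableau) (S : ChargedParticle) (t₁ t₀ : ℝ) (z : Phase) : Prop :=
  (∀ i < T.s, (T.stagePoint S t₀ (t₁ - t₀) z.1 i, T.stageTime t₀ (t₁ - t₀) i) ∈ S.Ω) ∧
    IsUnit (T.updateMat S t₀ (t₁ - t₀) z.1).det

/-! ### The composed integrators -/

/-- `γ_p = 1 / (2 - 2^(1/(p+1)))`. -/
noncomputable def gam (p : ℕ) : ℝ := 1 / (2 - (2 : ℝ) ^ (1 / ((p : ℝ) + 1)))

/-- `theta T S n t₁ t₀` is the map `Θ_{2n+2}(t₁, t₀)` with `ψ₂` in place of the exact flow of `H₂`: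
`Θ₂` is `ψ₁ ∘ ψ₂ ∘ ψ₁`, and `Θ_{p+2}` is the triple jump built from `Θ_p` with `γ_p`. The
Runge–Kutta method `T` is the same at all levels. -/
noncomputable def theta (T : RKTableau) (S : ChargedParticle) : ℕ → ℝ → ℝ → Phase → Phase
  | 0, t₁, t₀ => fun z =>
      psi₁ S t₁ (t₀ + (t₁ - t₀) / 2) (psi₂ T S t₁ t₀ (psi₁ S (t₀ + (t₁ - t₀) / 2) t₀ z))
  | n + 1, t₁, t₀ => fun z =>
      theta T S n t₁ (t₀ + (1 - gam (2 * n + 2)) * (t₁ - t₀))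
        (theta T S n (t₀ + (1 - gam (2 * n + 2)) * (t₁ - t₀)) (t₀ + gam (2 * n + 2) * (t₁ - t₀))
          (theta T S n (t₀ + gam (2 * n + 2) * (t₁ - t₀)) t₀ z))

/-- All the `ψ₂` substeps of `theta T S n t₁ t₀`, started at `z`, can be evaluated. -/
def ThetaDefined (T : RKTableau) (S : ChargedParticle) : ℕ → ℝ → ℝ → Phase → Prop
  | 0, t₁, t₀ => fun z => Psi₂Defined T S t₁ t₀ (psi₁ S (t₀ + (t₁ - t₀) / 2) t₀ z)
  | n + 1, t₁, t₀ => fun z =>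
      ThetaDefined T S n (t₀ + gam (2 * n + 2) * (t₁ - t₀)) t₀ z ∧
      ThetaDefined T S n (t₀ + (1 - gam (2 * n + 2)) * (t₁ - t₀))
        (t₀ + gam (2 * n + 2) * (t₁ - t₀))
        (theta T S n (t₀ + gam (2 * n + 2) * (t₁ - t₀)) t₀ z) ∧
      ThetaDefined T S n t₁ (t₀ + (1 - gam (2 * n + 2)) * (t₁ - t₀))
        (theta T S n (t₀ + (1 - gam (2 * n + 2)) * (t₁ - t₀)) (t₀ + gam (2 * n + 2) * (t₁ - t₀))
          (theta T S n (t₀ + gam (2 * n + 2) * (t₁ - t₀)) t₀ z))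

/-- The ESSRK integrator `Θ_p(t₁, t₀)`, for even `p ≥ 2`. -/
noncomputable def essrk (T : RKTableau) (S : ChargedParticle) (p : ℕ) (t₁ t₀ : ℝ) (z : Phase) :
    Phase :=
  theta T S (p / 2 - 1) t₁ t₀ z

/-- The ESSRK integrator `Θ_p(t₁, t₀)`, for even `p ≥ 2`, can be evaluated at `z`. -/
def EssrkDefined (T : RKTableau) (S : ChargedParticle) (p : ℕ) (t₁ t₀ : ℝ) (z : Phase) : Prop :=
  ThetaDefined T S (p / 2 - 1) t₁ t₀ z

/-- The alternating composition
`ψ₁(s_{l+1}, s_l) ∘ ψ₂(τ_l, τ_{l-1}) ∘ ψ₁(s_l, s_{l-1}) ∘ ⋯ ∘ ψ₂(τ₁, τ₀) ∘ ψ₁(s₁, s₀)`. -/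
noncomputable def alternating (T : RKTableau) (S : ChargedParticle) (s τ : ℕ → ℝ) :
    ℕ → Phase → Phase
  | 0 => psi₁ S (s 1) (s 0)
  | l + 1 => fun z => psi₁ S (s (l + 2)) (s (l + 1))
      (psi₂ T S (τ (l + 1)) (τ l) (alternating T S s τ l z))

/-- The classical fourth-order Runge–Kutta method. -/
noncomputable def rk4 : RKTableau where
  s := 4
  a := fun i j =>
    if i = 1 ∧ j = 0 then 1 / 2 else if i = 2 ∧ j = 1 then 1 / 2 else
      if i = 3 ∧ j = 2 then 1 else 0
  b := fun i => if i = 0 then 1 / 6 else if i = 1 then 2 / 6 else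
    if i = 2 then 2 / 6 else if i = 3 then 1 / 6 else 0

/-- One step of length `h` from time `t` of the fourth-order ESSRK method, written out in its seven
substeps. -/
noncomputable def essrk4 (S : ChargedParticle) (t h : ℝ) (z : Phase) : Phase :=
  let γ : ℝ := 1 / (2 - (2 : ℝ) ^ (1 / 3 : ℝ))
  let q₁ : Vec := z.1 + (γ * h / 2 / S.m) • z.2
  let z₂ : Phase := psi₂ rk4 S (t + γ * h) t (q₁, z.2)
  let q₃ : Vec := z₂.1 + ((h / 2 - γ * h / 2) / S.m) • z₂.2
  let z₄ : Phase := psi₂ rk4 S (t + (1 - γ) * h) (t + γ * h) (q₃, z₂.2)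
  let q₅ : Vec := z₄.1 + ((h / 2 - γ * h / 2) / S.m) • z₄.2
  let z₆ : Phase := psi₂ rk4 S (t + h) (t + (1 - γ) * h) (q₅, z₄.2)
  (z₆.1 + (γ * h / 2 / S.m) • z₆.2, z₆.2)

/-! ### Explicitness -/

/-- The kinds of quantities that occur in an explicit update. -/
inductive Kind
  | scalar
  | vector
  | matrix

/-- The values of a given kind. -/
abbrev Kind.Val : Kind → Type
  | .scalar => ℝ
  | .vector => Vec
  | .matrix => Mat

/-- Explicit update formulas: finite expressions in the old state `(q, p)`, the times `t₀` and `t₁`,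
the mass, the charge, evaluations of `A`, `A'` and `∇φ` at points and times that are themselves
given by such expressions, real constants, arithmetic, and linear algebra (including the inverse of
a `3 × 3` matrix). No equation has to be solved, and no flow or integral may occur. -/
inductive Formula : Kind → Type
  | const (c : ℝ) : Formula .scalar
  | mass : Formula .scalar
  | charge : Formula .scalar
  | startTime : Formula .scalar
  | endTime : Formula .scalar
  | addS (x y : Formula .scalar) : Formula .scalar
  | mulS (x y : Formula .scalar) : Formula .scalar
  | divS (x y : Formula .scalar) : Formula .scalar
  | pos : Formula .vector
  | mom : Formula .vector
  | evalA (x : Formula .vector) (τ : Formula .scalar) : Formula .vector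
  | evalGradφ (x : Formula .vector) (τ : Formula .scalar) : Formula .vector
  | addV (x y : Formula .vector) : Formula .vector
  | smulV (c : Formula .scalar) (x : Formula .vector) : Formula .vector
  | mulVM (x : Formula .vector) (M : Formula .matrix) : Formula .vector
  | evalJacA (x : Formula .vector) (τ : Formula .scalar) : Formula .matrix
  | one : Formula .matrix
  | addM (M N : Formula .matrix) : Formula .matrix
  | smulM (c : Formula .scalar) (M : Formula .matrix) : Formula .matrix
  | mulM (M N : Formula .matrix) : Formula .matrix
  | invM (M : Formula .matrix) : Formula .matrix

/-- The value of a formula for a given particle, given times and a given old state. -/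
noncomputable def Formula.eval (S : ChargedParticle) (t₁ t₀ : ℝ) (z : Phase) :
    {κ : Kind} → Formula κ → κ.Val
  | _, .const c => c
  | _, .mass => S.m
  | _, .charge => S.e
  | _, .startTime => t₀
  | _, .endTime => t₁
  | _, .addS x y => x.eval S t₁ t₀ z + y.eval S t₁ t₀ z
  | _, .mulS x y => x.eval S t₁ t₀ z * y.eval S t₁ t₀ z
  | _, .divS x y => x.eval S t₁ t₀ z / y.eval S t₁ t₀ z
  | _, .pos => z.1
  | _, .mom => z.2
  | _, .evalA x τ => S.A (x.eval S t₁ t₀ z) (τ.eval S t₁ t₀ z)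
  | _, .evalGradφ x τ => grad (fun y => S.φ y (τ.eval S t₁ t₀ z)) (x.eval S t₁ t₀ z)
  | _, .addV x y => x.eval S t₁ t₀ z + y.eval S t₁ t₀ z
  | _, .smulV c x => c.eval S t₁ t₀ z • x.eval S t₁ t₀ z
  | _, .mulVM x M => Matrix.vecMul (x.eval S t₁ t₀ z) (M.eval S t₁ t₀ z)
  | _, .evalJacA x τ => jac (fun y => S.A y (τ.eval S t₁ t₀ z)) (x.eval S t₁ t₀ z)
  | _, .one => (1 : Mat)
  | _, .addM M N => M.eval S t₁ t₀ z + N.eval S t₁ t₀ z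
  | _, .smulM c M => c.eval S t₁ t₀ z • M.eval S t₁ t₀ z
  | _, .mulM M N => M.eval S t₁ t₀ z * N.eval S t₁ t₀ z
  | _, .invM M => (M.eval S t₁ t₀ z)⁻¹

end ESSRK

open ESSRK

/-! The structure of `psi₂` explains both its order and its symplecticity. To the position equation
`q' = -(e/m) A(q,t)` of `H - H₁` adjoin the variational equation for its Jacobian `J` and the
equation `w' = ∇f J` for the gradient of the action. A Runge–Kutta step for this augmented system
from `(q, I, 0)` produces exactly the new position, the matrix to be inverted and the vector `h ∑ bᵢ
∇lᵢ` (`step_variationField`), and `psi₂` is the image of that step under the smooth map `(Q, J, w) ↦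
(Q, (p - w) J⁻¹)`. The same map sends exact augmented solutions to trajectories of `H - H₁`
(`hasDerivAt_shadow`), so the order of the Runge–Kutta method passes to `psi₂`. For symplecticity,
whatever the order, the matrix is the Jacobian of the discrete position map and the vector is the
gradient of a discrete action `L`. Hence `P · dQ = p · dq - dL`, and the symmetry of the second
derivatives of `Q` and `L` gives invariance of the symplectic form (`isSymplecticAt_of_generating`).

The order of the compositions is proved against smooth approximate flows instead of the exact flow,
so smooth dependence of solutions on initial data is never needed. A family solving the equation up
to `O(h^N)` exists for each `N` (`exists_isApproxFlow`), satisfies the group law up to `O(h^(N+1))`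
(`IsApproxFlow.comp_sub`), and is that close to every genuine trajectory
(`IsApproxFlow.exists_norm_sub_le`). Since `psi₂` is not symmetric, it is first replaced by an
approximate flow of `H - H₁`, at a cost of `O(h^(p+1))` (`agreesTo_composed`). The modified
composition is symmetric to high order. Leading errors of successive substeps add up
(`isBigO_comp_leading`): for a forward step followed by its reverse this shows that a symmetric
scheme of odd order gains an order, and for the triple jump the choice of `γ_p` makes the sum
vanish. Each level therefore gains two orders, starting from the Strang splitting.

Runge–Kutta methods of every order come from Picard iteration with the integrals replaced by
quadrature. The classical method is Simpson's rule with stage errors whose linear effects cancel.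
Explicitness is closure of formulas under substitution, and the alternating form comes from merging
adjacent kinetic shifts. -/

set_option linter.unusedSectionVars false

namespace ESSRK

/-! ### Taylor expansion in the step size, locally uniform in parameters -/

section Taylor

variable {P V : Type*} [NormedAddCommGroup P] [NormedSpace ℝ P] [NormedAddCommGroup V]
  [NormedSpace ℝ V]

/-- The mean value inequality on the segment from `0` to `h`, with the parameter `y` carried along.
Monotonicity of `ρ` in `|h|` lets its value at the endpoint bound the derivative on the whole
segment. -/
theorem isBigO_of_hasDerivAt {G G' : P × ℝ → V} {ρ : P × ℝ → ℝ} {y₀ : P}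
    (hd : ∀ᶠ x in 𝓝 (y₀, (0 : ℝ)), HasDerivAt (fun h => G (x.1, h)) (G' x) x.2)
    (h0 : ∀ᶠ y in 𝓝 y₀, G (y, 0) = 0)
    (hρ : ∀ y h h', |h'| ≤ |h| → |ρ (y, h')| ≤ |ρ (y, h)|)
    (hO : G' =O[𝓝 (y₀, 0)] ρ) : G =O[𝓝 (y₀, 0)] fun x => ρ x * x.2 := by
  obtain ⟨C, hC⟩ := hO.bound
  obtain ⟨U, hU, δ, hδ, H⟩ : ∃ U ∈ 𝓝 y₀, ∃ δ > (0 : ℝ), ∀ y ∈ U, ∀ h : ℝ, |h| < δ →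
      HasDerivAt (fun h => G (y, h)) (G' (y, h)) h ∧ ‖G' (y, h)‖ ≤ C * ‖ρ (y, h)‖ ∧
        G (y, 0) = 0 := by
    have h3 := (hd.and hC).and
      ((continuousAt_fst (p := (y₀, (0 : ℝ)))).eventually h0)
    rw [nhds_prod_eq, eventually_prod_iff] at h3
    obtain ⟨p, hp, q, hq, hpq⟩ := h3
    obtain ⟨δ, hδ, hq⟩ := Metric.eventually_nhds_iff.1 hq
    refine ⟨{y | p y}, hp, δ, hδ, fun y hy h hh => ?_⟩
    have := hpq hy (hq (y := h) (by simpa using hh))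
    exact ⟨this.1.1, this.1.2, this.2⟩
  refine IsBigO.of_bound (max C 0) ?_
  have hn : U ×ˢ Metric.ball (0 : ℝ) δ ∈ 𝓝 (y₀, (0 : ℝ)) :=
    prod_mem_nhds hU (Metric.ball_mem_nhds _ hδ)
  filter_upwards [hn] with x hx
  obtain ⟨y, h⟩ := x
  have hyU : y ∈ U := hx.1
  have hh : |h| < δ := by simpa using hx.2
  have habs : ∀ k ∈ uIcc 0 h, |k| ≤ |h| := fun k hk => by
    simpa using abs_sub_left_of_mem_uIcc hk
  have key := Convex.norm_image_sub_le_of_norm_hasDerivWithin_le (s := uIcc 0 h)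
    (f := fun h => G (y, h)) (f' := fun k => G' (y, k)) (C := max C 0 * |ρ (y, h)|)
    (x := 0) (y := h)
    (fun k hk => (H y hyU k ((habs k hk).trans_lt hh)).1.hasDerivWithinAt)
    (fun k hk => (H y hyU k ((habs k hk).trans_lt hh)).2.1.trans (by
      have := hρ y h k (habs k hk)
      rw [Real.norm_eq_abs]
      gcongr
      exact le_max_left _ _)) (convex_uIcc 0 h) left_mem_uIcc right_mem_uIcc
  have hz := (H y hyU 0 (by simpa using hδ)).2.2
  simp only [hz, sub_zero] at key
  simpa [mul_assoc] using key

/-- The partial derivative with respect to the last, scalar, variable. -/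
noncomputable def partialStep (E : P × ℝ → V) (x : P × ℝ) : V := fderiv ℝ E x (0, 1)

theorem contDiffAt_partialStep {E : P × ℝ → V} {x : P × ℝ} (hE : ContDiffAt ℝ ∞ E x) :
    ContDiffAt ℝ ∞ (partialStep E) x :=
  (hE.fderiv_right (m := ∞) (by simp)).clm_apply contDiffAt_const

theorem hasDerivAt_partialStep {E : P × ℝ → V} {x : P × ℝ} (hE : DifferentiableAt ℝ E x) :
    HasDerivAt (fun h => E (x.1, h)) (partialStep E x) x.2 :=
  hE.hasFDerivAt.comp_hasDerivAt x.2 ((hasDerivAt_const x.2 x.1).prodMk (hasDerivAt_id x.2))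

theorem eventually_differentiableAt {E : P → V} {x : P} (hE : ContDiffAt ℝ ∞ E x) :
    ∀ᶠ y in 𝓝 x, DifferentiableAt ℝ E y :=
  ((hE.of_le (m := 1) (by simp)).eventually (by simp)).mono fun _ h =>
    h.differentiableAt (by simp)

theorem isBigO_sub_of_contDiffAt {E : P → V} {x : P} (hE : ContDiffAt ℝ ∞ E x) :
    (fun p : P × P => E p.1 - E p.2) =O[𝓝 (x, x)] fun p : P × P => p.1 - p.2 :=
  (hE.hasStrictFDerivAt (by simp)).isBigO_sub

theorem isBigO_comp_sub {ι : Type*} {l : Filter ι} {E : P → V} {x : P}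
    (hE : ContDiffAt ℝ ∞ E x) {u v : ι → P} (hu : Tendsto u l (𝓝 x)) (hv : Tendsto v l (𝓝 x)) :
    (fun i => E (u i) - E (v i)) =O[l] fun i => u i - v i :=
  (isBigO_sub_of_contDiffAt hE).comp_tendsto (hu.prodMk_nhds hv)

/-- The Taylor coefficients with respect to the last variable, at `0`. -/
noncomputable def stepCoeff : ℕ → (P × ℝ → V) → P → V
  | 0, E => fun y => E (y, 0)
  | k + 1, E => fun y => (1 / ((k : ℝ) + 1)) • stepCoeff k (partialStep E) y

theorem contDiffAt_stepCoeff {y : P} (k : ℕ) : ∀ {E : P × ℝ → V}, ContDiffAt ℝ ∞ E (y, 0) →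
    ContDiffAt ℝ ∞ (stepCoeff k E) y := by
  induction k with
  | zero =>
    intro E hE
    exact hE.comp y (contDiffAt_id.prodMk contDiffAt_const)
  | succ k ih => exact fun hE => contDiffAt_const.smul (ih (contDiffAt_partialStep hE))

/-- The `h`-derivative of a Taylor remainder is the remainder, one order lower, of the
`h`-derivative. Induction with `isBigO_of_hasDerivAt` therefore keeps the estimate uniform in the
parameter. -/
theorem isBigO_sub_stepCoeff {y₀ : P} (n : ℕ) : ∀ {E : P × ℝ → V}, ContDiffAt ℝ ∞ E (y₀, 0) →
    (fun x => E x - ∑ k ∈ Finset.range n, x.2 ^ k • stepCoeff k E x.1) =O[𝓝 (y₀, 0)]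
      fun x => x.2 ^ n := by
  induction n with
  | zero =>
    intro E hE
    simpa using hE.continuousAt.norm.isBoundedUnder_le.isBigO_one ℝ
  | succ n ih =>
    intro E hE
    have hlip := ih (contDiffAt_partialStep hE)
    have := isBigO_of_hasDerivAt (P := P) (y₀ := y₀)
      (G := fun x => E x - ∑ k ∈ Finset.range (n + 1), x.2 ^ k • stepCoeff k E x.1)
      (G' := fun x => partialStep E x -
        ∑ k ∈ Finset.range n, x.2 ^ k • stepCoeff k (partialStep E) x.1)
      (ρ := fun x => x.2 ^ n) ?_ ?_ ?_ hlip
    · simpa [pow_succ] using this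
    · filter_upwards [eventually_differentiableAt hE] with x hx
      refine (hasDerivAt_partialStep hx).sub ?_
      simp only [Finset.sum_range_succ' _ n, pow_zero, one_smul]
      rw [← add_zero (∑ k ∈ Finset.range n, _)]
      refine HasDerivAt.add (HasDerivAt.fun_sum fun k _ => ?_) (hasDerivAt_const _ _)
      have := (hasDerivAt_pow (k + 1) x.2).smul_const (stepCoeff (k + 1) E x.1)
      convert! this using 1
      simp only [stepCoeff, smul_smul]
      congr 1
      push_cast
      have : (k : ℝ) + 1 ≠ 0 := by positivity
      simp
      field_simp
    · refine Eventually.of_forall fun y => ?_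
      simp [Finset.sum_range_succ', stepCoeff]
    · intro y h h' hh
      simp only [abs_pow]
      gcongr

theorem eq_zero_of_sum_pow_isBigO (n : ℕ) : ∀ (c : ℕ → V),
    (fun h : ℝ => ∑ k ∈ Finset.range n, h ^ k • c k) =O[𝓝[≠] 0] (fun h => h ^ n) →
    ∀ k < n, c k = 0 := by
  induction n with
  | zero => simp
  | succ n ih =>
    intro c hc
    have h1 : Tendsto (fun h : ℝ => ∑ k ∈ Finset.range (n + 1), h ^ k • c k) (𝓝[≠] 0) (𝓝 (c 0)) := by
      have : Continuous (fun h : ℝ => ∑ k ∈ Finset.range (n + 1), h ^ k • c k) := by fun_prop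
      have := this.tendsto 0
      simp only [Finset.sum_range_succ', pow_zero, one_smul] at this ⊢
      simpa using this.mono_left nhdsWithin_le_nhds
    have h2 : Tendsto (fun h : ℝ => h ^ (n + 1)) (𝓝[≠] 0) (𝓝 0) := by
      have : Continuous fun h : ℝ => h ^ (n + 1) := by fun_prop
      simpa using (this.tendsto 0).mono_left nhdsWithin_le_nhds
    have hc0 : c 0 = 0 := tendsto_nhds_unique h1 (hc.trans_tendsto h2)
    have h3 := ih (fun k => c (k + 1)) (by
      have : (fun h : ℝ => h⁻¹ • ∑ k ∈ Finset.range (n + 1), h ^ k • c k) =O[𝓝[≠] 0]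
          fun h => h⁻¹ • h ^ (n + 1) := (isBigO_refl _ _).smul hc
      refine (this.congr' ?_ ?_)
      · filter_upwards [self_mem_nhdsWithin] with h hh
        have hh : h ≠ 0 := hh
        simp only [Finset.sum_range_succ', hc0, smul_zero, add_zero, Finset.smul_sum, smul_smul]
        refine Finset.sum_congr rfl fun k _ => ?_
        congr 1
        rw [pow_succ']
        field_simp
      · filter_upwards [self_mem_nhdsWithin] with h hh
        have hh : h ≠ 0 := hh
        simp only [smul_eq_mul]
        rw [pow_succ']
        field_simp)
    intro k hk
    cases k with
    | zero => exact hc0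
    | succ k => exact h3 k (by omega)

theorem stepCoeff_eq_zero {E : P × ℝ → V} {y : P} {n : ℕ} (hE : ContDiffAt ℝ ∞ E (y, 0))
    (h : (fun h => E (y, h)) =O[𝓝 0] fun h : ℝ => h ^ n) : ∀ k < n, stepCoeff k E y = 0 := by
  refine eq_zero_of_sum_pow_isBigO n _ ?_
  have ht : Tendsto (fun h : ℝ => (y, h)) (𝓝 0) (𝓝 (y, 0)) :=
    (Continuous.prodMk_right y).tendsto 0
  have h1 := (isBigO_sub_stepCoeff n hE).comp_tendsto ht
  have h2 := h.sub h1
  refine (h2.mono nhdsWithin_le_nhds).congr_left fun h => ?_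
  simp

/-- A smooth function that is `O(h^n)` for each value of the parameter in an open set is so locally
uniformly, and has a leading coefficient of order `n`. -/
theorem isBigO_sub_leading {E : P × ℝ → V} {W : Set P} (hW : IsOpen W)
    (hE : ∀ y ∈ W, ContDiffAt ℝ ∞ E (y, 0)) {n : ℕ}
    (h : ∀ y ∈ W, (fun h => E (y, h)) =O[𝓝 0] fun h : ℝ => h ^ n) {y₀ : P} (hy : y₀ ∈ W) :
    (fun x => E x - x.2 ^ n • stepCoeff n E x.1) =O[𝓝 (y₀, 0)] fun x => x.2 ^ (n + 1) := by
  refine (isBigO_sub_stepCoeff (n + 1) (hE y₀ hy)).congr' ?_ EventuallyEq.rfl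
  filter_upwards [continuousAt_fst.preimage_mem_nhds (hW.mem_nhds hy)] with x hx
  rw [Finset.sum_range_succ, Finset.sum_eq_zero, zero_add]
  intro k hk
  rw [stepCoeff_eq_zero (hE x.1 hx) (h x.1 hx) k (Finset.mem_range.1 hk), smul_zero]

/-- The order of a Runge–Kutta method is a statement about one initial value at a time. For a smooth
error, pointwise bounds kill all low Taylor coefficients on the open set `W`, and the uniform
remainder is all that is left. -/
theorem isBigO_of_pointwise {E : P × ℝ → V} {W : Set P} (hW : IsOpen W)
    (hE : ∀ y ∈ W, ContDiffAt ℝ ∞ E (y, 0)) {n : ℕ}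
    (h : ∀ y ∈ W, (fun h => E (y, h)) =O[𝓝 0] fun h : ℝ => h ^ n) {y₀ : P} (hy : y₀ ∈ W) :
    E =O[𝓝 (y₀, 0)] fun x => x.2 ^ n := by
  refine (isBigO_sub_stepCoeff n (hE y₀ hy)).congr' ?_ EventuallyEq.rfl
  filter_upwards [continuousAt_fst.preimage_mem_nhds (hW.mem_nhds hy)] with x hx
  rw [Finset.sum_eq_zero, sub_zero]
  intro k hk
  rw [stepCoeff_eq_zero (hE x.1 hx) (h x.1 hx) k (Finset.mem_range.1 hk), smul_zero]

/-- A bootstrap form of Grönwall's inequality. -/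
theorem isBigO_of_hasDerivAt_self {e e' : P × ℝ → V} {θ : P → ℝ} {y₀ : P} {N : ℕ}
    (hd : ∀ᶠ x in 𝓝 (y₀, (0 : ℝ)), HasDerivAt (fun h => e (x.1, h)) (e' x) x.2)
    (h0 : ∀ᶠ y in 𝓝 y₀, e (y, 0) = 0) (hb : e =O[𝓝 (y₀, 0)] fun _ => (1 : ℝ))
    (hθ : ContinuousAt θ y₀)
    (hO : e' =O[𝓝 (y₀, 0)] fun x => ‖e x‖ + (|θ x.1| + |x.2|) ^ N) :
    e =O[𝓝 (y₀, 0)] fun x => (|θ x.1| + |x.2|) ^ (N + 1) := by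
  set ρ : P × ℝ → ℝ := fun x => |θ x.1| + |x.2| with hρ
  have hρ0 : ∀ x, 0 ≤ ρ x := fun x => by positivity
  have hρ1 : ρ =O[𝓝 (y₀, 0)] fun _ => (1 : ℝ) := by
    have : ContinuousAt ρ (y₀, 0) := by
      have : ContinuousAt (fun x : P × ℝ => θ x.1) (y₀, 0) :=
        ContinuousAt.comp (f := Prod.fst) (g := θ) hθ continuousAt_fst
      fun_prop
    exact this.norm.isBoundedUnder_le.isBigO_one ℝ
  -- Start from mere boundedness; each integration of the derivative bound wins one power of `ρ`,
  -- until the inhomogeneous term `ρ ^ N` stops the gain at `N + 1`. No exponential is needed.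
  suffices H : ∀ m ≤ N + 1, e =O[𝓝 (y₀, 0)] fun x => ρ x ^ m from H _ le_rfl
  intro m
  induction m with
  | zero => simpa using hb
  | succ m ih =>
    intro hm
    have h1 : (fun x => ρ x ^ N) =O[𝓝 (y₀, 0)] fun x => ρ x ^ m := by
      obtain ⟨j, rfl⟩ := Nat.exists_eq_add_of_le (show m ≤ N by omega)
      simpa [pow_add] using (isBigO_refl (fun x => ρ x ^ m) _).mul (hρ1.pow j)
    have h2 : e' =O[𝓝 (y₀, 0)] fun x => ρ x ^ m := hO.trans ((ih (by omega)).norm_left.add h1)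
    refine (isBigO_of_hasDerivAt hd h0 ?_ h2).trans ?_
    · intro y h h' hh
      rw [abs_of_nonneg (pow_nonneg (hρ0 _) _), abs_of_nonneg (pow_nonneg (hρ0 _) _)]
      simp only [hρ]
      gcongr
    · simp only [pow_succ]
      refine (isBigO_refl _ _).mul (IsBigO.of_bound 1 (Eventually.of_forall fun x => ?_))
      rw [one_mul, Real.norm_eq_abs, Real.norm_of_nonneg (hρ0 x)]
      simp [hρ]

end Taylor

/-! ### Step maps and approximate flows -/

section StepMaps

variable {E : Type*} [NormedAddCommGroup E] [NormedSpace ℝ E]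

/-- A family `Φ ((t, z), h)` of maps `z ↦ Φ ((t, z), h)`, smooth near `h = 0` and equal to the
identity for `h = 0`, for `(t, z)` in the set `W`. -/
structure IsStepMap (W : Set (ℝ × E)) (Φ : (ℝ × E) × ℝ → E) : Prop where
  contDiffAt : ∀ y ∈ W, ContDiffAt ℝ ∞ Φ (y, 0)
  apply_zero : ∀ y ∈ W, Φ (y, 0) = y.2

/-- `Φ` and `Ψ` agree up to `O(h^n)`, locally uniformly on `W`. -/
def AgreesTo (W : Set (ℝ × E)) (n : ℕ) (Φ Ψ : (ℝ × E) × ℝ → E) : Prop :=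
  ∀ y ∈ W, (fun x => Φ x - Ψ x) =O[𝓝 (y, 0)] fun x => x.2 ^ n

/-- A step map that satisfies the differential equation `z' = X (t, z)` up to `O(h^N)`. -/
structure IsApproxFlow (W : Set (ℝ × E)) (X : ℝ × E → E) (N : ℕ) (R : (ℝ × E) × ℝ → E) : Prop
    extends IsStepMap W R where
  defect : ∀ y ∈ W,
    (fun x => partialStep R x - X (x.1.1 + x.2, R x)) =O[𝓝 (y, 0)] fun x => x.2 ^ N

variable {W : Set (ℝ × E)} {X : ℝ × E → E} {N : ℕ} {R Φ Ψ : (ℝ × E) × ℝ → E}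

theorem AgreesTo.mono {m n : ℕ} (h : AgreesTo W n Φ Ψ) (hmn : m ≤ n) : AgreesTo W m Φ Ψ := by
  intro y hy
  refine (h y hy).trans ?_
  have : (fun x : (ℝ × E) × ℝ => x.2) =O[𝓝 (y, 0)] fun _ => (1 : ℝ) :=
    (continuousAt_snd (p := (y, (0 : ℝ)))).norm.isBoundedUnder_le.isBigO_one ℝ
  obtain ⟨j, rfl⟩ := Nat.exists_eq_add_of_le hmn
  simpa [pow_add] using (isBigO_refl (fun x : (ℝ × E) × ℝ => x.2 ^ m) _).mul (this.pow j)

theorem AgreesTo.trans {n : ℕ} {Θ : (ℝ × E) × ℝ → E} (h : AgreesTo W n Φ Ψ)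
    (h' : AgreesTo W n Ψ Θ) : AgreesTo W n Φ Θ := fun y hy =>
  ((h y hy).add (h' y hy)).congr_left fun _ => sub_add_sub_cancel _ _ _

/-- The point of space-time that is reached from `(t, z)` by `Ψ` after the time `a h`. -/
def reached (a : ℝ) (Ψ : (ℝ × E) × ℝ → E) (x : (ℝ × E) × ℝ) : ℝ × E := (x.1.1 + a * x.2, Ψ x)

theorem tendsto_reached {y : ℝ × E} (a b : ℝ) (hc : ContinuousAt Ψ (y, 0)) (h0 : Ψ (y, 0) = y.2) :
    Tendsto (fun x => (reached a Ψ x, b * x.2)) (𝓝 (y, 0)) (𝓝 (y, 0)) := by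
  have : ContinuousAt (fun x => (reached a Ψ x, b * x.2)) (y, (0 : ℝ)) := by
    unfold reached; fun_prop
  have h1 := this.tendsto
  simpa [reached, h0] using h1

theorem isBigO_comp_reached {y : ℝ × E} (a b : ℝ) (hc : ContinuousAt Ψ (y, 0))
    (h0 : Ψ (y, 0) = y.2) {n : ℕ} {V : Type*} [NormedAddCommGroup V] {F : (ℝ × E) × ℝ → V}
    (hF : F =O[𝓝 (y, 0)] fun x => x.2 ^ n) :
    (fun x => F (reached a Ψ x, b * x.2)) =O[𝓝 (y, 0)] fun x => x.2 ^ n := by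
  refine (hF.comp_tendsto (tendsto_reached a b hc h0)).trans ?_
  simp only [Function.comp_def, mul_pow]
  exact isBigO_const_mul_self _ _ _

/-- Successive correction: if the defect of `R` is `h^N c + O(h^(N+1))`, then subtracting
`h^(N+1)/(N+1) c` removes the leading term, because this correction has `h`-derivative `h^N c` and
changes `X` along `R` only by `O(h^(N+1))`. -/
theorem exists_isApproxFlow (hW : IsOpen W) (hX : ∀ y ∈ W, ContDiffAt ℝ ∞ X y) (N : ℕ) :
    ∃ R, IsApproxFlow W X N R := by
  induction N with
  | zero =>
    have h1 : ∀ y : ℝ × E, ContDiffAt ℝ ∞ (fun x : (ℝ × E) × ℝ => x.1.2) (y, 0) := fun y => by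
      fun_prop
    refine ⟨fun x => x.1.2, ⟨fun y _ => h1 y, fun _ _ => rfl⟩, fun y hy => ?_⟩
    have h2 : ContDiffAt ℝ ∞ (fun x : (ℝ × E) × ℝ => X (x.1.1 + x.2, x.1.2)) (y, 0) := by
      refine ContDiffAt.comp (y, (0 : ℝ)) (g := X) ?_ (by fun_prop)
      simpa using hX y hy
    simpa using (((contDiffAt_partialStep (h1 y)).sub h2).continuousAt).norm.isBoundedUnder_le.isBigO_one ℝ
  | succ N ih =>
    obtain ⟨R, hR⟩ := ih
    set D : (ℝ × E) × ℝ → E := fun x => partialStep R x - X (x.1.1 + x.2, R x) with hD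
    have hDs : ∀ y ∈ W, ContDiffAt ℝ ∞ D (y, 0) := fun y hy => by
      refine (contDiffAt_partialStep (hR.contDiffAt y hy)).sub ?_
      have := hR.contDiffAt y hy
      refine ContDiffAt.comp (y, (0 : ℝ)) (g := X) ?_ (by fun_prop)
      simpa [hR.apply_zero y hy] using hX y hy
    have hDp : ∀ y ∈ W, (fun h => D (y, h)) =O[𝓝 0] fun h : ℝ => h ^ N := fun y hy =>
      (hR.defect y hy).comp_tendsto ((Continuous.prodMk_right y).tendsto 0)
    set c := stepCoeff N D with hc
    have hcs : ∀ y ∈ W, ContDiffAt ℝ ∞ c y := fun y hy => contDiffAt_stepCoeff N (hDs y hy)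
    set S : (ℝ × E) × ℝ → E := fun x => (x.2 ^ (N + 1) / ((N : ℝ) + 1)) • c x.1 with hS
    have hSs : ∀ y ∈ W, ContDiffAt ℝ ∞ S (y, 0) := fun y hy => by
      have : ContDiffAt ℝ ∞ (fun x : (ℝ × E) × ℝ => c x.1) (y, 0) :=
        ContDiffAt.comp (y, (0 : ℝ)) (g := c) (hcs y hy) (by fun_prop)
      exact ContDiffAt.smul (by fun_prop) this
    have hRS : ∀ y ∈ W, ContDiffAt ℝ ∞ (fun x => R x - S x) (y, 0) := fun y hy =>
      (hR.contDiffAt y hy).sub (hSs y hy)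
    refine ⟨fun x => R x - S x, ⟨hRS, fun y hy => by simp [hR.apply_zero y hy, hS]⟩, fun y hy => ?_⟩
    have h1 := isBigO_sub_leading hW hDs hDp hy
    have hb : (fun x : (ℝ × E) × ℝ => c x.1) =O[𝓝 (y, 0)] fun _ => (1 : ℝ) := by
      have : ContDiffAt ℝ ∞ (fun x : (ℝ × E) × ℝ => c x.1) (y, 0) :=
        ContDiffAt.comp (y, (0 : ℝ)) (g := c) (hcs y hy) (by fun_prop)
      exact this.continuousAt.norm.isBoundedUnder_le.isBigO_one ℝ
    have hSO : S =O[𝓝 (y, 0)] fun x => x.2 ^ (N + 1) := by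
      have : (fun x : (ℝ × E) × ℝ => x.2 ^ (N + 1) / ((N : ℝ) + 1)) =O[𝓝 (y, 0)]
          fun x => x.2 ^ (N + 1) := by
        simp only [div_eq_inv_mul]
        exact isBigO_const_mul_self _ _ _
      simpa using this.smul hb
    have h2 : (fun x => X (x.1.1 + x.2, R x) - X (x.1.1 + x.2, R x - S x)) =O[𝓝 (y, 0)]
        fun x => x.2 ^ (N + 1) := by
      have e1 : Tendsto (fun x : (ℝ × E) × ℝ => (x.1.1 + x.2, R x)) (𝓝 (y, 0)) (𝓝 y) := by
        have := (hR.contDiffAt y hy).continuousAt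
        have : ContinuousAt (fun x : (ℝ × E) × ℝ => (x.1.1 + x.2, R x)) (y, 0) := by fun_prop
        simpa [hR.apply_zero y hy] using this.tendsto
      have e2 : Tendsto (fun x : (ℝ × E) × ℝ => (x.1.1 + x.2, R x - S x)) (𝓝 (y, 0)) (𝓝 y) := by
        have := (hRS y hy).continuousAt
        have : ContinuousAt (fun x : (ℝ × E) × ℝ => (x.1.1 + x.2, R x - S x)) (y, 0) := by
          fun_prop
        simpa [hR.apply_zero y hy, hS] using this.tendsto
      refine (isBigO_comp_sub (hX y hy) e1 e2).trans ?_
      refine IsBigO.trans (IsBigO.of_bound 1 (Eventually.of_forall fun x => ?_)) hSO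
      simp
    refine (h1.add h2).congr' ?_ EventuallyEq.rfl
    filter_upwards [eventually_differentiableAt (hR.contDiffAt y hy),
      eventually_differentiableAt (hSs y hy)] with x hx1 hx2
    have h3 : partialStep (fun x => R x - S x) x = partialStep R x - partialStep S x := by
      simp [partialStep, fderiv_fun_sub hx1 hx2]
    have h4 : partialStep S x = x.2 ^ N • c x.1 := by
      refine (hasDerivAt_partialStep hx2).unique ?_
      have := ((hasDerivAt_pow (N + 1) x.2).div_const ((N : ℝ) + 1)).smul_const (c x.1)
      convert! this using 2
      push_cast
      have : (N : ℝ) + 1 ≠ 0 := by positivity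
      field_simp
    rw [h3, h4]
    simp only [hD]
    abel

/-- Approximate flows obey the group law approximately. -/
theorem IsApproxFlow.comp_sub (hW : IsOpen W) (hX : ∀ y ∈ W, ContDiffAt ℝ ∞ X y)
    (hR : IsApproxFlow W X N R) (a b : ℝ) {y : ℝ × E} (hy : y ∈ W) :
    (fun x => R (reached a (fun x => R (x.1, a * x.2)) x, b * x.2) - R (x.1, (a + b) * x.2))
      =O[𝓝 (y, 0)] fun x => x.2 ^ (N + 1) := by
  have hRc := (hR.contDiffAt y hy).continuousAt
  have hR0 := hR.apply_zero y hy
  -- The two step lengths are made independent: the first is part of the parameter, the second is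
  -- the integration variable. Both sides then solve the same equation in the second length up to a
  -- small defect and agree when it is `0`, so the bootstrap lemma applies; `(a h, b h)` is
  -- substituted at the end.
  let g : ((ℝ × E) × ℝ) × ℝ → (ℝ × E) × ℝ := fun w => (reached 1 R w.1, w.2)
  let g' : ((ℝ × E) × ℝ) × ℝ → (ℝ × E) × ℝ := fun w => (w.1.1, w.1.2 + w.2)
  have hg : Tendsto g (𝓝 ((y, 0), 0)) (𝓝 (y, 0)) := by
    have : ContinuousAt g ((y, (0 : ℝ)), (0 : ℝ)) := by
      have : ContinuousAt (fun w : ((ℝ × E) × ℝ) × ℝ => R w.1) ((y, (0 : ℝ)), (0 : ℝ)) :=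
        ContinuousAt.comp (g := R) (f := Prod.fst) hRc continuousAt_fst
      simp only [g, reached]; fun_prop
    simpa [g, reached, hR0] using this.tendsto
  have hg' : Tendsto g' (𝓝 ((y, 0), 0)) (𝓝 (y, 0)) := by
    have : ContinuousAt g' ((y, (0 : ℝ)), (0 : ℝ)) := by
      simp only [g']; fun_prop
    simpa [g'] using this.tendsto
  have hdR := eventually_differentiableAt (hR.contDiffAt y hy)
  have h0' : ContinuousAt (fun x => R (reached 0 (fun x => x.1.2) x, x.2)) (y, (0 : ℝ)) := by
    refine ContinuousAt.comp (g := R) (by simpa [reached] using hRc) ?_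
    simp only [reached]; fun_prop
  have hRg : Tendsto (fun w => R (g w)) (𝓝 ((y, 0), 0)) (𝓝 y.2) := by
    simpa [hR0] using! hRc.tendsto.comp hg
  have hRg' : Tendsto (fun w => R (g' w)) (𝓝 ((y, 0), 0)) (𝓝 y.2) := by
    simpa [hR0] using! hRc.tendsto.comp hg'
  have hsum : Tendsto (fun w : ((ℝ × E) × ℝ) × ℝ => w.1.1.1 + w.1.2 + w.2) (𝓝 ((y, 0), 0))
      (𝓝 y.1) := by
    have : Continuous (fun w : ((ℝ × E) × ℝ) × ℝ => w.1.1.1 + w.1.2 + w.2) := by fun_prop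
    simpa using this.tendsto ((y, 0), 0)
  have key := isBigO_of_hasDerivAt_self (P := (ℝ × E) × ℝ) (y₀ := (y, (0 : ℝ))) (N := N)
    (e := fun w => R (g w) - R (g' w))
    (e' := fun w => partialStep R (g w) - partialStep R (g' w)) (θ := fun x => x.2) ?_ ?_ ?_ ?_ ?_
  · have ht : Tendsto (fun x : (ℝ × E) × ℝ => ((x.1, a * x.2), b * x.2)) (𝓝 (y, 0))
        (𝓝 ((y, 0), 0)) := by
      have : Continuous (fun x : (ℝ × E) × ℝ => ((x.1, a * x.2), b * x.2)) := by fun_prop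
      simpa using this.tendsto (y, 0)
    have := key.comp_tendsto ht
    refine (this.trans ?_).congr_left ?_
    · refine IsBigO.of_bound ((|a| + |b|) ^ (N + 1)) (Eventually.of_forall fun x => ?_)
      simp only [Function.comp, abs_mul, norm_pow, Real.norm_eq_abs, ← mul_pow]
      rw [← add_mul, abs_mul, abs_abs, abs_of_nonneg (by positivity : 0 ≤ |a| + |b|)]
    · intro x
      simp [g, g', reached, add_mul]
  · filter_upwards [hg.eventually hdR, hg'.eventually hdR] with w h1 h2
    refine (hasDerivAt_partialStep h1).sub ?_
    have := (hasDerivAt_partialStep h2).comp_const_add w.1.2 w.2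
    exact this
  · have hc : Tendsto (fun x => reached 1 R x) (𝓝 (y, 0)) (𝓝 y) := by
      have := (continuous_fst.tendsto _).comp (tendsto_reached 1 1 hRc hR0)
      exact this
    filter_upwards [hc.eventually (hW.mem_nhds hy)] with x hx
    simp only [g, g', add_zero, hR.apply_zero _ hx]
    simp [reached]
  · have : Tendsto (fun w => R (g w) - R (g' w)) (𝓝 ((y, 0), 0)) (𝓝 (y.2 - y.2)) := hRg.sub hRg'
    exact this.norm.isBoundedUnder_le.isBigO_one ℝ
  · exact continuousAt_snd
  · have e1 := (hR.defect y hy).comp_tendsto hg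
    have e2 := (hR.defect y hy).comp_tendsto hg'
    have e3 := isBigO_comp_sub (hX y hy) (hsum.prodMk_nhds hRg) (hsum.prodMk_nhds hRg')
    set T : ((ℝ × E) × ℝ) × ℝ → ℝ := fun w => ‖R (g w) - R (g' w)‖ + (|w.1.2| + |w.2|) ^ N
    have b1 : (fun w : ((ℝ × E) × ℝ) × ℝ => w.2 ^ N) =O[𝓝 ((y, 0), 0)] T := by
      refine IsBigO.of_bound 1 (Eventually.of_forall fun w => ?_)
      rw [one_mul, norm_pow, Real.norm_eq_abs, Real.norm_of_nonneg (by positivity)]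
      refine le_add_of_nonneg_of_le (norm_nonneg _) ?_
      gcongr
      exact le_add_of_nonneg_left (abs_nonneg _)
    have b2 : (fun w : ((ℝ × E) × ℝ) × ℝ => (w.1.2 + w.2) ^ N) =O[𝓝 ((y, 0), 0)] T := by
      refine IsBigO.of_bound 1 (Eventually.of_forall fun w => ?_)
      rw [one_mul, norm_pow, Real.norm_eq_abs, Real.norm_of_nonneg (by positivity)]
      refine le_add_of_nonneg_of_le (norm_nonneg _) ?_
      gcongr
      exact abs_add_le _ _
    have b3 : (fun w : ((ℝ × E) × ℝ) × ℝ =>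
        ((w.1.1.1 + w.1.2 + w.2, R (g w)) : ℝ × E) - (w.1.1.1 + w.1.2 + w.2, R (g' w)))
        =O[𝓝 ((y, 0), 0)] T := by
      refine IsBigO.of_bound 1 (Eventually.of_forall fun w => ?_)
      rw [one_mul, Real.norm_of_nonneg (r := T w) (by positivity)]
      simp only [Prod.mk_sub_mk, sub_self, Prod.norm_mk, norm_zero]
      rw [max_eq_right (norm_nonneg _)]
      exact le_add_of_nonneg_right (by positivity)
    refine (((e1.trans b1).sub (e2.trans b2)).add (e3.trans b3)).congr_left fun w => ?_
    simp only [Function.comp, g, g', reached, one_mul, add_assoc]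
    abel

end StepMaps

/-! ### Errors of compositions: leading terms, symmetry, triple jump -/

section Composition

variable {E : Type*} [NormedAddCommGroup E] [NormedSpace ℝ E]
variable {W : Set (ℝ × E)} {X : ℝ × E → E} {N : ℕ} {R Φ Ψ A A' B B' : (ℝ × E) × ℝ → E}

theorem IsStepMap.continuousAt (hΦ : IsStepMap W Φ) {y : ℝ × E} (hy : y ∈ W) :
    ContinuousAt Φ (y, 0) := (hΦ.contDiffAt y hy).continuousAt

theorem contDiffAt_reached {y : ℝ × E} (a : ℝ) (hΨ : ContDiffAt ℝ ∞ Ψ (y, 0)) :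
    ContDiffAt ℝ ∞ (reached a Ψ) (y, 0) := by
  unfold reached; fun_prop

theorem IsStepMap.comp_reached (hΦ : IsStepMap W Φ) (hΨ : IsStepMap W Ψ) (a b : ℝ) :
    IsStepMap W fun x => Φ (reached a Ψ x, b * x.2) := by
  have h0 : ∀ y ∈ W, (reached a Ψ (y, 0), b * (0 : ℝ)) = (y, 0) := fun y hy => by
    simp [reached, hΨ.apply_zero y hy]
  refine ⟨fun y hy => ?_, fun y hy => ?_⟩
  · refine ContDiffAt.comp (y, (0 : ℝ)) (g := Φ) ?_
      ((contDiffAt_reached a (hΨ.contDiffAt y hy)).prodMk (by fun_prop))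
    rw [h0 y hy]
    exact hΦ.contDiffAt y hy
  · simp only [h0 y hy, hΦ.apply_zero y hy]

theorem isStepMap_snd : IsStepMap W fun x => x.1.2 :=
  ⟨fun _ _ => by fun_prop, fun _ _ => rfl⟩

theorem reached_zero_snd (x : (ℝ × E) × ℝ) : reached 0 (fun x => x.1.2) x = x.1 := by
  simp [reached]

theorem IsStepMap.scale (hΦ : IsStepMap W Φ) (a : ℝ) : IsStepMap W fun x => Φ (x.1, a * x.2) := by
  simpa only [reached_zero_snd] using hΦ.comp_reached isStepMap_snd 0 a

/-- Two evaluations of a step map at neighbouring points. -/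
theorem IsStepMap.isBigO_sub_comp {ι : Type*} {l : Filter ι} (hΦ : IsStepMap W Φ) {y : ℝ × E}
    (hy : y ∈ W) {s k : ι → ℝ} {u v : ι → E} (hs : Tendsto s l (𝓝 y.1)) (hk : Tendsto k l (𝓝 0))
    (hu : Tendsto u l (𝓝 y.2)) (hv : Tendsto v l (𝓝 y.2)) :
    (fun i => Φ ((s i, u i), k i) - Φ ((s i, v i), k i)) =O[l] fun i => u i - v i := by
  refine (isBigO_comp_sub (hΦ.contDiffAt y hy) ((hs.prodMk_nhds hu).prodMk_nhds hk)
    ((hs.prodMk_nhds hv).prodMk_nhds hk)).trans (IsBigO.of_bound 1 (Eventually.of_forall fun i => ?_))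
  simp

/-- A step map differs from the identity by a map with Lipschitz constant `O(h)`. -/
theorem IsStepMap.isBigO_displacement_sub (hW : IsOpen W) (hΦ : IsStepMap W Φ) {y : ℝ × E}
    (hy : y ∈ W) :
    (fun w : ((ℝ × E) × (ℝ × E)) × ℝ =>
      (Φ (w.1.1, w.2) - w.1.1.2) - (Φ (w.1.2, w.2) - w.1.2.2)) =O[𝓝 ((y, y), 0)]
      fun w => ‖w.1.1 - w.1.2‖ * w.2 := by
  have t1 : Tendsto (fun w : ((ℝ × E) × (ℝ × E)) × ℝ => (w.1.1, w.2)) (𝓝 ((y, y), 0))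
      (𝓝 (y, 0)) := by
    have : Continuous (fun w : ((ℝ × E) × (ℝ × E)) × ℝ => (w.1.1, w.2)) := by fun_prop
    exact this.tendsto ((y, y), 0)
  have t2 : Tendsto (fun w : ((ℝ × E) × (ℝ × E)) × ℝ => (w.1.2, w.2)) (𝓝 ((y, y), 0))
      (𝓝 (y, 0)) := by
    have : Continuous (fun w : ((ℝ × E) × (ℝ × E)) × ℝ => (w.1.2, w.2)) := by fun_prop
    exact this.tendsto ((y, y), 0)
  have hd := eventually_differentiableAt (hΦ.contDiffAt y hy)
  refine isBigO_of_hasDerivAt (P := (ℝ × E) × (ℝ × E)) (y₀ := (y, y))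
    (G' := fun w => partialStep Φ (w.1.1, w.2) - partialStep Φ (w.1.2, w.2))
    (ρ := fun w => ‖w.1.1 - w.1.2‖) ?_ ?_ (fun _ _ _ _ => le_rfl) ?_
  · filter_upwards [t1.eventually hd, t2.eventually hd] with w h1 h2
    exact ((hasDerivAt_partialStep h1).sub_const _).sub ((hasDerivAt_partialStep h2).sub_const _)
  · have hWn := hW.mem_nhds hy
    filter_upwards [prod_mem_nhds hWn hWn] with w hw
    simp [hΦ.apply_zero _ hw.1, hΦ.apply_zero _ hw.2]
  · refine (isBigO_comp_sub (contDiffAt_partialStep (hΦ.contDiffAt y hy)) t1 t2).trans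
      (IsBigO.of_bound 1 (Eventually.of_forall fun w => ?_))
    simp

theorem IsStepMap.isBigO_sub_snd (hW : IsOpen W) (hΦ : IsStepMap W Φ) {y : ℝ × E} (hy : y ∈ W) :
    (fun x => Φ x - x.1.2) =O[𝓝 (y, 0)] fun x => x.2 := by
  have h := isBigO_of_pointwise (n := 1) hW (E := fun x => Φ x - x.1.2)
    (fun y hy => (hΦ.contDiffAt y hy).sub (by fun_prop)) (fun y hy => ?_) hy
  · simpa using h
  · have hd : DifferentiableAt ℝ (fun h : ℝ => Φ (y, h)) 0 :=
      ((hΦ.contDiffAt y hy).differentiableAt (by simp)).comp 0 (by fun_prop)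
    simpa [hΦ.apply_zero y hy] using hd.isBigO_sub

/-- Leading errors add. The earlier error is transported by a near-identity map, which alters it by
a factor `1 + O(h)`; the new step contributes `(b h)^(q+1)` times its error coefficient, and
evaluating that coefficient at the reached point instead of the initial one costs another factor
`h`. So `κ` simply becomes `κ + b^(q+1)`. -/
theorem isBigO_comp_leading (hW : IsOpen W) (hR : IsStepMap W R) (hΦ : IsStepMap W Φ) {q : ℕ}
    (hgroup : ∀ a b : ℝ, ∀ y ∈ W,
      (fun x => R (reached a (fun x => R (x.1, a * x.2)) x, b * x.2) - R (x.1, (a + b) * x.2))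
        =O[𝓝 (y, 0)] fun x => x.2 ^ (q + 2))
    (hD : AgreesTo W (q + 1) Φ R) (hΨ : IsStepMap W Ψ) (a b κ : ℝ) {y : ℝ × E} (hy : y ∈ W)
    (h : (fun x => Ψ x - R (x.1, a * x.2) -
      (κ * x.2 ^ (q + 1)) • stepCoeff (q + 1) (fun x => Φ x - R x) x.1)
        =O[𝓝 (y, 0)] fun x => x.2 ^ (q + 2)) :
    (fun x => Φ (reached a Ψ x, b * x.2) - R (x.1, (a + b) * x.2) -
      ((κ + b ^ (q + 1)) * x.2 ^ (q + 1)) • stepCoeff (q + 1) (fun x => Φ x - R x) x.1)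
        =O[𝓝 (y, 0)] fun x => x.2 ^ (q + 2) := by
  set D : (ℝ × E) × ℝ → E := fun x => Φ x - R x with hDdef
  have hDs : ∀ y ∈ W, ContDiffAt ℝ ∞ D (y, 0) := fun y hy =>
    (hΦ.contDiffAt y hy).sub (hR.contDiffAt y hy)
  have hDp : ∀ y ∈ W, (fun h => D (y, h)) =O[𝓝 0] fun h : ℝ => h ^ (q + 1) := fun y hy =>
    (hD y hy).comp_tendsto ((Continuous.prodMk_right y).tendsto 0)
  set c := stepCoeff (q + 1) D with hc
  have hcs : ContDiffAt ℝ ∞ c y := contDiffAt_stepCoeff _ (hDs y hy)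
  have hRa := hR.scale a
  have t1 := tendsto_reached a b (hΨ.continuousAt hy) (hΨ.apply_zero y hy)
  have t2 := tendsto_reached a b (hRa.continuousAt hy) (hRa.apply_zero y hy)
  have hcb : (fun x : (ℝ × E) × ℝ => c x.1) =O[𝓝 (y, 0)] fun _ => (1 : ℝ) := by
    have : ContDiffAt ℝ ∞ (fun x : (ℝ × E) × ℝ => c x.1) (y, 0) :=
      ContDiffAt.comp (y, (0 : ℝ)) (g := c) hcs (by fun_prop)
    exact this.continuousAt.norm.isBoundedUnder_le.isBigO_one ℝ
  -- the values of `Ψ` and `R`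
  have hsub : (fun x => Ψ x - R (x.1, a * x.2)) =O[𝓝 (y, 0)] fun x => x.2 ^ (q + 1) := by
    have e1 : (fun x : (ℝ × E) × ℝ => x.2 ^ (q + 2)) =O[𝓝 (y, 0)] fun x => x.2 ^ (q + 1) := by
      have : (fun x : (ℝ × E) × ℝ => x.2) =O[𝓝 (y, 0)] fun _ => (1 : ℝ) :=
        (continuousAt_snd (p := (y, (0 : ℝ)))).norm.isBoundedUnder_le.isBigO_one ℝ
      simpa [pow_succ] using (isBigO_refl (fun x : (ℝ × E) × ℝ => x.2 ^ (q + 1)) _).mul this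
    have e2 : (fun x : (ℝ × E) × ℝ => (κ * x.2 ^ (q + 1)) • c x.1) =O[𝓝 (y, 0)]
        fun x => x.2 ^ (q + 1) := by
      simpa using (isBigO_const_mul_self κ (fun x : (ℝ × E) × ℝ => x.2 ^ (q + 1)) _).smul hcb
    exact ((h.trans e1).add e2).congr_left fun x => by abel
  -- the leading error term
  have hDlead : (fun x => D (reached a Ψ x, b * x.2) - ((b * x.2) ^ (q + 1)) • c x.1)
      =O[𝓝 (y, 0)] fun x => x.2 ^ (q + 2) := by
    have e1 := isBigO_comp_reached a b (hΨ.continuousAt hy) (hΨ.apply_zero y hy)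
      (isBigO_sub_leading hW hDs hDp hy)
    have e2 : (fun x => c (reached a Ψ x) - c x.1) =O[𝓝 (y, 0)] fun x => x.2 := by
      have h1 : Tendsto (fun x : (ℝ × E) × ℝ => reached a Ψ x) (𝓝 (y, 0)) (𝓝 y) :=
        (continuous_fst.tendsto _).comp t1
      have h2 : Tendsto (fun x : (ℝ × E) × ℝ => x.1) (𝓝 (y, 0)) (𝓝 y) :=
        continuous_fst.tendsto _
      refine (isBigO_comp_sub hcs h1 h2).trans ?_
      have h3 : (fun x : (ℝ × E) × ℝ => a * x.2) =O[𝓝 (y, 0)] fun x => x.2 :=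
        isBigO_const_mul_self _ _ _
      refine (h3.prod_left (hΨ.isBigO_sub_snd hW hy)).congr_left fun x => ?_
      simp only [reached]
      ext <;> simp
    have e3 : (fun x : (ℝ × E) × ℝ => (b * x.2) ^ (q + 1)) =O[𝓝 (y, 0)]
        fun x => x.2 ^ (q + 1) := by
      simp only [mul_pow]
      exact isBigO_const_mul_self _ _ _
    have e4 := e3.smul e2
    have e5 : (fun x : (ℝ × E) × ℝ => x.2 ^ (q + 1) • x.2) = fun x => x.2 ^ (q + 2) := by
      ext x; simp [pow_succ]
    rw [e5] at e4
    refine (e1.add e4).congr_left fun x => ?_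
    simp only [smul_sub]
    abel
  -- propagation of the earlier error
  have hRprop : (fun x => R (reached a Ψ x, b * x.2) -
      R (reached a (fun x => R (x.1, a * x.2)) x, b * x.2) - (Ψ x - R (x.1, a * x.2)))
      =O[𝓝 (y, 0)] fun x => x.2 ^ (q + 2) := by
    have t3 : Tendsto (fun x => ((reached a Ψ x, reached a (fun x => R (x.1, a * x.2)) x), b * x.2))
        (𝓝 (y, 0)) (𝓝 ((y, y), 0)) :=
      (((continuous_fst.tendsto _).comp t1).prodMk_nhds
        ((continuous_fst.tendsto _).comp t2)).prodMk_nhds ((continuous_snd.tendsto _).comp t1)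
    have e1 := (hR.isBigO_displacement_sub hW hy).comp_tendsto t3
    have e2 : (fun x => ‖reached a Ψ x - reached a (fun x => R (x.1, a * x.2)) x‖) =O[𝓝 (y, 0)]
        fun x => x.2 ^ (q + 1) := by
      refine IsBigO.trans (IsBigO.of_bound 1 (Eventually.of_forall fun x => ?_)) hsub
      simp [reached]
    have e3 : (fun x : (ℝ × E) × ℝ => b * x.2) =O[𝓝 (y, 0)] fun x => x.2 :=
      isBigO_const_mul_self _ _ _
    have e4 := e2.mul e3
    have e5 : (fun x : (ℝ × E) × ℝ => x.2 ^ (q + 1) * x.2) = fun x => x.2 ^ (q + 2) := by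
      ext x; simp [pow_succ]
    rw [e5] at e4
    refine (e1.trans e4).congr_left fun x => ?_
    simp only [Function.comp, reached]
    abel
  refine (((hDlead.add hRprop).add h).add (hgroup a b y hy)).congr_left fun x => ?_
  simp only [hDdef, mul_pow, add_mul, add_smul]
  abel

/-- The symmetric composition of `A` over `[0, a]`, of `B` over `[β, β + b]`, and of `A` over
`[1 - a, 1]`. -/
def sandwich (a β b : ℝ) (A B : (ℝ × E) × ℝ → E) (x : (ℝ × E) × ℝ) : E :=
  A (reached (1 - a) (fun x => B (reached β (fun x => A (x.1, a * x.2)) x, b * x.2)) x, a * x.2)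

theorem IsStepMap.sandwich (hA : IsStepMap W A) (hB : IsStepMap W B) (a β b : ℝ) :
    IsStepMap W (sandwich a β b A B) :=
  hA.comp_reached (hB.comp_reached (hA.scale a) β b) (1 - a) a

theorem AgreesTo.comp_reached {n : ℕ} (hA : IsStepMap W A) (hB : IsStepMap W B)
    (hB' : IsStepMap W B') (h : AgreesTo W n A A') (h' : AgreesTo W n B B') (a b : ℝ) :
    AgreesTo W n (fun x => A (reached a B x, b * x.2)) (fun x => A' (reached a B' x, b * x.2)) := by
  intro y hy
  have e1 := isBigO_comp_reached a b (hB'.continuousAt hy) (hB'.apply_zero y hy) (h y hy)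
  have t1 := tendsto_reached a b (hB.continuousAt hy) (hB.apply_zero y hy)
  have t2 := tendsto_reached a b (hB'.continuousAt hy) (hB'.apply_zero y hy)
  have e2 := hA.isBigO_sub_comp hy
    ((continuous_fst.tendsto _).comp ((continuous_fst.tendsto _).comp t1))
    ((continuous_snd.tendsto _).comp t1)
    ((continuous_snd.tendsto _).comp ((continuous_fst.tendsto _).comp t1))
    ((continuous_snd.tendsto _).comp ((continuous_fst.tendsto _).comp t2))
  refine ((e2.trans (h' y hy)).add e1).congr_left fun x => ?_
  simp [reached]

theorem AgreesTo.scale {n : ℕ} (h : AgreesTo W n A A') (hA : IsStepMap W A) (a : ℝ) :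
    AgreesTo W n (fun x => A (x.1, a * x.2)) (fun x => A' (x.1, a * x.2)) := by
  have := AgreesTo.comp_reached hA isStepMap_snd isStepMap_snd h
    (fun y _ => by simpa using! isBigO_zero _ _) 0 a
  simpa only [reached_zero_snd] using this

theorem AgreesTo.sandwich {n : ℕ} (hA : IsStepMap W A) (hA' : IsStepMap W A')
    (hB : IsStepMap W B) (hB' : IsStepMap W B') (h : AgreesTo W n A A') (h' : AgreesTo W n B B')
    (a β b : ℝ) : AgreesTo W n (sandwich a β b A B) (sandwich a β b A' B') :=
  AgreesTo.comp_reached hA (hB.comp_reached (hA.scale a) β b) (hB'.comp_reached (hA'.scale a) β b) h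
    (AgreesTo.comp_reached hB (hA.scale a) (hA'.scale a) h' (h.scale hA a) β b) (1 - a) a

/-- `Φ` over the step `-h` undoes `Φ` over the step `h`, up to `O(h^n)`. -/
def IsSymmetricTo (W : Set (ℝ × E)) (n : ℕ) (Φ : (ℝ × E) × ℝ → E) : Prop :=
  ∀ y ∈ W, (fun x => Φ (reached 1 Φ x, -x.2) - x.1.2) =O[𝓝 (y, 0)] fun x => x.2 ^ n

theorem IsSymmetricTo.comp_reached {n : ℕ} (hΦ : IsSymmetricTo W n Φ) (hΨ : IsStepMap W Ψ)
    (a b : ℝ) {y : ℝ × E} (hy : y ∈ W) :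
    (fun x => Φ ((x.1.1 + (a + b) * x.2, Φ (reached a Ψ x, b * x.2)), -(b * x.2)) - Ψ x)
      =O[𝓝 (y, 0)] fun x => x.2 ^ n := by
  refine (isBigO_comp_reached a b (hΨ.continuousAt hy) (hΨ.apply_zero y hy) (hΦ y hy)).congr_left
    fun x => ?_
  simp only [reached, one_mul]
  ring_nf

/-- The reversed composition meets the factors in reverse order, so each one cancels its forward
counterpart up to `O(h^n)`, and the remaining maps propagate that error with a bounded constant. The
condition `2 β + b = 1` centres the middle step, so that the way back starts its middle step at the
time where the forward one ended. -/
theorem IsSymmetricTo.sandwich {n : ℕ} (hA : IsStepMap W A) (hB : IsStepMap W B)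
    (sA : IsSymmetricTo W n A) (sB : IsSymmetricTo W n B) {a β b : ℝ} (hb : 2 * β + b = 1) :
    IsSymmetricTo W n (sandwich a β b A B) := by
  intro y hy
  have hu1 := hA.scale a
  have hu2 := hB.comp_reached hu1 β b
  have hu3 := hA.comp_reached hu2 (1 - a) a
  set u1 : (ℝ × E) × ℝ → E := fun x => A (x.1, a * x.2) with hu1d
  set u2 : (ℝ × E) × ℝ → E := fun x => B (reached β u1 x, b * x.2) with hu2d
  set u3 : (ℝ × E) × ℝ → E := fun x => A (reached (1 - a) u2 x, a * x.2) with hu3d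
  have tk : ∀ k : ℝ, Tendsto (fun x : (ℝ × E) × ℝ => -(k * x.2)) (𝓝 (y, 0)) (𝓝 0) := fun k => by
    have : Continuous (fun x : (ℝ × E) × ℝ => -(k * x.2)) := by fun_prop
    simpa using this.tendsto (y, 0)
  have ts : ∀ k : ℝ, Tendsto (fun x : (ℝ × E) × ℝ => x.1.1 + k * x.2) (𝓝 (y, 0)) (𝓝 y.1) :=
    fun k => by
    have : Continuous (fun x : (ℝ × E) × ℝ => x.1.1 + k * x.2) := by fun_prop
    simpa using this.tendsto (y, 0)
  have tu : ∀ {Ψ : (ℝ × E) × ℝ → E}, IsStepMap W Ψ → Tendsto Ψ (𝓝 (y, 0)) (𝓝 y.2) := fun hΨ => by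
    simpa [hΨ.apply_zero y hy] using (hΨ.continuousAt hy).tendsto
  have tΦ : ∀ {Φ : (ℝ × E) × ℝ → E} (_ : IsStepMap W Φ) (k k' : ℝ) {v : (ℝ × E) × ℝ → E},
      Tendsto v (𝓝 (y, 0)) (𝓝 y.2) →
      Tendsto (fun x => Φ ((x.1.1 + k * x.2, v x), -(k' * x.2))) (𝓝 (y, 0)) (𝓝 y.2) := by
    intro Φ hΦ k k' v hv
    have := (hΦ.continuousAt hy).tendsto.comp (((ts k).prodMk_nhds hv).prodMk_nhds (tk k'))
    simpa [hΦ.apply_zero y hy] using! this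
  set v1 : (ℝ × E) × ℝ → E := fun x => A ((x.1.1 + (1 - a + a) * x.2, u3 x), -(a * x.2)) with hv1d
  set v2 : (ℝ × E) × ℝ → E := fun x => B ((x.1.1 + (β + b) * x.2, v1 x), -(b * x.2)) with hv2d
  have e1 : (fun x => v1 x - u2 x) =O[𝓝 (y, 0)] fun x => x.2 ^ n :=
    sA.comp_reached hu2 (1 - a) a hy
  have tv1 : Tendsto v1 (𝓝 (y, 0)) (𝓝 y.2) := tΦ hA _ _ (tu hu3)
  have e2 : (fun x => v2 x - u1 x) =O[𝓝 (y, 0)] fun x => x.2 ^ n := by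
    have := (hB.isBigO_sub_comp hy (ts (β + b)) (tk b) tv1 (tu hu2)).trans e1
    refine (this.add (sB.comp_reached hu1 β b hy)).congr_left fun x => ?_
    simp only [hv2d, hu2d]
    abel
  have tv2 : Tendsto v2 (𝓝 (y, 0)) (𝓝 y.2) := tΦ hB _ _ tv1
  have e3 := (hA.isBigO_sub_comp hy (ts (0 + a)) (tk a) tv2 (tu hu1)).trans e2
  refine (e3.add (sA.comp_reached isStepMap_snd 0 a hy)).congr_left fun x => ?_
  have r1 : x.1.1 + 1 * x.2 + β * -x.2 = x.1.1 + (β + b) * x.2 := by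
    rw [← sub_eq_zero]; linear_combination (-x.2) * hb
  have r2 : x.1.1 + 1 * x.2 + (1 - a) * -x.2 = x.1.1 + (0 + a) * x.2 := by ring
  have r3 : x.1.1 + 1 * x.2 = x.1.1 + (1 - a + a) * x.2 := by ring
  have hS : ESSRK.sandwich a β b A B (reached 1 (ESSRK.sandwich a β b A B) x, -x.2) =
      A ((x.1.1 + (0 + a) * x.2, v2 x), -(a * x.2)) := by
    change A ((x.1.1 + 1 * x.2 + (1 - a) * -x.2, B ((x.1.1 + 1 * x.2 + β * -x.2,
      A ((x.1.1 + 1 * x.2, u3 x), a * -x.2)), b * -x.2)), a * -x.2) = _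
    rw [r1, r2, r3, mul_neg, mul_neg]
  rw [hS]
  simp only [reached_zero_snd, hu1d]
  abel

variable {γ : ℝ}

/-- A symmetric step map of odd order gains an order. -/
theorem AgreesTo.succ_of_isSymmetricTo (hW : IsOpen W) (hR : IsStepMap W R) (hΦ : IsStepMap W Φ)
    {q : ℕ} (hgroup : ∀ a b : ℝ, ∀ y ∈ W,
      (fun x => R (reached a (fun x => R (x.1, a * x.2)) x, b * x.2) - R (x.1, (a + b) * x.2))
        =O[𝓝 (y, 0)] fun x => x.2 ^ (q + 2))
    (hD : AgreesTo W (q + 1) Φ R) (hq : Even (q + 1)) (hs : IsSymmetricTo W (q + 2) Φ) :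
    AgreesTo W (q + 2) Φ R := by
  intro y hy
  have h1 := isBigO_sub_leading hW (E := fun x => Φ x - R x)
    (fun y hy => (hΦ.contDiffAt y hy).sub (hR.contDiffAt y hy))
    (fun y hy => (hD y hy).comp_tendsto ((Continuous.prodMk_right y).tendsto 0)) hy
  -- A step forward and a step back accumulate the coefficient `1 + (-1)^(q+1) = 2`, as `q + 1` is
  -- even; by symmetry the total is also `O(h^(q+2))`. Half of this estimate removes the leading
  -- term from `h1`.
  have h2 := isBigO_comp_leading hW hR hΦ hgroup hD hΦ 1 (-1) 1 hy (by
    simpa using h1)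
  have h3 := h2.sub (hs y hy)
  refine (h1.sub ((h3.const_smul_left (1 / 2 : ℝ)))).congr' ?_ EventuallyEq.rfl
  filter_upwards [continuousAt_fst.preimage_mem_nhds (hW.mem_nhds hy)] with x hx
  simp only [Pi.smul_apply, add_neg_cancel, zero_mul, hR.apply_zero x.1 hx, hq.neg_one_pow, neg_mul, one_mul]
  module

/-- Three substeps of relative lengths `γ`, `1 - 2γ`, `γ` accumulate the leading coefficient `2
γ^(q+1) + (1 - 2γ)^(q+1)`, which the hypothesis on `γ` makes zero. -/
theorem AgreesTo.triple (hW : IsOpen W) (hR : IsStepMap W R) (hΦ : IsStepMap W Φ)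
    {q : ℕ} (hgroup : ∀ a b : ℝ, ∀ y ∈ W,
      (fun x => R (reached a (fun x => R (x.1, a * x.2)) x, b * x.2) - R (x.1, (a + b) * x.2))
        =O[𝓝 (y, 0)] fun x => x.2 ^ (q + 2))
    (hD : AgreesTo W (q + 1) Φ R) (hγ : 2 * γ ^ (q + 1) + (1 - 2 * γ) ^ (q + 1) = 0) :
    AgreesTo W (q + 2) (ESSRK.sandwich γ γ (1 - 2 * γ) Φ Φ) R := by
  intro y hy
  have hu1 := hΦ.scale γ
  have hu2 := hΦ.comp_reached hu1 γ (1 - 2 * γ)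
  have h1 := isBigO_comp_leading hW hR hΦ hgroup hD isStepMap_snd 0 γ 0 hy (by
    refine (isBigO_zero _ _).congr' ?_ EventuallyEq.rfl
    filter_upwards [continuousAt_fst.preimage_mem_nhds (hW.mem_nhds hy)] with x hx
    simp [hR.apply_zero x.1 hx])
  simp only [reached_zero_snd] at h1
  have h2 := isBigO_comp_leading hW hR hΦ hgroup hD hu1 (0 + γ) (1 - 2 * γ) (0 + γ ^ (q + 1)) hy h1
  simp only [zero_add] at h2
  have h3 := isBigO_comp_leading hW hR hΦ hgroup hD hu2 (γ + (1 - 2 * γ)) γ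
    (γ ^ (q + 1) + (1 - 2 * γ) ^ (q + 1)) hy h2
  refine h3.congr_left fun x => ?_
  have : γ ^ (q + 1) + (1 - 2 * γ) ^ (q + 1) + γ ^ (q + 1) = 0 := by linarith
  have h' : γ + (1 - 2 * γ) = 1 - γ := by ring
  simp [ESSRK.sandwich, this, h']

end Composition

/-! ### Approximate flows are close to genuine trajectories -/

section Fence

variable {E : Type*} [NormedAddCommGroup E] [NormedSpace ℝ E]
variable {W : Set (ℝ × E)} {X : ℝ × E → E} {N : ℕ} {R : (ℝ × E) × ℝ → E}

/-- A fencing argument: as long as the error is small, it satisfies a differential inequality that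
keeps it small. -/
theorem norm_le_of_fence {e e' : ℝ → E} {T K C δ : ℝ} {N : ℕ} (hT : 0 ≤ T) (hK : 1 ≤ K)
    (hC : 0 ≤ C) (hKT : 4 * K * T ≤ 1) (hδ : 0 < δ) (hCT : C * T ^ (N + 1) ≤ δ / 4)
    (he : ∀ s ∈ Icc 0 T, HasDerivWithinAt e (e' s) (Icc 0 T) s) (h0 : e 0 = 0)
    (hb : ∀ s ∈ Icc 0 T, ‖e s‖ ≤ δ / 2 → ‖e' s‖ ≤ K * ‖e s‖ + C / 2 * s ^ N) :
    ‖e T‖ ≤ C * T ^ (N + 1) := by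
  refine le_of_forall_pos_le_add fun ε hε => ?_
  set η := min (ε / 2) (δ / 8) with hη
  have hη0 : 0 < η := by positivity
  have hη1 : η ≤ ε / 2 := min_le_left _ _
  have hη2 : η ≤ δ / 8 := min_le_right _ _
  -- The fence is `B(s) = C s^(N+1) + η (1 + 2 K s)`. The slack `η` gives the strict inequality `K B
  -- + C s^N / 2 < B'` (using `4 K s ≤ 1`), keeps `B` below `δ / 2`, and contributes at most `ε` at
  -- the end.
  have key := image_norm_le_of_norm_deriv_right_lt_deriv_boundary (f := e) (f' := e') (a := 0)
    (b := T) (B := fun s => C * s ^ (N + 1) + η * (1 + 2 * K * s))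
    (B' := fun s => C * ((N + 1 : ℕ) * s ^ N) + η * (2 * K * 1))
    (fun s hs => (he s hs).continuousWithinAt)
    (fun s hs => (he s (Ico_subset_Icc_self hs)).mono_of_mem_nhdsWithin (Icc_mem_nhdsGE_of_mem hs))
    (by simpa [h0] using hη0.le) (fun s => by
      have h1 := (hasDerivAt_pow (N + 1) s).const_mul C
      have h2 := (((hasDerivAt_id s).const_mul (2 * K)).const_add 1).const_mul η
      simpa using! h1.add h2) ?_ (right_mem_Icc.2 hT)
  · have : 2 * K * T ≤ 1 / 2 := by linarith
    have : η * (1 + 2 * K * T) ≤ η * 2 := by gcongr; linarith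
    linarith
  · intro s hs hes
    have hs0 : 0 ≤ s := hs.1
    have hsT : s ≤ T := hs.2.le
    have hKs : 4 * K * s ≤ 1 := le_trans (by gcongr) hKT
    have h1 : C * s ^ (N + 1) ≤ δ / 4 := le_trans (by gcongr) hCT
    have h2 : η * (1 + 2 * K * s) ≤ η * 2 := by gcongr; linarith
    have h3 : ‖e s‖ ≤ δ / 2 := by rw [hes]; linarith
    refine (hb s (Ico_subset_Icc_self hs) h3).trans_lt ?_
    rw [hes]
    have hp : 0 ≤ C * s ^ N := by positivity
    have h4 : K * (C * s ^ (N + 1)) ≤ C * s ^ N / 2 := by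
      have : K * (C * s ^ (N + 1)) = (K * s) * (C * s ^ N) := by ring
      rw [this]
      nlinarith
    have h5 : C * s ^ N ≤ C * ((N + 1 : ℕ) * s ^ N) := by
      push_cast
      have : 0 ≤ C * s ^ N * N := by positivity
      linarith
    have h6 : K * (η * (1 + 2 * K * s)) ≤ K * (η * (3 / 2)) := by gcongr; linarith
    have h7 : 0 < K * η := by positivity
    linarith

/-- Nothing is assumed about how far `ζ` strays. The Lipschitz bound for `X` holds only near `y₀`,
but `R` stays there, and the fencing argument asks for the differential inequality only while `ζ` is
close to `R`. -/
theorem IsApproxFlow.exists_norm_sub_le (hW : IsOpen W) (hX : ∀ y ∈ W, ContDiffAt ℝ ∞ X y)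
    (hR : IsApproxFlow W X N R) {y₀ : ℝ × E} (hy₀ : y₀ ∈ W) :
    ∃ V ∈ 𝓝 y₀, ∃ h₀ > 0, ∃ C : ℝ, ∀ y ∈ V, ∀ h : ℝ, |h| ≤ h₀ → ∀ ζ : ℝ → E, ζ y.1 = y.2 →
      (∀ τ ∈ uIcc y.1 (y.1 + h), HasDerivWithinAt ζ (X (τ, ζ τ)) (uIcc y.1 (y.1 + h)) τ) →
      ‖R (y, h) - ζ (y.1 + h)‖ ≤ C * |h| ^ (N + 1) := by
  -- Lipschitz bound
  obtain ⟨K, hK⟩ := (isBigO_sub_of_contDiffAt (hX y₀ hy₀)).bound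
  rw [nhds_prod_eq, Filter.eventually_prod_iff] at hK
  obtain ⟨p, hp, q, hq, hpq⟩ := hK
  obtain ⟨δ, hδ, hδpq⟩ := Metric.eventually_nhds_iff_ball.1 (hp.and hq)
  obtain ⟨M, hM⟩ := (hR.defect y₀ hy₀).bound
  have hRc : ∀ᶠ x in 𝓝 (y₀, (0 : ℝ)), ‖R x - y₀.2‖ < δ / 2 := by
    have := (hR.contDiffAt y₀ hy₀).continuousAt.tendsto
    rw [hR.apply_zero y₀ hy₀] at this
    simpa [dist_eq_norm] using this.eventually (Metric.ball_mem_nhds y₀.2 (half_pos hδ))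
  have hWe : ∀ᶠ x in 𝓝 (y₀, (0 : ℝ)), x.1 ∈ W :=
    continuousAt_fst.preimage_mem_nhds (hW.mem_nhds hy₀)
  obtain ⟨r, hr, H⟩ := Metric.eventually_nhds_iff_ball.1
    (((eventually_differentiableAt (hR.contDiffAt y₀ hy₀)).and hM).and (hRc.and hWe))
  set K' := max K 1 with hK'
  have hK1 : 1 ≤ K' := le_max_right _ _
  set C := 2 * max M 0 with hC
  have hC0 : 0 ≤ C := by positivity
  obtain ⟨h₀, hh₀, hsmall⟩ : ∃ h₀ > 0, ∀ T : ℝ, 0 ≤ T → T ≤ h₀ →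
      T < r ∧ T < δ / 2 ∧ 4 * K' * T ≤ 1 ∧ C * T ^ (N + 1) ≤ δ / 4 := by
    have c1 : Tendsto (fun T : ℝ => T) (𝓝 0) (𝓝 0) := tendsto_id
    have c2 : Tendsto (fun T : ℝ => 4 * K' * T) (𝓝 0) (𝓝 0) := by
      have : Continuous (fun T : ℝ => 4 * K' * T) := by fun_prop
      simpa using this.tendsto 0
    have c3 : Tendsto (fun T : ℝ => C * T ^ (N + 1)) (𝓝 0) (𝓝 0) := by
      have : Continuous (fun T : ℝ => C * T ^ (N + 1)) := by fun_prop
      simpa using this.tendsto 0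
    have := ((c1.eventually_lt_const hr).and (c1.eventually_lt_const (half_pos hδ))).and
      ((c2.eventually_lt_const one_pos).and (c3.eventually_lt_const (show (0 : ℝ) < δ / 4 by positivity)))
    obtain ⟨ε, hε, hh⟩ := Metric.eventually_nhds_iff_ball.1 this
    refine ⟨ε / 2, half_pos hε, fun T hT hT' => ?_⟩
    have := hh T (by simp [abs_of_nonneg hT]; linarith)
    exact ⟨this.1.1, this.1.2, this.2.1.le, this.2.2.le⟩
  refine ⟨Metric.ball y₀ (min r (δ / 2)), Metric.ball_mem_nhds _ (by positivity), h₀, hh₀, C, ?_⟩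
  intro y hy h hh ζ hζ0 hζ
  have hyr : dist y y₀ < r := hy.trans_le (min_le_left _ _)
  have hyδ : dist y y₀ < δ / 2 := hy.trans_le (min_le_right _ _)
  obtain ⟨T1, T2, T3, T4⟩ := hsmall |h| (abs_nonneg h) hh
  -- the sign of the step
  obtain ⟨σ, hσ, hσh⟩ : ∃ σ : ℝ, |σ| = 1 ∧ σ * |h| = h := by
    rcases le_or_gt 0 h with hp | hn
    · exact ⟨1, by simp, by simp [abs_of_nonneg hp]⟩
    · exact ⟨-1, by simp, by simp [abs_of_neg hn]⟩
  have hσs : ∀ s ∈ Icc 0 |h|, y.1 + σ * s ∈ uIcc y.1 (y.1 + h) := by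
    intro s hs
    rcases le_or_gt 0 h with hp | hn
    · rw [abs_of_nonneg hp] at hs hσh
      rw [uIcc_of_le (by linarith)]
      rcases (abs_eq zero_le_one).1 hσ with rfl | rfl
      · constructor <;> linarith [hs.1, hs.2]
      · constructor <;> linarith [hs.1, hs.2]
    · rw [abs_of_neg hn] at hs hσh
      rw [uIcc_of_ge (by linarith)]
      rcases (abs_eq zero_le_one).1 hσ with rfl | rfl
      · constructor <;> linarith [hs.1, hs.2]
      · constructor <;> linarith [hs.1, hs.2]
  have hball : ∀ s ∈ Icc 0 |h|, (y, σ * s) ∈ Metric.ball (y₀, (0 : ℝ)) r := by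
    intro s hs
    rw [Metric.mem_ball, Prod.dist_eq, max_lt_iff]
    refine ⟨hyr, ?_⟩
    simp only [dist_zero_right, norm_mul, Real.norm_eq_abs, hσ, one_mul, abs_of_nonneg hs.1]
    exact hs.2.trans_lt T1
  have key := norm_le_of_fence (T := |h|) (K := K') (C := C) (δ := δ) (N := N)
    (e := fun s => R (y, σ * s) - ζ (y.1 + σ * s))
    (e' := fun s => σ • (partialStep R (y, σ * s) - X (y.1 + σ * s, ζ (y.1 + σ * s))))
    (abs_nonneg h) hK1 hC0 T3 hδ T4 ?_ ?_ ?_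
  · simpa only [hσh] using key
  · intro s hs
    rw [smul_sub]
    have hl : HasDerivAt (fun s => σ * s) σ s := by
      simpa using (hasDerivAt_id s).const_mul σ
    refine HasDerivWithinAt.sub ?_ ?_
    · have := (hasDerivAt_partialStep (H _ (hball s hs)).1.1)
      exact (HasDerivAt.scomp s this hl).hasDerivWithinAt
    · exact HasDerivWithinAt.scomp s (hζ _ (hσs s hs)) (hl.const_add _).hasDerivWithinAt
        (fun s hs => hσs s hs)
  · have := (H _ (hball 0 (left_mem_Icc.2 (abs_nonneg h)))).2.2
    simp only [mul_zero, add_zero] at this ⊢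
    rw [hR.apply_zero y this, hζ0, sub_self]
  · intro s hs hes
    obtain ⟨⟨-, d2⟩, d3, -⟩ := H _ (hball s hs)
    have habs : |σ * s| = s := by rw [abs_mul, hσ, one_mul, abs_of_nonneg hs.1]
    rw [norm_smul, Real.norm_eq_abs, hσ, one_mul]
    have htau : |y.1 + σ * s - y₀.1| < δ := by
      have h1 : |y.1 - y₀.1| ≤ dist y y₀ := by
        rw [Prod.dist_eq, Real.dist_eq]; exact le_max_left _ _
      calc |y.1 + σ * s - y₀.1| = |(y.1 - y₀.1) + σ * s| := by ring_nf
        _ ≤ |y.1 - y₀.1| + |σ * s| := abs_add_le _ _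
        _ < δ := by rw [habs]; linarith [hs.2]
    have hmem : ∀ u : E, ‖u - y₀.2‖ < δ → (y.1 + σ * s, u) ∈ Metric.ball y₀ δ := by
      intro u hu
      rw [Metric.mem_ball, Prod.dist_eq, max_lt_iff, Real.dist_eq, dist_eq_norm]
      exact ⟨htau, hu⟩
    have hζδ : ‖ζ (y.1 + σ * s) - y₀.2‖ < δ := by
      have : ζ (y.1 + σ * s) - y₀.2 = (R (y, σ * s) - y₀.2) - (R (y, σ * s) - ζ (y.1 + σ * s)) := by
        abel
      rw [this]
      refine (norm_sub_le _ _).trans_lt ?_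
      linarith
    have hL := hpq (hδpq _ (hmem _ (d3.trans (by linarith)))).1 (hδpq _ (hmem _ hζδ)).2
    simp only [Prod.mk_sub_mk, sub_self, Prod.norm_mk, norm_zero] at hL
    rw [max_eq_right (norm_nonneg _)] at hL
    simp only [norm_pow, Real.norm_eq_abs, habs] at d2
    have hsN : 0 ≤ s ^ N := pow_nonneg hs.1 N
    calc _ = ‖(partialStep R (y, σ * s) - X (y.1 + σ * s, R (y, σ * s))) +
          (X (y.1 + σ * s, R (y, σ * s)) - X (y.1 + σ * s, ζ (y.1 + σ * s)))‖ := by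
            congr 1; abel
      _ ≤ M * s ^ N + K * ‖R (y, σ * s) - ζ (y.1 + σ * s)‖ := (norm_add_le _ _).trans (add_le_add d2 hL)
      _ ≤ C / 2 * s ^ N + K' * ‖R (y, σ * s) - ζ (y.1 + σ * s)‖ := by
        gcongr
        · rw [hC]; linarith [le_max_left M 0]
        · exact le_max_left _ _
      _ = _ := by ring

end Fence

/-! ### Order of the composition scheme built from approximate flows -/

section Order

variable {E : Type*} [NormedAddCommGroup E] [NormedSpace ℝ E]
variable {W : Set (ℝ × E)} {X X₁ X₂ Y : ℝ × E → E} {N : ℕ} {R Φ Ψ ψ φ : (ℝ × E) × ℝ → E}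

/-- For `N ≥ 1` the bound on the defect forces it to vanish at `h = 0`, so the first Taylor
coefficient is `X` itself. -/
theorem IsApproxFlow.isBigO_sub_first_order (hΦ : IsApproxFlow W X N Φ) (hN : 1 ≤ N) {y : ℝ × E}
    (hW : IsOpen W) (hy : y ∈ W) :
    (fun x => Φ x - x.1.2 - x.2 • X x.1) =O[𝓝 (y, 0)] fun x => x.2 ^ 2 := by
  refine (isBigO_sub_stepCoeff 2 (hΦ.contDiffAt y hy)).congr' ?_ EventuallyEq.rfl
  filter_upwards [continuousAt_fst.preimage_mem_nhds (hW.mem_nhds hy)] with x hx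
  have h1 : partialStep Φ (x.1, 0) = X x.1 := by
    have := ((hΦ.defect x.1 hx).eq_zero_imp.self_of_nhds) (by
      simp only; exact zero_pow (by omega))
    simpa [hΦ.apply_zero x.1 hx, sub_eq_zero] using this
  simp [Finset.sum_range_succ, stepCoeff, hΦ.apply_zero x.1 hx, h1, sub_sub]

theorem isBigO_reached_sub (hW : IsOpen W) (hΨ : IsStepMap W Ψ) (a : ℝ) {y : ℝ × E} (hy : y ∈ W) :
    (fun x => reached a Ψ x - x.1) =O[𝓝 (y, 0)] fun x => x.2 := by
  have h3 : (fun x : (ℝ × E) × ℝ => a * x.2) =O[𝓝 (y, 0)] fun x => x.2 :=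
    isBigO_const_mul_self _ _ _
  refine (h3.prod_left (hΨ.isBigO_sub_snd hW hy)).congr_left fun x => ?_
  simp only [reached]
  ext <;> simp

theorem IsApproxFlow.comp_first_order (hW : IsOpen W) (hX : ∀ y ∈ W, ContDiffAt ℝ ∞ X y)
    (hΦ : IsApproxFlow W X N Φ) (hN : 1 ≤ N) (hΨ : IsStepMap W Ψ) (a b : ℝ) {y : ℝ × E}
    (hy : y ∈ W)
    (h : (fun x => Ψ x - x.1.2 - x.2 • Y x.1) =O[𝓝 (y, 0)] fun x => x.2 ^ 2) :
    (fun x => Φ (reached a Ψ x, b * x.2) - x.1.2 - x.2 • (Y x.1 + b • X x.1)) =O[𝓝 (y, 0)]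
      fun x => x.2 ^ 2 := by
  have e1 := isBigO_comp_reached a b (hΨ.continuousAt hy) (hΨ.apply_zero y hy)
    (hΦ.isBigO_sub_first_order hN hW hy)
  have t1 := tendsto_reached a b (hΨ.continuousAt hy) (hΨ.apply_zero y hy)
  have e2 := (isBigO_comp_sub (hX y hy) ((continuous_fst.tendsto _).comp t1)
    (continuous_fst.tendsto (y, (0 : ℝ)))).trans (isBigO_reached_sub hW hΨ a hy)
  have e3 : (fun x : (ℝ × E) × ℝ => b * x.2) =O[𝓝 (y, 0)] fun x => x.2 :=
    isBigO_const_mul_self _ _ _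
  have e4 := e3.smul e2
  have e5 : (fun x : (ℝ × E) × ℝ => x.2 • x.2) = fun x => x.2 ^ 2 := by
    ext x; simp [pow_two]
  rw [e5] at e4
  refine ((e1.add e4).add h).congr_left fun x => ?_
  simp only [Function.comp, reached]
  module

/-- The Strang splitting is consistent. -/
theorem agreesTo_strang (hW : IsOpen W) (hX₁ : ∀ y ∈ W, ContDiffAt ℝ ∞ X₁ y)
    (hX₂ : ∀ y ∈ W, ContDiffAt ℝ ∞ X₂ y) (hψ : IsApproxFlow W X₁ N ψ) (hφ : IsApproxFlow W X₂ N φ)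
    (hR : IsApproxFlow W (fun y => X₁ y + X₂ y) N R) (hN : 1 ≤ N) :
    AgreesTo W 2 (sandwich (1 / 2) 0 1 ψ φ) R := by
  intro y hy
  have hu1 := hψ.toIsStepMap.scale (1 / 2)
  have hu2 := hφ.toIsStepMap.comp_reached hu1 0 1
  have h1 := hψ.comp_first_order (Y := fun _ => 0) hW hX₁ hN isStepMap_snd 0 (1 / 2) hy
    (by simpa using! isBigO_zero _ _)
  simp only [reached_zero_snd] at h1
  have h2 := hφ.comp_first_order (Y := fun y => 0 + (1 / 2 : ℝ) • X₁ y) hW hX₂ hN hu1 0 1 hy h1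
  have h3 := hψ.comp_first_order
    (Y := fun y => 0 + (1 / 2 : ℝ) • X₁ y + (1 : ℝ) • X₂ y) hW hX₁ hN hu2 (1 - 1 / 2) (1 / 2) hy h2
  refine (h3.sub (hR.isBigO_sub_first_order hN hW hy)).congr_left fun x => ?_
  simp only [sandwich]
  module

theorem IsApproxFlow.isSymmetricTo (hW : IsOpen W) (hX : ∀ y ∈ W, ContDiffAt ℝ ∞ X y)
    (hΦ : IsApproxFlow W X N Φ) : IsSymmetricTo W (N + 1) Φ := by
  intro y hy
  refine (hΦ.comp_sub hW hX 1 (-1) hy).congr' ?_ EventuallyEq.rfl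
  filter_upwards [continuousAt_fst.preimage_mem_nhds (hW.mem_nhds hy)] with x hx
  simp [hΦ.apply_zero x.1 hx]

theorem IsSymmetricTo.mono {m n : ℕ} (h : IsSymmetricTo W n Φ) (hmn : m ≤ n) :
    IsSymmetricTo W m Φ := by
  intro y hy
  exact (AgreesTo.mono (Φ := fun x => Φ (reached 1 Φ x, -x.2)) (Ψ := fun x => x.1.2) h hmn) y hy

theorem gam_pow {p : ℕ} (hp : Even p) (h2 : 2 ≤ p) :
    2 * gam p ^ (p + 1) + (1 - 2 * gam p) ^ (p + 1) = 0 := by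
  set r : ℝ := (2 : ℝ) ^ (1 / ((p : ℝ) + 1)) with hr
  have hrp : r ^ (p + 1) = 2 := by
    rw [hr, ← Real.rpow_natCast, ← Real.rpow_mul (by norm_num)]
    push_cast
    rw [one_div_mul_cancel (by positivity), Real.rpow_one]
  have hr2 : r < 2 := by
    rw [hr]
    conv_rhs => rw [← Real.rpow_one 2]
    refine Real.rpow_lt_rpow_of_exponent_lt (by norm_num) ?_
    rw [div_lt_one (by positivity)]
    have : (2 : ℝ) ≤ p := by exact_mod_cast h2
    linarith
  have hne : 2 - r ≠ 0 := by linarith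
  -- With `r^(p+1) = 2` and `p + 1` odd, the middle substep contributes `-2 γ^(p+1)` and balances
  -- the two outer ones.
  have h1 : 1 - 2 * gam p = -(r * gam p) := by
    simp only [gam, ← hr]
    field_simp
    ring
  rw [h1, hp.add_one.neg_pow, mul_pow, hrp]
  ring

/-- The composition scheme of the integrators, for general step maps `ψ` and `φ`. -/
noncomputable def composed (ψ φ : (ℝ × E) × ℝ → E) : ℕ → (ℝ × E) × ℝ → E
  | 0 => sandwich (1 / 2) 0 1 ψ φ
  | n + 1 => sandwich (gam (2 * n + 2)) (gam (2 * n + 2)) (1 - 2 * gam (2 * n + 2))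
      (composed ψ φ n) (composed ψ φ n)

theorem isStepMap_composed (hψ : IsStepMap W ψ) (hφ : IsStepMap W φ) (n : ℕ) :
    IsStepMap W (composed ψ φ n) := by
  induction n with
  | zero => exact hψ.sandwich hφ _ _ _
  | succ n ih => exact ih.sandwich ih _ _ _

theorem isSymmetricTo_composed (hψ : IsStepMap W ψ) (hφ : IsStepMap W φ) {m : ℕ}
    (sψ : IsSymmetricTo W m ψ) (sφ : IsSymmetricTo W m φ) (n : ℕ) :
    IsSymmetricTo W m (composed ψ φ n) := by
  induction n with
  | zero => exact sψ.sandwich hψ hφ sφ (by norm_num)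
  | succ n ih =>
    have := isStepMap_composed hψ hφ n
    exact ih.sandwich this this ih (by ring)

/-- This decouples the Runge–Kutta error from the splitting error: the symmetry arguments need a
nearly exact second factor, and replacing the Runge–Kutta map by one perturbs the whole composition
by no more than the order of the replacement. -/
theorem agreesTo_composed {m : ℕ} {φ' : (ℝ × E) × ℝ → E} (hψ : IsStepMap W ψ)
    (hφ : IsStepMap W φ) (hφ' : IsStepMap W φ') (h : AgreesTo W m φ φ') (n : ℕ) :
    AgreesTo W m (composed ψ φ n) (composed ψ φ' n) := by
  induction n with
  | zero =>
    exact AgreesTo.sandwich hψ hψ hφ hφ' (fun y _ => by simpa using! isBigO_zero _ _) h _ _ _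
  | succ n ih =>
    have h1 := isStepMap_composed hψ hφ n
    have h2 := isStepMap_composed hψ hφ' n
    exact AgreesTo.sandwich h1 h2 h1 h2 ih ih _ _ _

/-- The composition scheme has order `2 n + 2` if the parts are nearly exact. -/
theorem agreesTo_composed_flow (hW : IsOpen W) (hX₁ : ∀ y ∈ W, ContDiffAt ℝ ∞ X₁ y)
    (hX₂ : ∀ y ∈ W, ContDiffAt ℝ ∞ X₂ y) (hψ : IsApproxFlow W X₁ N ψ) (hφ : IsApproxFlow W X₂ N φ)
    (hR : IsApproxFlow W (fun y => X₁ y + X₂ y) N R) (n : ℕ) (hN : 2 * n + 3 ≤ N) :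
    AgreesTo W (2 * n + 3) (composed ψ φ n) R := by
  have hX : ∀ y ∈ W, ContDiffAt ℝ ∞ (fun y => X₁ y + X₂ y) y := fun y hy =>
    (hX₁ y hy).add (hX₂ y hy)
  have hgroup : ∀ m ≤ N + 1, ∀ a b : ℝ, ∀ y ∈ W,
      (fun x => R (reached a (fun x => R (x.1, a * x.2)) x, b * x.2) - R (x.1, (a + b) * x.2))
        =O[𝓝 (y, 0)] fun x => x.2 ^ m := fun m hm a b y hy =>
    (AgreesTo.mono (W := W) (fun y hy => hR.comp_sub hW hX a b hy) hm) y hy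
  have hS := fun n => isStepMap_composed hψ.toIsStepMap hφ.toIsStepMap n
  have hsym := fun n => isSymmetricTo_composed hψ.toIsStepMap hφ.toIsStepMap
    (hψ.isSymmetricTo hW hX₁) (hφ.isSymmetricTo hW hX₂) n
  induction n with
  | zero =>
    -- Consistency gives the error `h^2`; symmetry improves it to `h^3`.
    exact AgreesTo.succ_of_isSymmetricTo (q := 1) hW hR.toIsStepMap (hS 0)
      (hgroup _ (by omega)) (agreesTo_strang hW hX₁ hX₂ hψ hφ hR (by omega)) (by decide)
      ((hsym 0).mono (by omega))
  | succ n ih =>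
    -- The triple jump raises the error exponent from `2n+3` to `2n+4`, and symmetry raises the now
    -- even exponent to `2n+5`.
    have h1 := AgreesTo.triple (q := 2 * n + 2) hW hR.toIsStepMap (hS n)
      (hgroup _ (by omega)) (ih (by omega)) (gam_pow (p := 2 * n + 2) (by simp [parity_simps]) (by omega))
    exact AgreesTo.succ_of_isSymmetricTo (q := 2 * n + 3) hW hR.toIsStepMap (hS (n + 1))
      (hgroup _ (by omega)) h1 ⟨n + 2, by omega⟩ ((hsym (n + 1)).mono (by omega))

end Order

/-! ### Smooth solutions, Taylor expansions and quadrature -/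

section Trajectories

variable {V : Type*} [NormedAddCommGroup V] [NormedSpace ℝ V]

/-- Solutions of smooth differential equations are smooth. -/
theorem contDiffAt_of_hasDerivAt [CompleteSpace V] {U : Set (V × ℝ)} {F : V → ℝ → V}
    (hU : IsOpen U) (hF : ContDiffOn ℝ ∞ (fun x : V × ℝ => F x.1 x.2) U) {t : ℝ} {y : ℝ → V}
    (hy : (y t, t) ∈ U) (hd : ∀ᶠ τ in 𝓝 t, HasDerivAt y (F (y τ) τ) τ) : ContDiffAt ℝ ∞ y t := by
  have hyc : ContinuousAt y t := hd.self_of_nhds.continuousAt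
  obtain ⟨A, hA, B, hB, hAB⟩ := mem_nhds_prod_iff.1 (hU.mem_nhds hy)
  obtain ⟨ε, hε, H⟩ := Metric.eventually_nhds_iff_ball.1 ((hd.and (hyc.eventually hA)).and hB)
  have hI : Icc (t - ε / 2) (t + ε / 2) ∈ 𝓝 t := Icc_mem_nhds (by linarith) (by linarith)
  have hIb : ∀ τ ∈ Icc (t - ε / 2) (t + ε / 2), τ ∈ Metric.ball t ε := fun τ hτ => by
    rw [Metric.mem_ball, Real.dist_eq, abs_lt]
    constructor <;> linarith [hτ.1, hτ.2]
  refine (ODE.contDiffOn_enat_Icc_of_hasDerivWithinAt (f := fun τ v => F v τ) (u := A)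
    (tmin := t - ε / 2) (tmax := t + ε / 2) (α := y) (n := ⊤) ?_ ?_ ?_).contDiffAt hI
  · refine hF.comp (f := fun x : ℝ × V => (x.2, x.1)) (by fun_prop) ?_
    rintro ⟨τ, v⟩ ⟨hτ, hv⟩
    exact hAB ⟨hv, (H τ (hIb τ hτ)).2⟩
  · exact fun τ hτ => (H τ (hIb τ hτ)).1.1.hasDerivWithinAt
  · exact fun τ hτ => (H τ (hIb τ hτ)).1.2

/-- Taylor expansion at `0` of a smooth function and of its derivative. -/
theorem exists_taylor_expansion {u u' : ℝ → V} (hu : ContDiffAt ℝ ∞ u 0)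
    (hd : ∀ᶠ h in 𝓝 0, HasDerivAt u (u' h) h) :
    ∃ c : ℕ → V, ∀ n : ℕ,
      ((fun h => u h - ∑ k ∈ Finset.range n, h ^ k • c k) =O[𝓝 0] fun h => h ^ n) ∧
      (fun h => u' h - ∑ k ∈ Finset.range n, (((k : ℝ) + 1) * h ^ k) • c (k + 1)) =O[𝓝 0]
        fun h => h ^ n := by
  set G : ℝ × ℝ → V := fun x => u x.2 with hG
  have hGs : ContDiffAt ℝ ∞ G (0, 0) := ContDiffAt.comp (0, 0) (g := u) hu contDiffAt_snd
  have ht : Tendsto (fun h : ℝ => ((0 : ℝ), h)) (𝓝 0) (𝓝 (0, 0)) :=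
    (Continuous.prodMk_right 0).tendsto 0
  refine ⟨fun k => stepCoeff k G 0, fun n =>
    ⟨(isBigO_sub_stepCoeff n hGs).comp_tendsto ht, ?_⟩⟩
  refine ((isBigO_sub_stepCoeff n (contDiffAt_partialStep hGs)).comp_tendsto ht).congr' ?_
    EventuallyEq.rfl
  filter_upwards [hd, ht.eventually (eventually_differentiableAt hGs)] with h h1 h2
  have h3 : partialStep G (0, h) = u' h := (hasDerivAt_partialStep h2).unique h1
  simp only [Function.comp, h3]
  congr 1
  refine Finset.sum_congr rfl fun k _ => ?_
  have : (k : ℝ) + 1 ≠ 0 := by positivity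
  simp only [stepCoeff, smul_smul]
  congr 1
  field_simp

theorem isBigO_comp_mul {u : ℝ → V} {n : ℕ} (hu : u =O[𝓝 0] fun h : ℝ => h ^ n) (c : ℝ) :
    (fun h => u (c * h)) =O[𝓝 0] fun h : ℝ => h ^ n := by
  have ht : Tendsto (fun h : ℝ => c * h) (𝓝 0) (𝓝 0) := by
    have : Continuous fun h : ℝ => c * h := by fun_prop
    simpa using this.tendsto 0
  refine (hu.comp_tendsto ht).trans ?_
  simp only [Function.comp_def, mul_pow]
  exact isBigO_const_mul_self _ _ _

theorem isBigO_pow_of_le {m n : ℕ} (hmn : m ≤ n) :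
    (fun h : ℝ => h ^ n) =O[𝓝 0] fun h : ℝ => h ^ m := by
  have : (fun x : ℝ => x) =O[𝓝 0] fun _ => (1 : ℝ) :=
    (continuousAt_id (x := (0 : ℝ))).norm.isBoundedUnder_le.isBigO_one ℝ
  obtain ⟨j, rfl⟩ := Nat.exists_eq_add_of_le hmn
  simpa [pow_add] using (isBigO_refl (fun x : ℝ => x ^ m) _).mul (this.pow j)

theorem isBigO_smul_pow {u : ℝ → V} {n : ℕ} (hu : u =O[𝓝 0] fun h : ℝ => h ^ n) :
    (fun h => h • u h) =O[𝓝 0] fun h : ℝ => h ^ (n + 1) := by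
  simpa [pow_succ'] using (isBigO_refl (fun h : ℝ => h) _).smul hu

/-- Error of an interpolatory quadrature formula on `[0, γ h]`. -/
theorem isBigO_quadrature {ι : Type*} (I : Finset ι) {u u' : ℝ → V} (hu : ContDiffAt ℝ ∞ u 0)
    (hd : ∀ᶠ h in 𝓝 0, HasDerivAt u (u' h) h) {N : ℕ} {w c : ι → ℝ} {γ : ℝ}
    (hw : ∀ k < N, ∑ j ∈ I, w j * c j ^ k = γ ^ (k + 1) / ((k : ℝ) + 1)) :
    (fun h => u 0 + h • ∑ j ∈ I, w j • u' (c j * h) - u (γ * h)) =O[𝓝 0]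
      fun h => h ^ (N + 1) := by
  obtain ⟨a, ha⟩ := exists_taylor_expansion hu hd
  have h0 : u 0 = a 0 := by
    have := ((ha 1).1.eq_zero_imp.self_of_nhds) (by simp)
    simpa [sub_eq_zero] using this
  have e1 := isBigO_comp_mul (ha (N + 1)).1 γ
  have e2 : (fun h : ℝ => ∑ j ∈ I, w j • (u' (c j * h) -
      ∑ k ∈ Finset.range N, (((k : ℝ) + 1) * (c j * h) ^ k) • a (k + 1))) =O[𝓝 0]
        fun h => h ^ N :=
    IsBigO.fun_sum fun j _ => (isBigO_comp_mul (ha N).2 (c j)).const_smul_left (w j)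
  refine ((isBigO_smul_pow e2).sub e1).congr_left fun h => ?_
  have e3 : ∑ j ∈ I, w j • ∑ k ∈ Finset.range N, (((k : ℝ) + 1) * (c j * h) ^ k) • a (k + 1) =
      ∑ k ∈ Finset.range N, (γ ^ (k + 1) * h ^ k) • a (k + 1) := by
    simp only [Finset.smul_sum]
    rw [Finset.sum_comm]
    refine Finset.sum_congr rfl fun k hk => ?_
    simp only [smul_smul]
    rw [← Finset.sum_smul]
    congr 1
    have hk1 : (k : ℝ) + 1 ≠ 0 := by positivity
    have := hw k (Finset.mem_range.1 hk)
    rw [eq_div_iff hk1] at this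
    rw [← this, Finset.sum_mul, Finset.sum_mul]
    refine Finset.sum_congr rfl fun j _ => by ring
  simp only [smul_sub, Finset.sum_sub_distrib, e3]
  simp only [Finset.sum_range_succ' _ N, h0, Finset.smul_sum, smul_smul, pow_zero, one_smul]
  have e4 : ∀ k : ℕ, h * (γ ^ (k + 1) * h ^ k) = (γ * h) ^ (k + 1) := fun k => by ring
  simp only [e4]
  abel

/-- The moment conditions are a Vandermonde system, invertible because the nodes are distinct. -/
theorem exists_quadrature_weights (N : ℕ) {c : ℕ → ℝ} (hc : Function.Injective c) (r : ℕ → ℝ) :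
    ∃ w : ℕ → ℝ, ∀ k < N, ∑ j ∈ Finset.range N, w j * c j ^ k = r k := by
  set M : Matrix (Fin N) (Fin N) ℝ := Matrix.vandermonde fun i : Fin N => c i with hM
  have hdet : IsUnit M.det := by
    rw [isUnit_iff_ne_zero, hM, Matrix.det_vandermonde_ne_zero_iff]
    exact fun i j hij => Fin.ext (hc hij)
  set w : Fin N → ℝ := Matrix.vecMul (fun k : Fin N => r k) M⁻¹ with hw
  have h1 : Matrix.vecMul w M = fun k : Fin N => r k := by
    rw [hw, Matrix.vecMul_vecMul, Matrix.nonsing_inv_mul _ hdet, Matrix.vecMul_one]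
  refine ⟨fun j => if h : j < N then w ⟨j, h⟩ else 0, fun k hk => ?_⟩
  have := congrFun h1 ⟨k, hk⟩
  rw [← this, Finset.sum_range]
  simp [Matrix.vecMul, dotProduct, hM, Matrix.vandermonde]

end Trajectories

/-! ### Runge–Kutta methods of every order -/

section Existence

/-- Runge–Kutta methods from iterated quadrature with `N` nodes: the stage `m N + r` belongs to the
`m`-th iterate at the `r`-th node. -/
noncomputable def iteratedQuadrature (N M : ℕ) (A : ℕ → ℕ → ℝ) (w : ℕ → ℝ) : RKTableau where
  s := N * (M + 1)
  a i j := if j / N + 1 = i / N then A (i % N) (j % N) else 0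
  b j := if j / N = M then w (j % N) else 0

theorem sum_block {V : Type*} [AddCommGroup V] [Module ℝ V] {N : ℕ} (hN : 0 < N) (m L : ℕ)
    (hL : (m + 1) * N ≤ L) (w : ℕ → ℝ) (f : ℕ → V) :
    ∑ j ∈ Finset.range L, (if j / N = m then w (j % N) else 0) • f j =
      ∑ r ∈ Finset.range N, w r • f (m * N + r) := by
  have hsub : Finset.Ico (m * N) ((m + 1) * N) ⊆ Finset.range L := by
    intro j hj
    simp only [Finset.mem_Ico, Finset.mem_range] at hj ⊢
    omega
  rw [← Finset.sum_subset hsub, Finset.sum_Ico_eq_sum_range]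
  · have : (m + 1) * N - m * N = N := by rw [add_mul, one_mul, Nat.add_sub_cancel_left]
    rw [this]
    refine Finset.sum_congr rfl fun r hr => ?_
    have hr := Finset.mem_range.1 hr
    have h1 : (m * N + r) / N = m := by
      rw [mul_comm, Nat.mul_add_div hN, Nat.div_eq_of_lt hr, add_zero]
    have h2 : (m * N + r) % N = r := by
      rw [mul_comm, Nat.mul_add_mod, Nat.mod_eq_of_lt hr]
    rw [h1, h2, if_pos rfl]
  · intro j _ hj
    rw [if_neg, zero_smul]
    rintro rfl
    apply hj
    rw [Finset.mem_Ico]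
    exact ⟨Nat.div_mul_le_self j N, by
      have := Nat.lt_mul_div_succ j hN
      rw [mul_comm]; exact this⟩

theorem RKTableau.stage_eq {V : Type*} [AddCommGroup V] [Module ℝ V] (T : RKTableau)
    (F : V → ℝ → V) (t h : ℝ) (x : V) (i : ℕ) :
    T.stage F t h x i = F (x + h • ∑ j ∈ Finset.range i, T.a i j • T.stage F t h x j)
      (t + h * ∑ j ∈ Finset.range i, T.a i j) := by
  rw [RKTableau.stage, Finset.sum_range, Finset.sum_range]

/-- For every `p` there is an explicit Runge–Kutta method of order `p`. -/
theorem exists_hasOrder (p : ℕ) : ∃ T : RKTableau, T.HasOrder p := by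
  set N := p + 1 with hN
  have hN0 : 0 < N := by omega
  have hc : Function.Injective (fun j : ℕ => (j : ℝ)) := Nat.cast_injective
  -- The nodes are the times `t + j h` for `j = 0, …, p`. Row `r` of `A` integrates polynomials of
  -- degree at most `p` exactly over `[0, r]`, and `w` does so over `[0, 1]`.
  choose A hA using fun r : ℕ =>
    exists_quadrature_weights N hc fun k => (r : ℝ) ^ (k + 1) / ((k : ℝ) + 1)
  obtain ⟨w, hw⟩ := exists_quadrature_weights N hc fun k => (1 : ℝ) ^ (k + 1) / ((k : ℝ) + 1)
  set T := iteratedQuadrature N p A w with hT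
  refine ⟨T, fun n U F hU hF t y hy hd => ?_⟩
  have hys := contDiffAt_of_hasDerivAt hU hF hy hd
  set u : ℝ → Fin n → ℝ := fun h => y (t + h) with hu
  set u' : ℝ → Fin n → ℝ := fun h => F (y (t + h)) (t + h) with hu'
  have ht : Tendsto (fun h : ℝ => t + h) (𝓝 0) (𝓝 t) := by
    have : Continuous fun h : ℝ => t + h := by fun_prop
    simpa using this.tendsto 0
  have hus : ContDiffAt ℝ ∞ u 0 := by
    refine ContDiffAt.comp (0 : ℝ) (g := y) ?_ (by fun_prop)
    simpa using hys
  have hud : ∀ᶠ h in 𝓝 0, HasDerivAt u (u' h) h := by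
    filter_upwards [ht.eventually hd] with h hh
    exact hh.comp_const_add t h
  have hFs : ContDiffAt ℝ ∞ (fun x : (Fin n → ℝ) × ℝ => F x.1 x.2) (y t, t) :=
    hF.contDiffAt (hU.mem_nhds hy)
  have hu's : ContDiffAt ℝ ∞ u' 0 := by
    refine ContDiffAt.comp (0 : ℝ) (g := fun x : (Fin n → ℝ) × ℝ => F x.1 x.2)
      (f := fun h => (u h, t + h)) (by simpa [hu] using hFs) (hus.prodMk (by fun_prop))
  have hu0 : u 0 = y t := by simp [hu]
  -- Discrete Picard iteration: block `0` has zero coefficients and so freezes the field at the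
  -- initial point, with error `O(h)`. Each later block integrates the field values of the preceding
  -- one, and the factor `h` of the integral gains a power.
  have stage_err : ∀ m ≤ p, ∀ r < N,
      (fun h => T.stage F t h (y t) (m * N + r) - u' (r * h)) =O[𝓝 0] fun h => h ^ (m + 1) := by
    intro m
    induction m with
    | zero =>
      intro _ r hr
      have e1 : (fun h => u' h - u' 0) =O[𝓝 0] fun h : ℝ => h ^ 1 := by
        simpa using (hu's.differentiableAt (by simp)).isBigO_sub
      refine (isBigO_comp_mul e1 r).neg_left.congr_left fun h => ?_
      have hz : ∀ j, T.a r j = 0 := fun j => by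
        simp [hT, iteratedQuadrature, Nat.div_eq_of_lt hr]
      rw [zero_mul, zero_add, RKTableau.stage_eq]
      simp [hz, hu']
    | succ m ih =>
      intro hm r hr
      have hdiv : ((m + 1) * N + r) / N = m + 1 := by
        rw [mul_comm, Nat.mul_add_div hN0, Nat.div_eq_of_lt hr, add_zero]
      have hmod : ((m + 1) * N + r) % N = r := by
        rw [mul_comm, Nat.mul_add_mod, Nat.mod_eq_of_lt hr]
      have ha : ∀ j, T.a ((m + 1) * N + r) j = if j / N = m then A r (j % N) else 0 := fun j => by
        simp [hT, iteratedQuadrature, hdiv, hmod]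
      -- Exactness for constants, the moment `k = 0`, puts the stage at the time `t + r h`.
      have hsumA : ∑ j ∈ Finset.range ((m + 1) * N + r), T.a ((m + 1) * N + r) j = r := by
        have h1 := sum_block hN0 m ((m + 1) * N + r) (by omega) (A r) fun _ => (1 : ℝ)
        have h2 := hA r 0 hN0
        simp only [smul_eq_mul, mul_one] at h1
        simp only [pow_zero, mul_one, zero_add, pow_one, Nat.cast_zero, div_one] at h2
        simp only [ha, h1, h2]
      have hX : (fun h => (y t + h • ∑ j ∈ Finset.range ((m + 1) * N + r),
          T.a ((m + 1) * N + r) j • T.stage F t h (y t) j) - u (r * h)) =O[𝓝 0]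
          fun h => h ^ (m + 2) := by
        have e1 := (isBigO_quadrature (Finset.range N) hus hud (hA r)).trans
          (isBigO_pow_of_le (show m + 2 ≤ N + 1 by omega))
        have e2 : (fun h => ∑ j ∈ Finset.range N,
            A r j • (T.stage F t h (y t) (m * N + j) - u' (j * h))) =O[𝓝 0] fun h => h ^ (m + 1) :=
          IsBigO.fun_sum fun j hj => (ih (by omega) j (Finset.mem_range.1 hj)).const_smul_left (A r j)
        refine (e1.add (isBigO_smul_pow e2)).congr_left fun h => ?_
        simp only [ha, sum_block hN0 m ((m + 1) * N + r) (by omega) (A r), smul_sub,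
          Finset.sum_sub_distrib, hu0]
        abel
      have t1 : Tendsto (fun h : ℝ => u (r * h)) (𝓝 0) (𝓝 (y t)) := by
        have h1 : Tendsto (fun h : ℝ => r * h) (𝓝 0) (𝓝 0) := by
          have : Continuous fun h : ℝ => (r : ℝ) * h := by fun_prop
          simpa using this.tendsto 0
        simpa [hu0] using! hus.continuousAt.tendsto.comp h1
      have t2 := (hX.trans (isBigO_pow_of_le (show 1 ≤ m + 2 by omega))).trans_tendsto
        (by simpa using (continuous_pow 1).tendsto (0 : ℝ))
      have t3 := t2.add t1
      simp only [sub_add_cancel, zero_add] at t3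
      have t4 : Tendsto (fun h : ℝ => t + h * r) (𝓝 0) (𝓝 t) := by
        have : Continuous fun h : ℝ => t + h * (r : ℝ) := by fun_prop
        simpa using this.tendsto 0
      have e3 := isBigO_comp_sub hFs (t3.prodMk_nhds t4) (t1.prodMk_nhds t4)
      refine (e3.trans (IsBigO.trans (IsBigO.of_bound 1 (Eventually.of_forall fun h => ?_)) hX)).congr_left
        fun h => ?_
      · simp
      · rw [RKTableau.stage_eq _ _ _ _ _ ((m + 1) * N + r), hsumA]
        simp only [hu', hu, mul_comm h]
  have e1 := (isBigO_quadrature (Finset.range N) hus hud hw).trans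
    (isBigO_pow_of_le (show p + 1 ≤ N + 1 by omega))
  have e2 : (fun h => ∑ j ∈ Finset.range N,
      w j • (T.stage F t h (y t) (p * N + j) - u' (j * h))) =O[𝓝 0] fun h => h ^ (p + 1) :=
    IsBigO.fun_sum fun j hj => (stage_err p le_rfl j (Finset.mem_range.1 hj)).const_smul_left (w j)
  have e3 := (isBigO_smul_pow e2).trans (isBigO_pow_of_le (show p + 1 ≤ p + 1 + 1 by omega))
  refine (e1.add e3).congr_left fun h => ?_
  have hb := sum_block hN0 p T.s (by rw [hT, iteratedQuadrature, mul_comm]) w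
    (T.stage F t h (y t))
  have hb' : ∀ i, T.b i = if i / N = p then w (i % N) else 0 := fun _ => rfl
  simp only [RKTableau.step, hb', hb, smul_sub, Finset.sum_sub_distrib, hu0, one_mul]
  abel

end Existence

/-! ### The classical Runge–Kutta method -/

section Classical

variable {V V' : Type*} [NormedAddCommGroup V] [NormedSpace ℝ V] [NormedAddCommGroup V']
  [NormedSpace ℝ V']

/-- The first-order Taylor remainder is quadratic, locally uniformly. -/
theorem isBigO_taylor_quadratic {G : V → V'} {w₀ : V} (hG : ContDiffAt ℝ ∞ G w₀) :
    (fun x : V × V => G (x.1 + x.2) - G x.1 - fderiv ℝ G x.1 x.2) =O[𝓝 (w₀, 0)]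
      fun x => ‖x.2‖ ^ 2 := by
  have hG' : ContDiffAt ℝ ∞ (fderiv ℝ G) w₀ := hG.fderiv_right (m := ∞) (by simp)
  obtain ⟨K, hK⟩ := (isBigO_sub_of_contDiffAt hG').bound
  rw [nhds_prod_eq, Filter.eventually_prod_iff] at hK
  obtain ⟨p, hp, q, hq, hpq⟩ := hK
  obtain ⟨δ, hδ, H⟩ := Metric.eventually_nhds_iff_ball.1
    ((hp.and hq).and (eventually_differentiableAt hG))
  refine IsBigO.of_bound (max K 0) ?_
  filter_upwards [prod_mem_nhds (Metric.ball_mem_nhds w₀ (half_pos hδ))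
    (Metric.ball_mem_nhds (0 : V) (half_pos hδ))] with x hx
  obtain ⟨w, v⟩ := x
  have hw : dist w w₀ < δ / 2 := hx.1
  have hv : ‖v‖ < δ / 2 := by simpa using hx.2
  have hsub : ∀ z ∈ Metric.closedBall w ‖v‖, z ∈ Metric.ball w₀ δ := fun z hz => by
    have hz : dist z w ≤ ‖v‖ := hz
    have := dist_triangle z w w₀
    rw [Metric.mem_ball]; linarith
  have hww : w ∈ Metric.closedBall w ‖v‖ := Metric.mem_closedBall_self (norm_nonneg _)
  have key := Convex.norm_image_sub_le_of_norm_hasFDerivWithin_le' (f := G) (f' := fderiv ℝ G)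
    (φ := fderiv ℝ G w) (C := max K 0 * ‖v‖) (s := Metric.closedBall w ‖v‖) (x := w) (y := w + v)
    (fun z hz => (H z (hsub z hz)).2.hasFDerivAt.hasFDerivWithinAt)
    (fun z hz => (hpq (H z (hsub z hz)).1.1 (H w (hsub w hww)).1.2).trans (by
      have hz : dist z w ≤ ‖v‖ := hz
      rw [dist_eq_norm] at hz
      gcongr
      exact le_max_left _ _)) (convex_closedBall _ _) hww (by simp)
  simp only [add_sub_cancel_left] at key
  simpa [pow_two, mul_assoc] using key

/-- The classical Runge–Kutta method has order four. -/
theorem rk4_hasOrder : rk4.HasOrder 4 := by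
  intro n U F hU hF t y hy hd
  have hys := contDiffAt_of_hasDerivAt hU hF hy hd
  set u : ℝ → (Fin n → ℝ) := fun h => y (t + h) with hu
  set u' : ℝ → (Fin n → ℝ) := fun h => F (y (t + h)) (t + h) with hu'
  set G : (Fin n → ℝ) × ℝ → (Fin n → ℝ) := fun x => F x.1 x.2 with hGdef
  have ht : Tendsto (fun h : ℝ => t + h) (𝓝 0) (𝓝 t) := by
    have : Continuous fun h : ℝ => t + h := by fun_prop
    simpa using this.tendsto 0
  have hus : ContDiffAt ℝ ∞ u 0 := by
    refine ContDiffAt.comp (0 : ℝ) (g := y) ?_ (by fun_prop)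
    simpa using hys
  have hud : ∀ᶠ h in 𝓝 0, HasDerivAt u (u' h) h := by
    filter_upwards [ht.eventually hd] with h hh
    exact hh.comp_const_add t h
  have hGs : ContDiffAt ℝ ∞ G (y t, t) := hF.contDiffAt (hU.mem_nhds hy)
  have hu0 : u 0 = y t := by simp [hu]
  obtain ⟨c, hc⟩ := exists_taylor_expansion hus hud
  have hc0 : y t = c 0 := by
    have := ((hc 1).1.eq_zero_imp.self_of_nhds) (by simp)
    rw [← hu0]
    simpa [sub_eq_zero] using this
  have hc1 : F (y t) t = c 1 := by
    have := ((hc 1).2.eq_zero_imp.self_of_nhds) (by simp)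
    simpa [sub_eq_zero, hu'] using this
  -- the linearisation along the solution
  set L : ℝ → (Fin n → ℝ) → (Fin n → ℝ) := fun h v => fderiv ℝ G (u h, t + h) (v, 0) with hL
  have hLadd : ∀ h v w, L h (v + w) = L h v + L h w := fun h v w => by
    simp only [hL, ← map_add, Prod.mk_add_mk, add_zero]
  have hLsmul : ∀ h (a : ℝ) v, L h (a • v) = a • L h v := fun h a v => by
    simp only [hL, ← map_smul, Prod.smul_mk, smul_zero]
  have tends : ∀ a : ℝ, Tendsto (fun h : ℝ => (u (a * h), t + a * h)) (𝓝 0) (𝓝 (y t, t)) := by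
    intro a
    have h1 : Tendsto (fun h : ℝ => a * h) (𝓝 0) (𝓝 0) := by
      have : Continuous fun h : ℝ => a * h := by fun_prop
      simpa using this.tendsto 0
    have h2 := hus.continuousAt.tendsto
    rw [hu0] at h2
    exact (h2.comp h1).prodMk_nhds (ht.comp h1)
  have pow_tendsto : ∀ {e : ℝ → (Fin n → ℝ)} {m : ℕ}, (e =O[𝓝 0] fun h : ℝ => h ^ (m + 1)) →
      Tendsto e (𝓝 0) (𝓝 0) := fun {e m} he => he.trans_tendsto
    (by simpa using (continuous_pow (m + 1)).tendsto (0 : ℝ))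
  -- A stage is evaluated at the exact time but at a position off the solution by `e = O(h^2)`. The
  -- quadratic Taylor remainder is thus `O(h^4)`, negligible after the factor `h` of the step, and
  -- only the linear effect `L e` in the state direction has to be followed.
  have quad : ∀ (a : ℝ) {e : ℝ → (Fin n → ℝ)}, (e =O[𝓝 0] fun h : ℝ => h ^ 2) →
      (fun h => F (u (a * h) + e h) (t + a * h) - u' (a * h) - L (a * h) (e h)) =O[𝓝 0]
        fun h => h ^ 4 := by
    intro a e he
    have t1 := (tends a).prodMk_nhds ((pow_tendsto he).prodMk_nhds
      (tendsto_const_nhds (x := (0 : ℝ))))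
    have h1 := (isBigO_taylor_quadratic hGs).comp_tendsto t1
    refine (h1.trans ?_).congr_left fun h => ?_
    · have h2 := he.norm_left.pow 2
      refine (h2.congr_left fun h => ?_).congr_right fun h => ?_
      · simp
      · ring
    · simp [hGdef, hL, hu', hu]
  -- Freezing the linearisation at time `t` costs one power of `h`.
  have L_lip : ∀ (a : ℝ) {e : ℝ → (Fin n → ℝ)} {m : ℕ}, (e =O[𝓝 0] fun h : ℝ => h ^ m) →
      (fun h => L (a * h) (e h) - L 0 (e h)) =O[𝓝 0] fun h => h ^ (m + 1) := by
    intro a e m he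
    have hG' : ContDiffAt ℝ ∞ (fderiv ℝ G) (y t, t) := hGs.fderiv_right (m := ∞) (by simp)
    have h1 : DifferentiableAt ℝ (fun h => fderiv ℝ G (u h, t + h)) 0 := by
      refine DifferentiableAt.comp (0 : ℝ) (g := fderiv ℝ G) (f := fun h => (u h, t + h)) ?_ ?_
      · simpa [hu0] using hG'.differentiableAt (by simp)
      · exact (hus.differentiableAt (by simp)).prodMk (by fun_prop)
    have h2 : (fun h => fderiv ℝ G (u h, t + h) - fderiv ℝ G (u 0, t + 0)) =O[𝓝 0]
        fun h : ℝ => h ^ 1 := by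
      simpa using h1.isBigO_sub
    have h3 := isBigO_comp_mul h2 a
    have h4 : (fun h => (fderiv ℝ G (u (a * h), t + a * h) - fderiv ℝ G (u 0, t + 0))
        (e h, (0 : ℝ))) =O[𝓝 0] fun h : ℝ => h ^ 1 * h ^ m := by
      refine IsBigO.trans (IsBigO.of_bound 1 (Eventually.of_forall fun h => ?_))
        (h3.norm_left.mul he.norm_left)
      rw [one_mul, norm_mul, norm_norm, norm_norm]
      simpa using ContinuousLinearMap.le_opNorm
        (fderiv ℝ G (u (a * h), t + a * h) - fderiv ℝ G (u 0, t + 0)) (e h, (0 : ℝ))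
    refine (h4.congr_left fun h => ?_).congr_right fun h => by ring
    simp [hL]
  have L_const : ∀ (a : ℝ) {e : ℝ → (Fin n → ℝ)} {m : ℕ}, (e =O[𝓝 0] fun h : ℝ => h ^ m) →
      (fun h => L a (e h)) =O[𝓝 0] fun h => h ^ m := by
    intro a e m he
    refine IsBigO.trans (IsBigO.of_bound ‖fderiv ℝ G (u a, t + a)‖ (Eventually.of_forall fun h => ?_))
      he
    simpa [hL] using ContinuousLinearMap.le_opNorm (fderiv ℝ G (u a, t + a)) (e h, (0 : ℝ))
  -- the stages
  have st0 : ∀ h, rk4.stage F t h (y t) 0 = c 1 := fun h => by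
    rw [RKTableau.stage_eq]; simp [hc1]
  have st1 : ∀ h, rk4.stage F t h (y t) 1 =
      F (c 0 + h • ((1 / 2 : ℝ) • c 1)) (t + 1 / 2 * h) := fun h => by
    rw [RKTableau.stage_eq]
    simp [rk4, hc0, ← st0 h, mul_comm]
  have st2 : ∀ h, rk4.stage F t h (y t) 2 =
      F (c 0 + h • ((1 / 2 : ℝ) • rk4.stage F t h (y t) 1)) (t + 1 / 2 * h) := fun h => by
    rw [RKTableau.stage_eq]
    simp [rk4, hc0, mul_comm]
  have st3 : ∀ h, rk4.stage F t h (y t) 3 =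
      F (c 0 + h • rk4.stage F t h (y t) 2) (t + 1 * h) := fun h => by
    rw [RKTableau.stage_eq]
    simp [rk4, hc0]
  set k₁ : ℝ → (Fin n → ℝ) := fun h => rk4.stage F t h (y t) 1 with hk₁
  set k₂ : ℝ → (Fin n → ℝ) := fun h => rk4.stage F t h (y t) 2 with hk₂
  set k₃ : ℝ → (Fin n → ℝ) := fun h => rk4.stage F t h (y t) 3 with hk₃
  set e₁ : ℝ → (Fin n → ℝ) := fun h => c 0 + h • ((1 / 2 : ℝ) • c 1) - u (1 / 2 * h) with he₁
  set e₂ : ℝ → (Fin n → ℝ) := fun h => c 0 + h • ((1 / 2 : ℝ) • k₁ h) - u (1 / 2 * h) with he₂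
  set e₃ : ℝ → (Fin n → ℝ) := fun h => c 0 + h • k₂ h - u (1 * h) with he₃
  -- expansions of the solution at the nodes
  have xu : ∀ a : ℝ, (fun h : ℝ => u (a * h) - (c 0 + (a * h) • c 1 + (a * h) ^ 2 • c 2 +
      (a * h) ^ 3 • c 3)) =O[𝓝 0] fun h => h ^ 4 := fun a => by
    simpa [Finset.sum_range_succ] using isBigO_comp_mul (hc 4).1 a
  have xu' : ∀ a : ℝ, (fun h : ℝ => u' (a * h) - (c 1 + (2 * (a * h)) • c 2 +
      (3 * (a * h) ^ 2) • c 3)) =O[𝓝 0] fun h => h ^ 3 := fun a => by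
    refine (isBigO_comp_mul (hc 3).2 a).congr_left fun h => ?_
    simp only [Finset.sum_range_succ, Finset.sum_range_zero]
    norm_num
  have small : ∀ {m k : ℕ} (v : (Fin n → ℝ)) (a : ℝ), m ≤ k →
      (fun h : ℝ => (a * h ^ k) • v) =O[𝓝 0] fun h => h ^ m := fun {m k} v a hmk => by
    have h1 : (fun h : ℝ => a * h ^ k) =O[𝓝 0] fun h => h ^ m :=
      (isBigO_const_mul_self _ _ _).trans (isBigO_pow_of_le hmk)
    simpa using h1.smul (isBigO_const_const v (one_ne_zero (α := ℝ)) (𝓝 (0 : ℝ)))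
  -- first stage error
  have E₁ : (fun h => e₁ h + (1 / 4 * h ^ 2) • c 2 + (1 / 8 * h ^ 3) • c 3) =O[𝓝 0]
      fun h => h ^ 4 := by
    refine (xu (1 / 2)).neg_left.congr_left fun h => ?_
    simp only [he₁]
    module
  have E₁s : e₁ =O[𝓝 0] fun h => h ^ 2 := by
    refine (((E₁.trans (isBigO_pow_of_le (by omega))).sub (small (c 2) (1 / 4) le_rfl)).sub
      (small (c 3) (1 / 8) (by omega : 2 ≤ 3))).congr_left fun h => ?_
    abel
  have K₁ : (fun h => k₁ h - u' (1 / 2 * h) - L (1 / 2 * h) (e₁ h)) =O[𝓝 0] fun h => h ^ 4 := by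
    refine (quad (1 / 2) E₁s).congr_left fun h => ?_
    simp only [hk₁, st1, he₁, add_sub_cancel]
  -- `L e₁`
  have Le₁ : (fun h => L (1 / 2 * h) (e₁ h) + (1 / 4 * h ^ 2) • L 0 (c 2)) =O[𝓝 0]
      fun h => h ^ 3 := by
    have h1 := L_lip (1 / 2) E₁s
    have h2 := L_const 0 (((E₁.trans (isBigO_pow_of_le (by omega : 3 ≤ 4))).sub
      (small (c 3) (1 / 8) (le_refl 3))))
    refine (h1.add h2).congr_left fun h => ?_
    have : e₁ h + (1 / 4 * h ^ 2) • c 2 + (1 / 8 * h ^ 3) • c 3 - (1 / 8 * h ^ 3) • c 3 =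
      e₁ h + (1 / 4 * h ^ 2) • c 2 := by abel
    simp only [this, hLadd, hLsmul]
    abel
  have E₂ : (fun h => e₂ h - (1 / 4 * h ^ 2) • c 2 - (1 / 4 * h ^ 3) • c 3 +
      (1 / 8 * h ^ 3) • L 0 (c 2)) =O[𝓝 0] fun h => h ^ 4 := by
    have h1 := isBigO_smul_pow ((((K₁.trans (isBigO_pow_of_le (by omega : 3 ≤ 4))).add
      (xu' (1 / 2))).add Le₁).const_smul_left (1 / 2 : ℝ))
    refine (h1.sub (xu (1 / 2))).congr_left fun h => ?_
    simp only [he₂, Pi.smul_apply]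
    module
  have E₂s : e₂ =O[𝓝 0] fun h => h ^ 2 := by
    refine ((((E₂.trans (isBigO_pow_of_le (by omega))).add (small (c 2) (1 / 4) le_rfl)).add
      (small (c 3) (1 / 4) (by omega : 2 ≤ 3))).sub
      (small (L 0 (c 2)) (1 / 8) (by omega : 2 ≤ 3))).congr_left fun h => ?_
    abel
  have K₂ : (fun h => k₂ h - u' (1 / 2 * h) - L (1 / 2 * h) (e₂ h)) =O[𝓝 0] fun h => h ^ 4 := by
    refine (quad (1 / 2) E₂s).congr_left fun h => ?_
    simp only [hk₂, st2, he₂, hk₁, add_sub_cancel]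
  have Le₂ : (fun h => L (1 / 2 * h) (e₂ h) - (1 / 4 * h ^ 2) • L 0 (c 2)) =O[𝓝 0]
      fun h => h ^ 3 := by
    have h1 := L_lip (1 / 2) E₂s
    have h2 := L_const 0 (((E₂.trans (isBigO_pow_of_le (by omega : 3 ≤ 4))).add
      (small (c 3) (1 / 4) (le_refl 3))).sub (small (L 0 (c 2)) (1 / 8) (le_refl 3)))
    refine (h1.add h2).congr_left fun h => ?_
    have : e₂ h - (1 / 4 * h ^ 2) • c 2 - (1 / 4 * h ^ 3) • c 3 + (1 / 8 * h ^ 3) • L 0 (c 2) +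
      (1 / 4 * h ^ 3) • c 3 - (1 / 8 * h ^ 3) • L 0 (c 2) = e₂ h + (-(1 / 4 * h ^ 2)) • c 2 := by
      module
    simp only [this, hLadd, hLsmul]
    module
  have E₃ : (fun h => e₃ h + (1 / 4 * h ^ 3) • c 3 - (1 / 4 * h ^ 3) • L 0 (c 2)) =O[𝓝 0]
      fun h => h ^ 4 := by
    have h1 := isBigO_smul_pow (((K₂.trans (isBigO_pow_of_le (by omega : 3 ≤ 4))).add
      (xu' (1 / 2))).add Le₂)
    refine (h1.sub (xu 1)).congr_left fun h => ?_
    simp only [he₃]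
    module
  have E₃s : e₃ =O[𝓝 0] fun h => h ^ 3 := by
    refine (((E₃.trans (isBigO_pow_of_le (by omega))).sub (small (c 3) (1 / 4) le_rfl)).add
      (small (L 0 (c 2)) (1 / 4) le_rfl)).congr_left fun h => ?_
    abel
  have K₃ : (fun h => k₃ h - u' (1 * h) - L (1 * h) (e₃ h)) =O[𝓝 0] fun h => h ^ 4 := by
    refine (quad 1 (E₃s.trans (isBigO_pow_of_le (by omega)))).congr_left fun h => ?_
    simp only [hk₃, st3, he₃, hk₂, add_sub_cancel]
  -- The two midpoint errors start with opposite terms `∓ (h²/4) c₂`. Their sum is `O(h^3)`, and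
  -- twice its leading term is the negative of that of `e₃`.
  have E₁₂ : (fun h => e₁ h + e₂ h - (1 / 8 * h ^ 3) • c 3 + (1 / 8 * h ^ 3) • L 0 (c 2)) =O[𝓝 0]
      fun h => h ^ 4 := by
    refine (E₁.add E₂).congr_left fun h => ?_
    module
  have E₁₂s : (fun h => e₁ h + e₂ h) =O[𝓝 0] fun h => h ^ 3 := by
    refine (((E₁₂.trans (isBigO_pow_of_le (by omega))).add (small (c 3) (1 / 8) le_rfl)).sub
      (small (L 0 (c 2)) (1 / 8) le_rfl)).congr_left fun h => ?_
    abel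
  -- the linear terms cancel
  have cancel : (fun h => (2 : ℝ) • (L (1 / 2 * h) (e₁ h) + L (1 / 2 * h) (e₂ h)) +
      L (1 * h) (e₃ h)) =O[𝓝 0] fun h => h ^ 4 := by
    have h1 := (L_lip (1 / 2) E₁₂s).const_smul_left (2 : ℝ)
    have h2 := L_lip 1 E₃s
    have h3 := L_const 0 ((E₁₂.const_smul_left (2 : ℝ)).add E₃)
    refine ((h1.add h2).add h3).congr_left fun h => ?_
    have : (2 : ℝ) • (e₁ h + e₂ h - (1 / 8 * h ^ 3) • c 3 + (1 / 8 * h ^ 3) • L 0 (c 2)) +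
      (e₃ h + (1 / 4 * h ^ 3) • c 3 - (1 / 4 * h ^ 3) • L 0 (c 2)) =
      (2 : ℝ) • (e₁ h + e₂ h) + e₃ h := by module
    simp only [Pi.smul_apply, this, hLadd, hLsmul]
    module
  -- Simpson's rule
  have simpson : (fun h => u 0 + h • ∑ j ∈ Finset.range 3,
      (if j = 1 then 4 / 6 else 1 / 6 : ℝ) • u' ((j / 2 : ℝ) * h) - u (1 * h)) =O[𝓝 0]
      fun h => h ^ 5 := by
    refine isBigO_quadrature (N := 4) (Finset.range 3) hus hud (c := fun j : ℕ => (j : ℝ) / 2)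
      fun k hk => ?_
    interval_cases k <;> simp [Finset.sum_range_succ] <;> norm_num
  -- Both middle stages approximate `u' (h/2)`, so their weights `2/6 + 2/6` form the Simpson weight
  -- `4/6`.
  have final := isBigO_smul_pow ((((K₁.const_smul_left (2 : ℝ)).add (K₂.const_smul_left (2 : ℝ))).add
    K₃).add cancel |>.const_smul_left (1 / 6 : ℝ))
  refine (final.add simpson).congr_left fun h => ?_
  have hs : rk4.step F t h (y t) = y t + h • ((1 / 6 : ℝ) • c 1 + (2 / 6 : ℝ) • k₁ h +
      (2 / 6 : ℝ) • k₂ h + (1 / 6 : ℝ) • k₃ h) := by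
    have : rk4.s = 4 := rfl
    rw [RKTableau.step, this]
    have b0 : rk4.b 0 = 1 / 6 := by simp [rk4]
    have b1 : rk4.b 1 = 2 / 6 := by simp [rk4]
    have b2 : rk4.b 2 = 2 / 6 := by simp [rk4]
    have b3 : rk4.b 3 = 1 / 6 := by simp [rk4]
    simp only [Finset.sum_range_succ, Finset.sum_range_zero, zero_add, st0, b0, b1, b2, b3]
    rfl
  have hu'0 : u' 0 = c 1 := by simp [hu', hc1]
  rw [hs]
  simp only [Pi.smul_apply, Finset.sum_range_succ, Finset.sum_range_zero, hu0]
  norm_num [hu'0]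
  simp only [hu]
  module

end Classical

/-! ### Gradients of the Hamiltonian and of its parts -/

section Gradients

theorem grad_dotProduct (g : Vec → ℝ) (x v : Vec) : grad g x ⬝ᵥ v = fderiv ℝ g x v := by
  conv_rhs => rw [pi_eq_sum_univ' v]
  simp only [map_sum, map_smul, dotProduct, grad, smul_eq_mul]
  refine Finset.sum_congr rfl fun i _ => ?_
  rw [mul_comm]

theorem jac_mulVec {G : Vec → Vec} {x : Vec} (hG : DifferentiableAt ℝ G x) (v : Vec) :
    Matrix.mulVec (jac G x) v = fderiv ℝ G x v := by
  ext i
  have h1 : (jac G x).mulVec v i = grad (fun y => G y i) x ⬝ᵥ v := rfl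
  rw [h1, grad_dotProduct, fderiv_apply hG]
  rfl

theorem grad_eq_of_fderiv {g : Vec → ℝ} {x w : Vec} (h : ∀ v, fderiv ℝ g x v = w ⬝ᵥ v) :
    grad g x = w :=
  dotProduct_eq _ _ fun v => by rw [grad_dotProduct, h]

theorem hasFDerivAt_dotProduct {E : Type*} [NormedAddCommGroup E] [NormedSpace ℝ E]
    {u v : E → Vec} {x : E} {u' v' : E →L[ℝ] Vec} (hu : HasFDerivAt u u' x)
    (hv : HasFDerivAt v v' x) :
    ∃ L : E →L[ℝ] ℝ, HasFDerivAt (fun y => u y ⬝ᵥ v y) L x ∧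
      ∀ w, L w = u x ⬝ᵥ v' w + u' w ⬝ᵥ v x := by
  have := HasFDerivAt.fun_sum (u := Finset.univ) (fun i _ =>
    ((hasFDerivAt_pi'.1 hu i).mul (hasFDerivAt_pi'.1 hv i)))
  refine ⟨_, this, fun w => ?_⟩
  simp [dotProduct, Finset.sum_add_distrib, mul_comm]

theorem fderiv_const_mul_dotProduct_self_add {u : Vec → Vec} {g : Vec → ℝ} {x : Vec}
    (hu : DifferentiableAt ℝ u x) (hg : DifferentiableAt ℝ g x) (c : ℝ) (v : Vec) :
    fderiv ℝ (fun y => c * (u y ⬝ᵥ u y) + g y) x v =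
      2 * c * (u x ⬝ᵥ fderiv ℝ u x v) + fderiv ℝ g x v := by
  obtain ⟨L, hL, hLv⟩ := hasFDerivAt_dotProduct hu.hasFDerivAt hu.hasFDerivAt
  rw [((hL.const_mul c).fun_add hg.hasFDerivAt).fderiv]
  simp only [add_apply, smul_apply, hLv, smul_eq_mul]
  rw [dotProduct_comm (fderiv ℝ u x v)]
  ring

end Gradients

namespace ChargedParticle

variable (S : ChargedParticle)

theorem contDiffAt_A {q : Vec} {t : ℝ} (h : (q, t) ∈ S.Ω) :
    ContDiffAt ℝ ∞ (fun x : Vec × ℝ => S.A x.1 x.2) (q, t) :=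
  S.smooth_A.contDiffAt (S.isOpen_Ω.mem_nhds h)

theorem contDiffAt_φ {q : Vec} {t : ℝ} (h : (q, t) ∈ S.Ω) :
    ContDiffAt ℝ ∞ (fun x : Vec × ℝ => S.φ x.1 x.2) (q, t) :=
  S.smooth_φ.contDiffAt (S.isOpen_Ω.mem_nhds h)

theorem differentiableAt_A {q : Vec} {t : ℝ} (h : (q, t) ∈ S.Ω) :
    DifferentiableAt ℝ (fun y => S.A y t) q :=
  DifferentiableAt.comp q (g := fun x : Vec × ℝ => S.A x.1 x.2) (f := fun y => (y, t))
    ((S.contDiffAt_A h).differentiableAt (by simp)) (by fun_prop)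

theorem differentiableAt_φ {q : Vec} {t : ℝ} (h : (q, t) ∈ S.Ω) :
    DifferentiableAt ℝ (fun y => S.φ y t) q :=
  DifferentiableAt.comp q (g := fun x : Vec × ℝ => S.φ x.1 x.2) (f := fun y => (y, t))
    ((S.contDiffAt_φ h).differentiableAt (by simp)) (by fun_prop)

/-- Expresses `∇f` through the admissible evaluations `A`, `A'` and `∇φ`. The chain rule requires
the point to lie in the domain, which is why explicitness is asserted only where the map is defined.
-/
theorem grad_f {q : Vec} {t : ℝ} (h : (q, t) ∈ S.Ω) :
    grad (fun y => S.f y t) q = (S.e ^ 2 / S.m) •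
      Matrix.vecMul (S.A q t) (jac (fun y => S.A y t) q) + S.e • grad (fun y => S.φ y t) q := by
  refine grad_eq_of_fderiv fun v => ?_
  have hA := S.differentiableAt_A h
  have hm := S.m_pos.ne'
  have h1 : (fun y => S.f y t) =
      fun y => (S.e ^ 2 / (2 * S.m)) * (S.A y t ⬝ᵥ S.A y t) + S.e * S.φ y t := by
    ext y; simp only [f]; ring
  rw [h1, fderiv_const_mul_dotProduct_self_add hA ((S.differentiableAt_φ h).const_mul _),
    fderiv_const_mul (S.differentiableAt_φ h), add_dotProduct, smul_dotProduct, smul_dotProduct,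
    ← Matrix.dotProduct_mulVec, jac_mulVec hA, grad_dotProduct]
  simp only [smul_apply, smul_eq_mul]
  field_simp

theorem grad_H_position {q p : Vec} {t : ℝ} (h : (q, t) ∈ S.Ω) :
    grad (fun q => S.H q p t) q = (-(S.e / S.m)) •
      Matrix.vecMul p (jac (fun y => S.A y t) q) + grad (fun y => S.f y t) q := by
  refine grad_eq_of_fderiv fun v => ?_
  have hA := S.differentiableAt_A h
  have hm := S.m_pos.ne'
  have hu : DifferentiableAt ℝ (fun y => p - S.e • S.A y t) q := (hA.fun_const_smul S.e).const_sub p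
  have hu' : fderiv ℝ (fun y => p - S.e • S.A y t) q v = -(S.e • fderiv ℝ (fun y => S.A y t) q v) := by
    rw [fderiv_const_sub, fderiv_fun_const_smul hA]; rfl
  have h1 : (fun y => S.H y p t) = fun y => (1 / (2 * S.m)) *
    ((p - S.e • S.A y t) ⬝ᵥ (p - S.e • S.A y t)) + S.e * S.φ y t := rfl
  rw [h1, fderiv_const_mul_dotProduct_self_add hu ((S.differentiableAt_φ h).const_mul _), hu',
    fderiv_const_mul (S.differentiableAt_φ h), S.grad_f h]
  simp only [add_dotProduct, smul_dotProduct, ← Matrix.dotProduct_mulVec, jac_mulVec hA,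
    grad_dotProduct, dotProduct_neg, dotProduct_smul, sub_dotProduct,
    smul_apply, smul_eq_mul]
  field_simp
  ring

theorem grad_H_momentum (q p : Vec) (t : ℝ) :
    grad (fun p => S.H q p t) p = (1 / S.m) • p + S.velocity q t := by
  refine grad_eq_of_fderiv fun v => ?_
  have hm := S.m_pos.ne'
  have hu : DifferentiableAt ℝ (fun y : Vec => y - S.e • S.A q t) p := by fun_prop
  have hu' : fderiv ℝ (fun y : Vec => y - S.e • S.A q t) p v = v := by
    rw [fderiv_sub_const, fderiv_fun_id]; rfl
  have h1 : (fun y => S.H q y t) = fun y => (1 / (2 * S.m)) *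
    ((y - S.e • S.A q t) ⬝ᵥ (y - S.e • S.A q t)) + S.e * S.φ q t := rfl
  rw [h1, fderiv_const_mul_dotProduct_self_add hu (differentiableAt_const _), hu']
  simp only [add_dotProduct, smul_dotProduct, sub_dotProduct, velocity, smul_eq_mul,
    fderiv_fun_const, Pi.zero_apply, zero_apply]
  field_simp
  ring

theorem grad_H₁_momentum (q p : Vec) (t : ℝ) :
    grad (fun p => S.H₁ q p t) p = (1 / S.m) • p := by
  refine grad_eq_of_fderiv fun v => ?_
  have hm := S.m_pos.ne'
  have h1 : (fun y => S.H₁ q y t) = fun y => (1 / (2 * S.m)) * (y ⬝ᵥ y) + 0 := by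
    ext y; simp only [H₁]; ring
  rw [h1, fderiv_const_mul_dotProduct_self_add (u := fun y => y) (g := fun _ => 0)
    differentiableAt_fun_id (differentiableAt_const _), fderiv_fun_id]
  simp only [smul_dotProduct, smul_eq_mul, fderiv_fun_const, Pi.zero_apply,
    zero_apply, ContinuousLinearMap.id_apply]
  field_simp
  ring

theorem grad_H₁_position (q p : Vec) (t : ℝ) : grad (fun q => S.H₁ q p t) q = 0 := by
  refine grad_eq_of_fderiv fun v => ?_
  simp [H₁]

end ChargedParticle

/-! ### The kinetic flow -/

section KineticFlow

variable (S : ChargedParticle)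

theorem psi₁_psi₁ (a b c : ℝ) (z : Phase) : psi₁ S c b (psi₁ S b a z) = psi₁ S c a z := by
  simp only [psi₁, Prod.mk.injEq, and_true]
  module

/-- `psi₁` is the exact flow of the kinetic energy. -/
theorem isTrajectory_H₁_iff (ζ : ℝ → Phase) :
    IsTrajectory S.H₁ Set.univ ζ ↔ ∀ t₁ t₀ : ℝ, ζ t₁ = psi₁ S t₁ t₀ (ζ t₀) := by
  simp only [IsTrajectory, S.grad_H₁_momentum, S.grad_H₁_position, neg_zero, mem_univ,
    hasDerivWithinAt_univ, forall_true_left]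
  constructor
  · intro h t₁ t₀
    have h1 : ∀ τ, HasDerivAt (fun s => (ζ s).1) ((1 / S.m) • (ζ τ).2) τ := fun τ =>
      (h τ).fst
    have h2 : ∀ τ, HasDerivAt (fun s => (ζ s).2) 0 τ := fun τ =>
      (h τ).snd
    have hp : ∀ a b, (ζ a).2 = (ζ b).2 := is_const_of_deriv_eq_zero
      (fun τ => (h2 τ).differentiableAt) fun τ => (h2 τ).deriv
    have h3 : ∀ τ, HasDerivAt (fun s => (ζ s).1 - (s / S.m) • (ζ t₀).2) 0 τ := fun τ => by
      have := (h1 τ).sub (((hasDerivAt_id τ).div_const S.m).smul_const (ζ t₀).2)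
      rwa [hp τ t₀, sub_self] at this
    have hq := is_const_of_deriv_eq_zero (fun τ => (h3 τ).differentiableAt) (fun τ => (h3 τ).deriv)
      t₁ t₀
    refine Prod.ext ?_ (hp t₁ t₀)
    rw [sub_eq_sub_iff_add_eq_add] at hq
    rw [← add_left_inj ((t₀ / S.m) • (ζ t₀).2), hq]
    simp only [psi₁]
    module
  · intro h τ
    have h1 : ζ = fun s => ((ζ 0).1 + ((s - 0) / S.m) • (ζ 0).2, (ζ 0).2) := funext fun s => h s 0
    have h2 : (ζ τ).2 = (ζ 0).2 := by rw [h τ 0]; rfl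
    rw [h2]
    conv => enter [1]; rw [h1]
    exact ((((hasDerivAt_id τ).sub_const 0).div_const S.m).smul_const (ζ 0).2
      |>.const_add (ζ 0).1).prodMk (hasDerivAt_const _ _)

end KineticFlow

/-! ### Merging kinetic shifts into an alternating composition -/

section Compositions

theorem psi₁_mk (S : ChargedParticle) {a b c : ℝ} (h : b - a = c) (z : Phase) :
    psi₁ S b a z = (z.1 + (c / S.m) • z.2, z.2) := by rw [← h]; rfl

/-- The seven substeps of the fourth-order method. -/
theorem essrk4_eq (S : ChargedParticle) (t h : ℝ) (z : Phase) :
    essrk4 S t h z = essrk rk4 S 4 (t + h) t z := by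
  have hγ : gam (2 * 0 + 2) = 1 / (2 - (2 : ℝ) ^ (1 / 3 : ℝ)) := by
    simp only [gam]; norm_num
  change _ = theta rk4 S 1 (t + h) t z
  simp only [theta, hγ, add_sub_cancel_left, essrk4, psi₁_psi₁]
  set γ : ℝ := 1 / (2 - (2 : ℝ) ^ (1 / 3 : ℝ)) with hγd
  -- The half-shifts of adjacent Strang steps have merged; their lengths add to `γh/2 + (1-2γ)h/2 =
  -- h/2 - γh/2`.
  rw [psi₁_mk S (c := γ * h / 2) (by ring), psi₁_mk S (c := h / 2 - γ * h / 2) (by ring),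
    psi₁_mk S (c := h / 2 - γ * h / 2) (by ring), psi₁_mk S (c := γ * h / 2) (by ring)]

theorem alternating_congr (T : RKTableau) (S : ChargedParticle) {s s' τ τ' : ℕ → ℝ} (l : ℕ)
    (hs : ∀ i ≤ l + 1, s i = s' i) (hτ : ∀ i ≤ l, τ i = τ' i) :
    alternating T S s τ l = alternating T S s' τ' l := by
  induction l with
  | zero => simp only [alternating, hs 0 (by omega), hs 1 le_rfl]
  | succ l ih =>
    simp only [alternating, hs (l + 2) le_rfl, hs (l + 1) (by omega), hτ l (by omega),
      hτ (l + 1) le_rfl, ih (fun i hi => hs i (by omega)) fun i hi => hτ i (by omega)]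

/-- Concatenation of sequences of nodes. -/
def joinNodes (l : ℕ) (s s' : ℕ → ℝ) (i : ℕ) : ℝ := if i ≤ l then s i else s' (i - l)

/-- The last kinetic shift of the first composition and the first one of the second merge, so their
common node `s (l + 1) = s' 0` disappears; the common node `τ l = τ' 0` separates two `psi₂` and is
kept. Both effects are the index shift of `joinNodes` at `l`. -/
theorem alternating_join (T : RKTableau) (S : ChargedParticle) {s s' τ τ' : ℕ → ℝ} (l l' : ℕ)
    (hs : s' 0 = s (l + 1)) (hτ : τ' 0 = τ l) (z : Phase) :
    alternating T S s' τ' l' (alternating T S s τ l z) =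
      alternating T S (joinNodes l s s') (joinNodes l τ τ') (l + l') z := by
  induction l' with
  | zero =>
    cases l with
    | zero => simp [alternating, joinNodes, hs, psi₁_psi₁]
    | succ l =>
      have h := alternating_congr T S (s := joinNodes (l + 1) s s') (s' := s)
        (τ := joinNodes (l + 1) τ τ') (τ' := τ) l (fun i hi => by simp [joinNodes, hi])
        (fun i hi => by simp [joinNodes, hi.trans (Nat.le_succ l)])
      simp only [alternating, h, hs, psi₁_psi₁]
      simp [joinNodes]
  | succ l' ih =>
    have h1 : joinNodes l s s' (l + l' + 2) = s' (l' + 2) := by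
      rw [joinNodes, if_neg (by omega)]; congr 1; omega
    have h2 : joinNodes l s s' (l + l' + 1) = s' (l' + 1) := by
      rw [joinNodes, if_neg (by omega)]; congr 1; omega
    have h3 : joinNodes l τ τ' (l + l' + 1) = τ' (l' + 1) := by
      rw [joinNodes, if_neg (by omega)]; congr 1; omega
    have h4 : joinNodes l τ τ' (l + l') = τ' l' := by
      rcases Nat.eq_zero_or_pos l' with rfl | h
      · simp [joinNodes, hτ]
      · rw [joinNodes, if_neg (by omega)]; congr 1; omega
    change psi₁ S _ _ (psi₂ T S _ _ (alternating T S s' τ' l' _)) =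
      psi₁ S (joinNodes l s s' (l + l' + 2)) (joinNodes l s s' (l + l' + 1))
        (psi₂ T S (joinNodes l τ τ' (l + l' + 1)) (joinNodes l τ τ' (l + l'))
          (alternating T S _ _ (l + l') z))
    rw [ih, h1, h2, h3, h4]

theorem exists_alternating (n : ℕ) : ∃ α β : ℕ → ℝ, α 0 = 0 ∧ β 0 = 0 ∧ α (3 ^ n + 1) = 1 ∧
    β (3 ^ n) = 1 ∧ ∀ (T : RKTableau) (S : ChargedParticle) (t h : ℝ) (z : Phase),
      theta T S n (t + h) t z =
        alternating T S (fun i => t + α i * h) (fun i => t + β i * h) (3 ^ n) z := by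
  induction n with
  | zero =>
    refine ⟨fun i => if i = 0 then 0 else if i = 1 then 1 / 2 else 1,
      fun i => if i = 0 then 0 else 1, by simp, by simp, by simp, by simp, fun T S t h z => ?_⟩
    simp only [theta, pow_zero, alternating]
    norm_num
    rw [one_div_mul_eq_div]
  | succ n ih =>
    obtain ⟨α, β, hα0, hβ0, hα1, hβ1, H⟩ := ih
    set γ := gam (2 * n + 2) with hγ
    set l := 3 ^ n with hl
    have hl0 : 0 < l := by positivity
    have h3 : 3 ^ (n + 1) = l + l + l := by rw [pow_succ, ← hl]; omega
    -- Three affine copies of the old nodes, running from `0` to `γ`, from `γ` to `1 - γ`, and from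
    -- `1 - γ` to `1`.
    refine ⟨joinNodes (l + l) (joinNodes l (fun i => γ * α i) fun i => γ + (1 - 2 * γ) * α i)
        fun i => (1 - γ) + γ * α i,
      joinNodes (l + l) (joinNodes l (fun i => γ * β i) fun i => γ + (1 - 2 * γ) * β i)
        fun i => (1 - γ) + γ * β i, by simp [joinNodes, hα0], by simp [joinNodes, hβ0], ?_, ?_,
        fun T S t h z => ?_⟩
    · rw [h3, joinNodes, if_neg (by omega), show l + l + l + 1 - (l + l) = l + 1 by omega, hα1]
      ring
    · rw [h3, joinNodes, if_neg (by omega), show l + l + l - (l + l) = l by omega, hβ1]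
      ring
    · simp only [theta, add_sub_cancel_left, ← hγ]
      have e1 := H T S t (γ * h) z
      have e2 := H T S (t + γ * h) ((1 - 2 * γ) * h)
      have e3 := H T S (t + (1 - γ) * h) (γ * h)
      rw [show t + γ * h + (1 - 2 * γ) * h = t + (1 - γ) * h by ring] at e2
      rw [show t + (1 - γ) * h + γ * h = t + h by ring] at e3
      rw [e3, e2, e1, alternating_join T S l l (by simp only [hα0, hα1]; ring)
        (by simp only [hβ0, hβ1]; ring) z, alternating_join T S (l + l) l ?_ ?_, h3]
      · congr 1
        · ext i
          simp only [joinNodes]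
          split_ifs <;> ring
        · ext i
          simp only [joinNodes]
          split_ifs <;> ring
      · simp only [joinNodes]
        rw [if_neg (by omega), show l + l + 1 - l = l + 1 by omega, hα0, hα1]
        ring
      · simp only [joinNodes]
        rw [if_neg (by omega), show l + l - l = l by omega, hβ0, hβ1]
        ring

end Compositions

/-! ### Closure properties of explicit formulas -/

section Explicit

/-- Substitution of formulas for the times and for the old state. -/
def Formula.subst : {κ : Kind} → Formula κ → (e s : Formula .scalar) → (Q P : Formula .vector) →
    Formula κ
  | _, .const c, _, _, _, _ => .const c
  | _, .mass, _, _, _, _ => .mass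
  | _, .charge, _, _, _, _ => .charge
  | _, .startTime, _, s, _, _ => s
  | _, .endTime, e, _, _, _ => e
  | _, .addS x y, e, s, Q, P => .addS (x.subst e s Q P) (y.subst e s Q P)
  | _, .mulS x y, e, s, Q, P => .mulS (x.subst e s Q P) (y.subst e s Q P)
  | _, .divS x y, e, s, Q, P => .divS (x.subst e s Q P) (y.subst e s Q P)
  | _, .pos, _, _, Q, _ => Q
  | _, .mom, _, _, _, P => P
  | _, .evalA x τ, e, s, Q, P => .evalA (x.subst e s Q P) (τ.subst e s Q P)
  | _, .evalGradφ x τ, e, s, Q, P => .evalGradφ (x.subst e s Q P) (τ.subst e s Q P)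
  | _, .addV x y, e, s, Q, P => .addV (x.subst e s Q P) (y.subst e s Q P)
  | _, .smulV c x, e, s, Q, P => .smulV (c.subst e s Q P) (x.subst e s Q P)
  | _, .mulVM x M, e, s, Q, P => .mulVM (x.subst e s Q P) (M.subst e s Q P)
  | _, .evalJacA x τ, e, s, Q, P => .evalJacA (x.subst e s Q P) (τ.subst e s Q P)
  | _, .one, _, _, _, _ => .one
  | _, .addM M N, e, s, Q, P => .addM (M.subst e s Q P) (N.subst e s Q P)
  | _, .smulM c M, e, s, Q, P => .smulM (c.subst e s Q P) (M.subst e s Q P)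
  | _, .mulM M N, e, s, Q, P => .mulM (M.subst e s Q P) (N.subst e s Q P)
  | _, .invM M, e, s, Q, P => .invM (M.subst e s Q P)

theorem Formula.eval_subst (e s : Formula .scalar) (Q P : Formula .vector) (S : ChargedParticle)
    (t₁ t₀ : ℝ) (z : Phase) {κ : Kind} (F : Formula κ) :
    (F.subst e s Q P).eval S t₁ t₀ z =
      F.eval S (e.eval S t₁ t₀ z) (s.eval S t₁ t₀ z) (Q.eval S t₁ t₀ z, P.eval S t₁ t₀ z) := by
  induction F <;> simp_all [Formula.subst, Formula.eval]

/-- Quantities that depend on the particle, the times and the state. -/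
abbrev Quantity (κ : Kind) : Type := ChargedParticle → ℝ → ℝ → Phase → κ.Val

/-- `g` is given by a formula wherever the condition `D` holds. -/
def IsExplicit (D : ChargedParticle → ℝ → ℝ → Phase → Prop) {κ : Kind} (g : Quantity κ) : Prop :=
  ∃ F : Formula κ, ∀ S t₁ t₀ z, D S t₁ t₀ z → F.eval S t₁ t₀ z = g S t₁ t₀ z

variable {D : ChargedParticle → ℝ → ℝ → Phase → Prop}

theorem IsExplicit.smulV {c : Quantity .scalar} {g : Quantity .vector} (hc : IsExplicit D c)
    (hg : IsExplicit D g) : IsExplicit D (κ := .vector) fun S t₁ t₀ z => c S t₁ t₀ z • g S t₁ t₀ z :=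
  let ⟨C, hC⟩ := hc; let ⟨G, hG⟩ := hg
  ⟨.smulV C G, fun S t₁ t₀ z h => by simp only [Formula.eval, hC S t₁ t₀ z h, hG S t₁ t₀ z h]⟩

theorem IsExplicit.smulM {c : Quantity .scalar} {g : Quantity .matrix} (hc : IsExplicit D c)
    (hg : IsExplicit D g) : IsExplicit D (κ := .matrix) fun S t₁ t₀ z => c S t₁ t₀ z • g S t₁ t₀ z :=
  let ⟨C, hC⟩ := hc; let ⟨G, hG⟩ := hg
  ⟨.smulM C G, fun S t₁ t₀ z h => by simp only [Formula.eval, hC S t₁ t₀ z h, hG S t₁ t₀ z h]⟩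

theorem IsExplicit.addV {f g : Quantity .vector} (hf : IsExplicit D f)
    (hg : IsExplicit D g) : IsExplicit D (κ := .vector) fun S t₁ t₀ z => f S t₁ t₀ z + g S t₁ t₀ z :=
  let ⟨C, hC⟩ := hf; let ⟨G, hG⟩ := hg
  ⟨.addV C G, fun S t₁ t₀ z h => by simp only [Formula.eval, hC S t₁ t₀ z h, hG S t₁ t₀ z h]⟩

theorem IsExplicit.addM {f g : Quantity .matrix} (hf : IsExplicit D f)
    (hg : IsExplicit D g) : IsExplicit D (κ := .matrix) fun S t₁ t₀ z => f S t₁ t₀ z + g S t₁ t₀ z :=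
  let ⟨C, hC⟩ := hf; let ⟨G, hG⟩ := hg
  ⟨.addM C G, fun S t₁ t₀ z h => by simp only [Formula.eval, hC S t₁ t₀ z h, hG S t₁ t₀ z h]⟩

theorem IsExplicit.addS {f g : Quantity .scalar} (hf : IsExplicit D f)
    (hg : IsExplicit D g) : IsExplicit D (κ := .scalar) fun S t₁ t₀ z => f S t₁ t₀ z + g S t₁ t₀ z :=
  let ⟨C, hC⟩ := hf; let ⟨G, hG⟩ := hg
  ⟨.addS C G, fun S t₁ t₀ z h => by simp only [Formula.eval, hC S t₁ t₀ z h, hG S t₁ t₀ z h]⟩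

theorem IsExplicit.mulS {f g : Quantity .scalar} (hf : IsExplicit D f)
    (hg : IsExplicit D g) : IsExplicit D (κ := .scalar) fun S t₁ t₀ z => f S t₁ t₀ z * g S t₁ t₀ z :=
  let ⟨C, hC⟩ := hf; let ⟨G, hG⟩ := hg
  ⟨.mulS C G, fun S t₁ t₀ z h => by simp only [Formula.eval, hC S t₁ t₀ z h, hG S t₁ t₀ z h]⟩

theorem IsExplicit.divS {f g : Quantity .scalar} (hf : IsExplicit D f)
    (hg : IsExplicit D g) : IsExplicit D (κ := .scalar) fun S t₁ t₀ z => f S t₁ t₀ z / g S t₁ t₀ z :=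
  let ⟨C, hC⟩ := hf; let ⟨G, hG⟩ := hg
  ⟨.divS C G, fun S t₁ t₀ z h => by simp only [Formula.eval, hC S t₁ t₀ z h, hG S t₁ t₀ z h]⟩

theorem IsExplicit.vecMul {f : Quantity .vector} {g : Quantity .matrix} (hf : IsExplicit D f)
    (hg : IsExplicit D g) :
    IsExplicit D (κ := .vector) fun S t₁ t₀ z => Matrix.vecMul (f S t₁ t₀ z) (g S t₁ t₀ z) :=
  let ⟨C, hC⟩ := hf; let ⟨G, hG⟩ := hg
  ⟨.mulVM C G, fun S t₁ t₀ z h => by simp only [Formula.eval, hC S t₁ t₀ z h, hG S t₁ t₀ z h]⟩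

theorem IsExplicit.mulM {f g : Quantity .matrix} (hf : IsExplicit D f)
    (hg : IsExplicit D g) :
    IsExplicit D (κ := .matrix) fun S t₁ t₀ z => (f S t₁ t₀ z * g S t₁ t₀ z : Mat) :=
  let ⟨C, hC⟩ := hf; let ⟨G, hG⟩ := hg
  ⟨.mulM C G, fun S t₁ t₀ z h => by simp only [Formula.eval, hC S t₁ t₀ z h, hG S t₁ t₀ z h]⟩

theorem IsExplicit.inv {g : Quantity .matrix} (hg : IsExplicit D g) :
    IsExplicit D (κ := .matrix) fun S t₁ t₀ z => ((g S t₁ t₀ z)⁻¹ : Mat) :=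
  let ⟨G, hG⟩ := hg
  ⟨.invM G, fun S t₁ t₀ z h => by simp only [Formula.eval, hG S t₁ t₀ z h]⟩

theorem isExplicit_const (c : ℝ) : IsExplicit D (κ := .scalar) fun _ _ _ _ => c :=
  ⟨.const c, fun _ _ _ _ _ => rfl⟩

theorem isExplicit_mass : IsExplicit D (κ := .scalar) fun S _ _ _ => S.m :=
  ⟨.mass, fun _ _ _ _ _ => rfl⟩

theorem isExplicit_charge : IsExplicit D (κ := .scalar) fun S _ _ _ => S.e :=
  ⟨.charge, fun _ _ _ _ _ => rfl⟩

theorem isExplicit_start : IsExplicit D (κ := .scalar) fun _ _ t₀ _ => t₀ :=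
  ⟨.startTime, fun _ _ _ _ _ => rfl⟩

theorem isExplicit_stop : IsExplicit D (κ := .scalar) fun _ t₁ _ _ => t₁ :=
  ⟨.endTime, fun _ _ _ _ _ => rfl⟩

theorem isExplicit_pos : IsExplicit D (κ := .vector) fun _ _ _ z => z.1 :=
  ⟨.pos, fun _ _ _ _ _ => rfl⟩

theorem isExplicit_mom : IsExplicit D (κ := .vector) fun _ _ _ z => z.2 :=
  ⟨.mom, fun _ _ _ _ _ => rfl⟩

theorem isExplicit_one : IsExplicit D (κ := .matrix) fun _ _ _ _ => (1 : Mat) :=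
  ⟨.one, fun _ _ _ _ _ => rfl⟩

theorem IsExplicit.neg {f : Quantity .scalar} (hf : IsExplicit D f) :
    IsExplicit D (κ := .scalar) fun S t₁ t₀ z => -(f S t₁ t₀ z : ℝ) := by
  simpa only [neg_one_mul] using (isExplicit_const (-1)).mulS hf

theorem isExplicit_step : IsExplicit D (κ := .scalar) fun _ t₁ t₀ _ => (t₁ - t₀ : ℝ) := by
  simpa only [← sub_eq_add_neg] using isExplicit_stop.addS isExplicit_start.neg

theorem IsExplicit.subV {f g : Quantity .vector} (hf : IsExplicit D f) (hg : IsExplicit D g) :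
    IsExplicit D (κ := .vector) fun S t₁ t₀ z => (f S t₁ t₀ z - g S t₁ t₀ z : Vec) := by
  simpa only [neg_smul, one_smul, ← sub_eq_add_neg] using
    hf.addV ((isExplicit_const (-1)).smulV hg)

theorem isExplicit_sumV (n : ℕ) {c : ℕ → ℝ} {g : ℕ → Quantity .vector}
    (hg : ∀ j < n, IsExplicit D (g j)) : IsExplicit D (κ := .vector) fun S t₁ t₀ z =>
      (∑ j ∈ Finset.range n, c j • (g j S t₁ t₀ z : Vec) : Vec) := by
  induction n with
  | zero =>
    -- The zero vector is not a primitive formula; the empty sum is written as `0 • q`.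
    simpa only [zero_smul, Finset.sum_range_zero] using (isExplicit_const 0).smulV isExplicit_pos
  | succ n ih =>
    simp only [Finset.sum_range_succ]
    exact (ih fun j hj => hg j (by omega)).addV ((isExplicit_const _).smulV (hg n (by omega)))

theorem isExplicit_sumM (n : ℕ) {c : ℕ → ℝ} {g : ℕ → Quantity .matrix}
    (hg : ∀ j < n, IsExplicit D (g j)) : IsExplicit D (κ := .matrix) fun S t₁ t₀ z =>
      (∑ j ∈ Finset.range n, c j • (g j S t₁ t₀ z : Mat) : Mat) := by
  induction n with
  | zero =>
    simpa only [zero_smul, Finset.sum_range_zero] using (isExplicit_const 0).smulM isExplicit_one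
  | succ n ih =>
    simp only [Finset.sum_range_succ]
    exact (ih fun j hj => hg j (by omega)).addM ((isExplicit_const _).smulM (hg n (by omega)))

end Explicit

/-! ### Stage recursions, and formulas for the integrators -/

namespace RKTableau

variable (T : RKTableau) (S : ChargedParticle) (t h : ℝ) (q : Vec) (i : ℕ)

theorem stagePoint_eq : T.stagePoint S t h q i =
    q + h • ∑ j ∈ Finset.range i, T.a i j • T.k S t h q j := by
  rw [stagePoint, Finset.sum_range]

theorem k_eq : T.k S t h q i =
    (-(S.e / S.m)) • S.A (T.stagePoint S t h q i) (T.stageTime t h i) := by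
  rw [k, stage]; rfl

/-- The matrix `I + h ∑_{j<i} aᵢⱼ k'ⱼ`. -/
noncomputable def stageJac : Mat := 1 + h • ∑ j ∈ Finset.range i, T.a i j • T.k' S t h q j

theorem k'_eq : T.k' S t h q i = (-(S.e / S.m)) •
    (jac (fun x => S.A x (T.stageTime t h i)) (T.stagePoint S t h q i) * T.stageJac S t h q i) := by
  rw [k', stageJac, Finset.sum_range]

theorem gradL_eq : T.gradL S t h q i = Matrix.vecMul
    (grad (fun x => S.f x (T.stageTime t h i)) (T.stagePoint S t h q i)) (T.stageJac S t h q i) := by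
  rw [gradL, stageJac, Finset.sum_range]

end RKTableau

section Explicit

variable {D : ChargedParticle → ℝ → ℝ → Phase → Prop} (T : RKTableau)

theorem IsExplicit.evalA {x : Quantity .vector} {τ : Quantity .scalar} (hx : IsExplicit D x)
    (hτ : IsExplicit D τ) :
    IsExplicit D (κ := .vector) fun S t₁ t₀ z => S.A (x S t₁ t₀ z) (τ S t₁ t₀ z) :=
  let ⟨C, hC⟩ := hx; let ⟨G, hG⟩ := hτ
  ⟨.evalA C G, fun S t₁ t₀ z h => by simp only [Formula.eval, hC S t₁ t₀ z h, hG S t₁ t₀ z h]⟩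

theorem IsExplicit.evalJacA {x : Quantity .vector} {τ : Quantity .scalar} (hx : IsExplicit D x)
    (hτ : IsExplicit D τ) : IsExplicit D (κ := .matrix) fun S t₁ t₀ z =>
      jac (fun y => S.A y (τ S t₁ t₀ z)) (x S t₁ t₀ z) :=
  let ⟨C, hC⟩ := hx; let ⟨G, hG⟩ := hτ
  ⟨.evalJacA C G, fun S t₁ t₀ z h => by simp only [Formula.eval, hC S t₁ t₀ z h, hG S t₁ t₀ z h]⟩

theorem IsExplicit.evalGradφ {x : Quantity .vector} {τ : Quantity .scalar} (hx : IsExplicit D x)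
    (hτ : IsExplicit D τ) : IsExplicit D (κ := .vector) fun S t₁ t₀ z =>
      grad (fun y => S.φ y (τ S t₁ t₀ z)) (x S t₁ t₀ z) :=
  let ⟨C, hC⟩ := hx; let ⟨G, hG⟩ := hτ
  ⟨.evalGradφ C G, fun S t₁ t₀ z h => by simp only [Formula.eval, hC S t₁ t₀ z h, hG S t₁ t₀ z h]⟩

theorem isExplicit_velocityFactor :
    IsExplicit D (κ := .scalar) fun S _ _ _ => (-(S.e / S.m) : ℝ) :=
  (isExplicit_charge.divS isExplicit_mass).neg

theorem isExplicit_stageTime (i : ℕ) :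
    IsExplicit D (κ := .scalar) fun _ t₁ t₀ _ => T.stageTime t₀ (t₁ - t₀) i :=
  isExplicit_start.addS (isExplicit_step.mulS (isExplicit_const _))

theorem isExplicit_stagePoint (i : ℕ) :
    IsExplicit D (κ := .vector) fun S t₁ t₀ z => T.stagePoint S t₀ (t₁ - t₀) z.1 i := by
  induction i using Nat.strong_induction_on with
  | _ i ih =>
    simp only [RKTableau.stagePoint_eq]
    refine isExplicit_pos.addV (isExplicit_step.smulV (isExplicit_sumV i fun j hj => ?_))
    simp only [RKTableau.k_eq]
    exact isExplicit_velocityFactor.smulV ((ih j hj).evalA (isExplicit_stageTime T j))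

theorem isExplicit_k (i : ℕ) :
    IsExplicit D (κ := .vector) fun S t₁ t₀ z => T.k S t₀ (t₁ - t₀) z.1 i := by
  simp only [RKTableau.k_eq]
  exact isExplicit_velocityFactor.smulV ((isExplicit_stagePoint T i).evalA (isExplicit_stageTime T i))

theorem isExplicit_k' (i : ℕ) :
    IsExplicit D (κ := .matrix) fun S t₁ t₀ z => T.k' S t₀ (t₁ - t₀) z.1 i := by
  induction i using Nat.strong_induction_on with
  | _ i ih =>
    rw [show (fun (S : ChargedParticle) t₁ t₀ (z : Phase) => T.k' S t₀ (t₁ - t₀) z.1 i) = _ from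
      funext fun S => funext fun t₁ => funext fun t₀ => funext fun z => T.k'_eq S t₀ (t₁ - t₀) z.1 i]
    exact isExplicit_velocityFactor.smulM
      (((isExplicit_stagePoint T i).evalJacA (isExplicit_stageTime T i)).mulM
        (isExplicit_one.addM (isExplicit_step.smulM (isExplicit_sumM i ih))))

theorem isExplicit_gradL (i : ℕ)
    (hD : ∀ S t₁ t₀ z, D S t₁ t₀ z →
      (T.stagePoint S t₀ (t₁ - t₀) z.1 i, T.stageTime t₀ (t₁ - t₀) i) ∈ S.Ω) :
    IsExplicit D (κ := .vector) fun S t₁ t₀ z => T.gradL S t₀ (t₁ - t₀) z.1 i := by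
  have hx := isExplicit_stagePoint (D := D) T i
  have hτ := isExplicit_stageTime (D := D) T i
  have h1 : IsExplicit D (κ := .vector) fun S t₁ t₀ z => grad
      (fun x => S.f x (T.stageTime t₀ (t₁ - t₀) i)) (T.stagePoint S t₀ (t₁ - t₀) z.1 i) := by
    obtain ⟨F, hF⟩ := (((isExplicit_charge (D := D)).mulS isExplicit_charge).divS
      isExplicit_mass).smulV ((hx.evalA hτ).vecMul (hx.evalJacA hτ)) |>.addV
      (isExplicit_charge.smulV (hx.evalGradφ hτ))
    refine ⟨F, fun S t₁ t₀ z h => ?_⟩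
    rw [hF S t₁ t₀ z h]
    beta_reduce
    rw [S.grad_f (hD S t₁ t₀ z h), pow_two]
  simp only [RKTableau.gradL_eq]
  exact h1.vecMul (isExplicit_one.addM
    (isExplicit_step.smulM (isExplicit_sumM i fun j _ => isExplicit_k' T j)))

theorem isExplicit_psi₂ :
    IsExplicit (fun S t₁ t₀ z => Psi₂Defined T S t₁ t₀ z) (κ := .vector)
      (fun S t₁ t₀ z => (psi₂ T S t₁ t₀ z).1) ∧
    IsExplicit (fun S t₁ t₀ z => Psi₂Defined T S t₁ t₀ z) (κ := .vector)
      (fun S t₁ t₀ z => (psi₂ T S t₁ t₀ z).2) := by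
  refine ⟨isExplicit_pos.addV (isExplicit_step.smulV (isExplicit_sumV _ fun j _ => isExplicit_k T j)),
    IsExplicit.vecMul (isExplicit_mom.subV (isExplicit_step.smulV (isExplicit_sumV _ fun j hj =>
      isExplicit_gradL T j fun S t₁ t₀ z h => h.1 j hj))) (IsExplicit.inv (isExplicit_one.addM
      (isExplicit_step.smulM (isExplicit_sumM _ fun j _ => isExplicit_k' T j))))⟩

theorem isExplicit_psi₁ :
    IsExplicit D (κ := .vector) (fun S t₁ t₀ z => (psi₁ S t₁ t₀ z).1) :=
  isExplicit_pos.addV ((isExplicit_step.divS isExplicit_mass).smulV isExplicit_mom)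

/-- Composition of maps is substitution of formulas, including the formulas for the intermediate
times. Definedness at a substep is stated for the true intermediate state, so each substep must
first be identified with the value of its formula before the next one can be treated. -/
theorem exists_formula_theta (n : ℕ) : ∃ Q P : Formula .vector,
    ∀ (S : ChargedParticle) (t₁ t₀ : ℝ) (z : Phase), ThetaDefined T S n t₁ t₀ z →
      theta T S n t₁ t₀ z = (Q.eval S t₁ t₀ z, P.eval S t₁ t₀ z) := by
  induction n with
  | zero =>
    obtain ⟨Q₁, hQ₁⟩ := isExplicit_psi₁ (D := fun _ _ _ _ => True)
    obtain ⟨⟨Q₂, hQ₂⟩, ⟨P₂, hP₂⟩⟩ := isExplicit_psi₂ T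
    obtain ⟨m, hm⟩ := (isExplicit_start (D := fun _ _ _ _ => True)).addS
      (isExplicit_step.divS (isExplicit_const 2))
    beta_reduce at hQ₁ hQ₂ hP₂ hm
    obtain ⟨Qa, ha⟩ : ∃ Qa : Formula .vector, ∀ S t₁ t₀ z,
        (Qa.eval S t₁ t₀ z, z.2) = psi₁ S (t₀ + (t₁ - t₀) / 2) t₀ z :=
      ⟨Q₁.subst m .startTime .pos .mom, fun S t₁ t₀ z => by
        rw [Formula.eval_subst, hm S t₁ t₀ z trivial, hQ₁ _ _ _ _ trivial]; rfl⟩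
    obtain ⟨Qb, Pb, hb⟩ : ∃ Qb Pb : Formula .vector, ∀ S t₁ t₀ z, ThetaDefined T S 0 t₁ t₀ z →
        (Qb.eval S t₁ t₀ z, Pb.eval S t₁ t₀ z) =
          psi₂ T S t₁ t₀ (psi₁ S (t₀ + (t₁ - t₀) / 2) t₀ z) := by
      refine ⟨Q₂.subst .endTime .startTime Qa .mom, P₂.subst .endTime .startTime Qa .mom,
        fun S t₁ t₀ z h => ?_⟩
      have h : Psi₂Defined T S t₁ t₀ (psi₁ S (t₀ + (t₁ - t₀) / 2) t₀ z) := h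
      rw [← ha] at h ⊢
      rw [Formula.eval_subst, Formula.eval_subst]
      exact Prod.ext (hQ₂ _ _ _ _ h) (hP₂ _ _ _ _ h)
    refine ⟨Q₁.subst .endTime m Qb Pb, Pb, fun S t₁ t₀ z h => ?_⟩
    rw [Formula.eval_subst, hm S t₁ t₀ z trivial, hQ₁ _ _ _ _ trivial]
    exact Prod.ext (by rw [hb S t₁ t₀ z h]; rfl) (congrArg Prod.snd (hb S t₁ t₀ z h)).symm
  | succ n ih =>
    obtain ⟨Q, P, H⟩ := ih
    have key : ∀ (e s : Formula .scalar) (Q₀ P₀ : Formula .vector), ∃ Q₁ P₁ : Formula .vector,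
        ∀ S t₁ t₀ z, ThetaDefined T S n (e.eval S t₁ t₀ z) (s.eval S t₁ t₀ z)
          (Q₀.eval S t₁ t₀ z, P₀.eval S t₁ t₀ z) →
        theta T S n (e.eval S t₁ t₀ z) (s.eval S t₁ t₀ z) (Q₀.eval S t₁ t₀ z, P₀.eval S t₁ t₀ z) =
          (Q₁.eval S t₁ t₀ z, P₁.eval S t₁ t₀ z) := fun e s Q₀ P₀ =>
      ⟨Q.subst e s Q₀ P₀, P.subst e s Q₀ P₀, fun S t₁ t₀ z h => by
        rw [Formula.eval_subst, Formula.eval_subst, H _ _ _ _ h]⟩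
    obtain ⟨m₁, hm₁⟩ := (isExplicit_start (D := fun _ _ _ _ => True)).addS
      ((isExplicit_const (gam (2 * n + 2))).mulS isExplicit_step)
    obtain ⟨m₂, hm₂⟩ := (isExplicit_start (D := fun _ _ _ _ => True)).addS
      ((isExplicit_const (1 - gam (2 * n + 2))).mulS isExplicit_step)
    obtain ⟨Q₁, P₁, h₁⟩ := key m₁ .startTime .pos .mom
    obtain ⟨Q₂, P₂, h₂⟩ := key m₂ m₁ Q₁ P₁
    obtain ⟨Q₃, P₃, h₃⟩ := key .endTime m₂ Q₂ P₂
    refine ⟨Q₃, P₃, fun S t₁ t₀ z h => ?_⟩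
    specialize h₁ S t₁ t₀ z
    specialize h₂ S t₁ t₀ z
    specialize h₃ S t₁ t₀ z
    rw [hm₁ S t₁ t₀ z trivial] at h₁ h₂
    rw [hm₂ S t₁ t₀ z trivial] at h₂ h₃
    obtain ⟨d₁, d₂, d₃⟩ := h
    specialize h₁ d₁
    rw [← h₁] at h₂
    specialize h₂ d₂
    rw [← h₂] at h₃
    exact h₃ d₃

end Explicit

/-! ### Joint smoothness in times, step size and state -/

section Smoothness

attribute [local instance] Matrix.normedAddCommGroup Matrix.normedSpace

variable {X : Type*} [NormedAddCommGroup X] [NormedSpace ℝ X] {x₀ : X}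

theorem contDiffAt_matrix {M : X → Mat} :
    ContDiffAt ℝ ∞ M x₀ ↔ ∀ i j, ContDiffAt ℝ ∞ (fun x => M x i j) x₀ := by
  have h : ContDiffAt ℝ ∞ (fun x => (M x : Fin 3 → Fin 3 → ℝ)) x₀ ↔
      ∀ i j, ContDiffAt ℝ ∞ (fun x => M x i j) x₀ :=
    contDiffAt_pi.trans (forall_congr' fun i => contDiffAt_pi (Φ := fun x => M x i))
  exact h

theorem contDiffAt_matrix_mul {M N : X → Mat} (hM : ContDiffAt ℝ ∞ M x₀)
    (hN : ContDiffAt ℝ ∞ N x₀) : ContDiffAt ℝ ∞ (fun x => M x * N x) x₀ := by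
  rw [contDiffAt_matrix] at *
  intro i j
  simp only [Matrix.mul_apply]
  exact ContDiffAt.sum fun l _ => (hM i l).mul (hN l j)

theorem contDiffAt_vecMul {v : X → Vec} {M : X → Mat} (hv : ContDiffAt ℝ ∞ v x₀)
    (hM : ContDiffAt ℝ ∞ M x₀) : ContDiffAt ℝ ∞ (fun x => Matrix.vecMul (v x) (M x)) x₀ := by
  rw [contDiffAt_matrix] at hM
  rw [contDiffAt_pi] at *
  intro j
  simp only [Matrix.vecMul, dotProduct]
  exact ContDiffAt.sum fun l _ => (hv l).mul (hM l j)

theorem contDiffAt_det {M : X → Mat} (hM : ContDiffAt ℝ ∞ M x₀) :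
    ContDiffAt ℝ ∞ (fun x => (M x).det) x₀ := by
  rw [contDiffAt_matrix] at hM
  simp only [Matrix.det_apply']
  exact ContDiffAt.sum fun σ _ => contDiffAt_const.mul (contDiffAt_prod fun i _ => hM _ _)

/-- By Cramer's rule the inverse is a rational function of the entries. -/
theorem contDiffAt_matrix_inv {M : X → Mat} (hM : ContDiffAt ℝ ∞ M x₀) (hu : IsUnit (M x₀).det) :
    ContDiffAt ℝ ∞ (fun x => (M x)⁻¹) x₀ := by
  simp only [Matrix.inv_def, Ring.inverse_eq_inv']
  refine ((contDiffAt_det hM).inv hu.ne_zero).smul ?_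
  rw [contDiffAt_matrix]
  intro i j
  simp only [Matrix.adjugate_apply]
  refine contDiffAt_det ?_
  rw [contDiffAt_matrix] at hM ⊢
  intro k l
  simp only [Matrix.updateRow_apply]
  split_ifs
  · exact contDiffAt_const
  · exact hM _ _

variable (S : ChargedParticle)

theorem ChargedParticle.eventually_mem_Ω {S : ChargedParticle} {u : X → Vec} {τ : X → ℝ}
    (hu : ContinuousAt u x₀) (hτ : ContinuousAt τ x₀) (h : (u x₀, τ x₀) ∈ S.Ω) :
    ∀ᶠ x in 𝓝 x₀, (u x, τ x) ∈ S.Ω :=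
  (hu.prodMk hτ).preimage_mem_nhds (S.isOpen_Ω.mem_nhds h)

theorem fderiv_slice {F : Type*} [NormedAddCommGroup F] [NormedSpace ℝ F] {g : Vec × ℝ → F}
    {q : Vec} {t : ℝ} (hg : DifferentiableAt ℝ g (q, t)) (v : Vec) :
    fderiv ℝ (fun y => g (y, t)) q v = fderiv ℝ g (q, t) (v, 0) := by
  have h : HasFDerivAt (fun y : Vec => (y, t)) (ContinuousLinearMap.inl ℝ Vec ℝ) q :=
    hasFDerivAt_prodMk_left q t
  have h2 := HasFDerivAt.comp q (f := fun y : Vec => (y, t)) hg.hasFDerivAt h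
  have h3 := h2.fderiv
  change fderiv ℝ (fun y => g (y, t)) q = _ at h3
  rw [h3]; rfl

/-- The spatial derivative at a moving time is the full space-time derivative in the direction `(v,
0)`, which is smooth. The two agree only over `Ω`, hence only near `x₀`, and that suffices. -/
theorem contDiffAt_fderiv_slice {F : Type*} [NormedAddCommGroup F] [NormedSpace ℝ F]
    {g : Vec × ℝ → F} {Ω : Set (Vec × ℝ)} (hΩ : IsOpen Ω) (hg : ContDiffOn ℝ ∞ g Ω) {u : X → Vec}
    {τ : X → ℝ} (hu : ContDiffAt ℝ ∞ u x₀) (hτ : ContDiffAt ℝ ∞ τ x₀) (h : (u x₀, τ x₀) ∈ Ω)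
    (v : Vec) : ContDiffAt ℝ ∞ (fun x => fderiv ℝ (fun y => g (y, τ x)) (u x) v) x₀ := by
  have h1 : ContDiffAt ℝ ∞ (fderiv ℝ g) (u x₀, τ x₀) :=
    (hg.contDiffAt (hΩ.mem_nhds h)).fderiv_right (m := ∞) (by simp)
  have h2 : ContDiffAt ℝ ∞ (fun x => fderiv ℝ g (u x, τ x) (v, 0)) x₀ :=
    (h1.comp x₀ (f := fun x => (u x, τ x)) (hu.prodMk hτ)).clm_apply contDiffAt_const
  refine h2.congr_of_eventuallyEq ?_
  filter_upwards [(hu.continuousAt.prodMk hτ.continuousAt).preimage_mem_nhds (hΩ.mem_nhds h)]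
    with x hx
  exact fderiv_slice ((hg.contDiffAt (hΩ.mem_nhds hx)).differentiableAt (by simp)) v

variable {S} {u : X → Vec} {τ : X → ℝ}

theorem ChargedParticle.contDiffOn_f : ContDiffOn ℝ ∞ (fun x : Vec × ℝ => S.f x.1 x.2) S.Ω := by
  have hA := contDiffOn_pi.1 S.smooth_A
  simp only [ChargedParticle.f, dotProduct]
  refine ((contDiffOn_const.mul (ContDiffOn.sum fun i _ => (hA i).mul (hA i))).div_const _).add
    (contDiffOn_const.mul S.smooth_φ)

theorem ChargedParticle.contDiffAt_velocity_comp (hu : ContDiffAt ℝ ∞ u x₀)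
    (hτ : ContDiffAt ℝ ∞ τ x₀) (h : (u x₀, τ x₀) ∈ S.Ω) :
    ContDiffAt ℝ ∞ (fun x => (-(S.e / S.m)) • S.A (u x) (τ x)) x₀ :=
  ((S.smooth_A.contDiffAt (S.isOpen_Ω.mem_nhds h)).comp x₀ (f := fun x => (u x, τ x))
    (hu.prodMk hτ)).const_smul _

theorem ChargedParticle.contDiffAt_jac_comp (hu : ContDiffAt ℝ ∞ u x₀)
    (hτ : ContDiffAt ℝ ∞ τ x₀) (h : (u x₀, τ x₀) ∈ S.Ω) :
    ContDiffAt ℝ ∞ (fun x => jac (fun y => S.A y (τ x)) (u x)) x₀ := by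
  rw [contDiffAt_matrix]
  intro i j
  exact contDiffAt_fderiv_slice S.isOpen_Ω (contDiffOn_pi.1 S.smooth_A i) hu hτ h _

theorem ChargedParticle.contDiffAt_grad_comp (hu : ContDiffAt ℝ ∞ u x₀)
    (hτ : ContDiffAt ℝ ∞ τ x₀) (h : (u x₀, τ x₀) ∈ S.Ω) :
    ContDiffAt ℝ ∞ (fun x => grad (fun y => S.f y (τ x)) (u x)) x₀ := by
  rw [contDiffAt_pi]
  intro j
  exact contDiffAt_fderiv_slice S.isOpen_Ω S.contDiffOn_f hu hτ h _

variable {T : RKTableau} {η : X → ℝ}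

theorem contDiffAt_stageTime (hτ : ContDiffAt ℝ ∞ τ x₀) (hη : ContDiffAt ℝ ∞ η x₀) (i : ℕ) :
    ContDiffAt ℝ ∞ (fun x => T.stageTime (τ x) (η x) i) x₀ :=
  hτ.add (hη.mul contDiffAt_const)

variable (hτ : ContDiffAt ℝ ∞ τ x₀) (hη : ContDiffAt ℝ ∞ η x₀) (hu : ContDiffAt ℝ ∞ u x₀)
include hτ hη hu

/-- Start time, step length and position all depend on the parameter `x`: the local error needs
smoothness jointly in `(t, z, h)`, symplecticity in the state alone. -/
theorem contDiffAt_stagePoint (i : ℕ)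
    (h : ∀ j < i, (T.stagePoint S (τ x₀) (η x₀) (u x₀) j, T.stageTime (τ x₀) (η x₀) j) ∈ S.Ω) :
    ContDiffAt ℝ ∞ (fun x => T.stagePoint S (τ x) (η x) (u x) i) x₀ := by
  induction i using Nat.strong_induction_on with
  | _ i ih =>
    simp only [RKTableau.stagePoint_eq]
    refine hu.add (hη.smul (ContDiffAt.sum fun j hj => ContDiffAt.const_smul _ ?_))
    have hj := Finset.mem_range.1 hj
    simp only [RKTableau.k_eq]
    exact S.contDiffAt_velocity_comp (ih j hj fun l hl => h l (hl.trans hj))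
      (contDiffAt_stageTime hτ hη j) (h j hj)

variable {n : ℕ}
  (h : ∀ j < n, (T.stagePoint S (τ x₀) (η x₀) (u x₀) j, T.stageTime (τ x₀) (η x₀) j) ∈ S.Ω)
include h

theorem contDiffAt_k {i : ℕ} (hi : i < n) :
    ContDiffAt ℝ ∞ (fun x => T.k S (τ x) (η x) (u x) i) x₀ := by
  simp only [RKTableau.k_eq]
  exact S.contDiffAt_velocity_comp
    (contDiffAt_stagePoint hτ hη hu i fun l hl => h l (hl.trans hi))
    (contDiffAt_stageTime hτ hη i) (h i hi)

theorem contDiffAt_k' {i : ℕ} (hi : i < n) :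
    ContDiffAt ℝ ∞ (fun x => T.k' S (τ x) (η x) (u x) i) x₀ := by
  induction i using Nat.strong_induction_on with
  | _ i ih =>
    rw [show (fun x => T.k' S (τ x) (η x) (u x) i) = _ from
      funext fun x => T.k'_eq S (τ x) (η x) (u x) i]
    refine ContDiffAt.const_smul _ (contDiffAt_matrix_mul (S.contDiffAt_jac_comp
      (contDiffAt_stagePoint hτ hη hu i fun l hl => h l (hl.trans hi))
      (contDiffAt_stageTime hτ hη i) (h i hi)) ?_)
    exact contDiffAt_const.add (hη.smul (ContDiffAt.sum fun j hj => ContDiffAt.const_smul _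
      (ih j (Finset.mem_range.1 hj) ((Finset.mem_range.1 hj).trans hi))))

theorem contDiffAt_gradL {i : ℕ} (hi : i < n) :
    ContDiffAt ℝ ∞ (fun x => T.gradL S (τ x) (η x) (u x) i) x₀ := by
  simp only [RKTableau.gradL_eq]
  refine contDiffAt_vecMul (S.contDiffAt_grad_comp
    (contDiffAt_stagePoint hτ hη hu i fun l hl => h l (hl.trans hi))
    (contDiffAt_stageTime hτ hη i) (h i hi)) ?_
  exact contDiffAt_const.add (hη.smul (ContDiffAt.sum fun j hj => ContDiffAt.const_smul _
    (contDiffAt_k' hτ hη hu h ((Finset.mem_range.1 hj).trans hi))))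

omit h in
theorem contDiffAt_updateMat
    (h : ∀ j < T.s, (T.stagePoint S (τ x₀) (η x₀) (u x₀) j, T.stageTime (τ x₀) (η x₀) j) ∈ S.Ω) :
    ContDiffAt ℝ ∞ (fun x => T.updateMat S (τ x) (η x) (u x)) x₀ :=
  contDiffAt_const.add (hη.smul (ContDiffAt.sum fun _ hj => ContDiffAt.const_smul _
    (contDiffAt_k' hτ hη hu h (Finset.mem_range.1 hj))))

end Smoothness

section SmoothMaps

attribute [local instance] Matrix.normedAddCommGroup Matrix.normedSpace

variable {X : Type*} [NormedAddCommGroup X] [NormedSpace ℝ X] {x₀ : X} {T : RKTableau}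
  {S : ChargedParticle} {σ τ : X → ℝ} {Z : X → Phase}

theorem contDiffAt_psi₁ (hσ : ContDiffAt ℝ ∞ σ x₀) (hτ : ContDiffAt ℝ ∞ τ x₀)
    (hZ : ContDiffAt ℝ ∞ Z x₀) : ContDiffAt ℝ ∞ (fun x => psi₁ S (σ x) (τ x) (Z x)) x₀ :=
  (hZ.fst.add (((hσ.sub hτ).div_const _).smul hZ.snd)).prodMk hZ.snd

theorem contDiffAt_psi₂ (hσ : ContDiffAt ℝ ∞ σ x₀) (hτ : ContDiffAt ℝ ∞ τ x₀)
    (hZ : ContDiffAt ℝ ∞ Z x₀) (h : Psi₂Defined T S (σ x₀) (τ x₀) (Z x₀)) :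
    ContDiffAt ℝ ∞ (fun x => psi₂ T S (σ x) (τ x) (Z x)) x₀ := by
  have hη := hσ.sub hτ
  obtain ⟨h1, h2⟩ := h
  refine (hZ.fst.add (hη.smul (ContDiffAt.sum fun j hj => ContDiffAt.const_smul _
    (contDiffAt_k hτ hη hZ.fst h1 (Finset.mem_range.1 hj))))).prodMk (contDiffAt_vecMul
    (hZ.snd.sub (hη.smul (ContDiffAt.sum fun j hj => ContDiffAt.const_smul _
      (contDiffAt_gradL hτ hη hZ.fst h1 (Finset.mem_range.1 hj)))))
    (contDiffAt_matrix_inv (contDiffAt_updateMat hτ hη hZ.fst h1) h2))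

theorem eventually_psi₂Defined (hσ : ContDiffAt ℝ ∞ σ x₀) (hτ : ContDiffAt ℝ ∞ τ x₀)
    (hZ : ContDiffAt ℝ ∞ Z x₀) (h : Psi₂Defined T S (σ x₀) (τ x₀) (Z x₀)) :
    ∀ᶠ x in 𝓝 x₀, Psi₂Defined T S (σ x) (τ x) (Z x) := by
  have hη := hσ.sub hτ
  obtain ⟨h1, h2⟩ := h
  refine Eventually.and ?_ ?_
  · have : ∀ j ∈ Finset.range T.s, ∀ᶠ x in 𝓝 x₀,
        (T.stagePoint S (τ x) (σ x - τ x) (Z x).1 j, T.stageTime (τ x) (σ x - τ x) j) ∈ S.Ω :=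
      fun j hj => S.eventually_mem_Ω
        (contDiffAt_stagePoint hτ hη hZ.fst j fun l hl => h1 l
          (hl.trans (Finset.mem_range.1 hj))).continuousAt
        (contDiffAt_stageTime hτ hη j).continuousAt (h1 j (Finset.mem_range.1 hj))
    filter_upwards [(Finset.eventually_all _).2 this] with x hx j hj
    exact hx j (Finset.mem_range.2 hj)
  · simp only [isUnit_iff_ne_zero] at h2 ⊢
    exact (contDiffAt_det (contDiffAt_updateMat hτ hη hZ.fst h1)).continuousAt.eventually_ne h2

/-- Smoothness and openness of the domain go through one induction, because definedness of a later
substep is a condition on the output of the earlier ones. -/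
theorem contDiffAt_theta (n : ℕ) (hσ : ContDiffAt ℝ ∞ σ x₀) (hτ : ContDiffAt ℝ ∞ τ x₀)
    (hZ : ContDiffAt ℝ ∞ Z x₀) (h : ThetaDefined T S n (σ x₀) (τ x₀) (Z x₀)) :
    ContDiffAt ℝ ∞ (fun x => theta T S n (σ x) (τ x) (Z x)) x₀ ∧
      ∀ᶠ x in 𝓝 x₀, ThetaDefined T S n (σ x) (τ x) (Z x) := by
  induction n generalizing σ τ Z with
  | zero =>
    have hm : ContDiffAt ℝ ∞ (fun x => τ x + (σ x - τ x) / 2) x₀ :=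
      hτ.add ((hσ.sub hτ).div_const 2)
    have h1 := contDiffAt_psi₁ (S := S) hm hτ hZ
    exact ⟨contDiffAt_psi₁ hσ hm (contDiffAt_psi₂ hσ hτ h1 h), eventually_psi₂Defined hσ hτ h1 h⟩
  | succ n ih =>
    have h₁ : ContDiffAt ℝ ∞ (fun x => τ x + gam (2 * n + 2) * (σ x - τ x)) x₀ :=
      hτ.add (contDiffAt_const.mul (hσ.sub hτ))
    have h₂ : ContDiffAt ℝ ∞ (fun x => τ x + (1 - gam (2 * n + 2)) * (σ x - τ x)) x₀ :=
      hτ.add (contDiffAt_const.mul (hσ.sub hτ))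
    obtain ⟨d₁, d₂, d₃⟩ := h
    obtain ⟨c₁, e₁⟩ := ih h₁ hτ hZ d₁
    obtain ⟨c₂, e₂⟩ := ih h₂ h₁ c₁ d₂
    obtain ⟨c₃, e₃⟩ := ih hσ h₂ c₂ d₃
    exact ⟨c₃, e₁.and (e₂.and e₃)⟩

end SmoothMaps

/-! ### Symplecticity -/

section Symplectic

variable {T : RKTableau} {S : ChargedParticle} {t h : ℝ} {q : Vec}

theorem ChargedParticle.hasFDerivAt_velocity {q : Vec} {t : ℝ} (h : (q, t) ∈ S.Ω) :
    HasFDerivAt (fun y => S.velocity y t)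
      (Matrix.mulVecLin ((-(S.e / S.m)) • jac (fun y => S.A y t) q)).toContinuousLinearMap q := by
  have hA := S.differentiableAt_A h
  refine (hA.hasFDerivAt.const_smul (-(S.e / S.m))).congr_fderiv ?_
  ext1 v
  simp [jac_mulVec hA]

theorem mulVecLin_comp (M N : Mat) :
    (M.mulVecLin.toContinuousLinearMap).comp N.mulVecLin.toContinuousLinearMap =
      (M * N).mulVecLin.toContinuousLinearMap := by
  ext1 v
  simp

theorem mulVecLin_one_add_smul_sum (s : Finset ℕ) (c : ℕ → ℝ) (M : ℕ → Mat) (h : ℝ) :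
    ContinuousLinearMap.id ℝ Vec +
        h • ∑ j ∈ s, c j • (M j).mulVecLin.toContinuousLinearMap =
      (1 + h • ∑ j ∈ s, c j • M j : Mat).mulVecLin.toContinuousLinearMap := by
  ext1 v
  simp

/-- Differentiating the stage recursion in `q` reproduces the recursion that defines `k'`.
Consequently the matrix inverted in the momentum update is the Jacobian of the position update. -/
theorem hasFDerivAt_stagePoint (i : ℕ)
    (H : ∀ j < i, (T.stagePoint S t h q j, T.stageTime t h j) ∈ S.Ω) :
    HasFDerivAt (fun y => T.stagePoint S t h y i)
      (T.stageJac S t h q i).mulVecLin.toContinuousLinearMap q := by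
  induction i using Nat.strong_induction_on with
  | _ i ih =>
    simp only [RKTableau.stagePoint_eq]
    rw [RKTableau.stageJac, ← mulVecLin_one_add_smul_sum]
    refine (hasFDerivAt_id q).add ((HasFDerivAt.fun_sum fun j hj =>
      HasFDerivAt.fun_const_smul ?_ _).fun_const_smul h)
    have hj := Finset.mem_range.1 hj
    have h1 := (ChargedParticle.hasFDerivAt_velocity (H j hj)).comp q
      (f := fun y => T.stagePoint S t h y j) (ih j hj fun l hl => H l (hl.trans hj))
    rw [mulVecLin_comp, Matrix.smul_mul, ← RKTableau.k'_eq] at h1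
    exact h1.congr_of_eventuallyEq (Eventually.of_forall fun y => T.k_eq S t h y j)

theorem hasFDerivAt_k {i : ℕ}
    (H : ∀ j ≤ i, (T.stagePoint S t h q j, T.stageTime t h j) ∈ S.Ω) :
    HasFDerivAt (fun y => T.k S t h y i) (T.k' S t h q i).mulVecLin.toContinuousLinearMap q := by
  have h1 := (ChargedParticle.hasFDerivAt_velocity (H i le_rfl)).comp q
      (f := fun y => T.stagePoint S t h y i) (hasFDerivAt_stagePoint i fun l hl => H l hl.le)
  rw [mulVecLin_comp, Matrix.smul_mul, ← RKTableau.k'_eq] at h1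
  exact h1.congr_of_eventuallyEq (Eventually.of_forall fun y => T.k_eq S t h y i)

theorem hasFDerivAt_step
    (H : ∀ j < T.s, (T.stagePoint S t h q j, T.stageTime t h j) ∈ S.Ω) :
    HasFDerivAt (fun y => y + h • ∑ i ∈ Finset.range T.s, T.b i • T.k S t h y i)
      (T.updateMat S t h q).mulVecLin.toContinuousLinearMap q := by
  rw [RKTableau.updateMat, ← mulVecLin_one_add_smul_sum]
  exact (hasFDerivAt_id q).add ((HasFDerivAt.fun_sum fun j hj => HasFDerivAt.fun_const_smul
    (hasFDerivAt_k fun l hl => H l (hl.trans_lt (Finset.mem_range.1 hj))) _).fun_const_smul h)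

/-- The quadrature `h ∑ bᵢ f(xᵢ, τᵢ)` of the momentum-free part of the Hamiltonian. -/
noncomputable def action (T : RKTableau) (S : ChargedParticle) (t h : ℝ) (q : Vec) : ℝ :=
  h * ∑ i ∈ Finset.range T.s, T.b i * S.f (T.stagePoint S t h q i) (T.stageTime t h i)

theorem contDiffAt_action
    (H : ∀ j < T.s, (T.stagePoint S t h q j, T.stageTime t h j) ∈ S.Ω) :
    ContDiffAt ℝ ∞ (action T S t h) q := by
  refine contDiffAt_const.mul (ContDiffAt.sum fun j hj => contDiffAt_const.mul ?_)
  have hj := Finset.mem_range.1 hj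
  exact (S.contDiffOn_f.contDiffAt (S.isOpen_Ω.mem_nhds (H j hj))).comp q
    (f := fun y => (T.stagePoint S t h y j, T.stageTime t h j))
    ((contDiffAt_stagePoint contDiffAt_const contDiffAt_const contDiffAt_id j
      fun l hl => H l (hl.trans hj)).prodMk contDiffAt_const)

theorem fderiv_action
    (H : ∀ j < T.s, (T.stagePoint S t h q j, T.stageTime t h j) ∈ S.Ω) (w : Vec) :
    fderiv ℝ (action T S t h) q w =
      (h • ∑ i ∈ Finset.range T.s, T.b i • T.gradL S t h q i) ⬝ᵥ w := by
  have h1 : HasFDerivAt (action T S t h) (h • ∑ i ∈ Finset.range T.s, T.b i •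
      ((fderiv ℝ (fun x => S.f x (T.stageTime t h i)) (T.stagePoint S t h q i)).comp
        (T.stageJac S t h q i).mulVecLin.toContinuousLinearMap)) q := by
    refine (HasFDerivAt.fun_sum fun j hj => HasFDerivAt.const_mul ?_ (T.b j)).const_mul h
    have hj := Finset.mem_range.1 hj
    refine HasFDerivAt.comp q (g := fun x => S.f x (T.stageTime t h j)) ?_
      (hasFDerivAt_stagePoint j fun l hl => H l (hl.trans hj))
    refine DifferentiableAt.hasFDerivAt (DifferentiableAt.comp (T.stagePoint S t h q j)
      (g := fun x : Vec × ℝ => S.f x.1 x.2) (f := fun x => (x, T.stageTime t h j)) ?_ (by fun_prop))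
    exact (S.contDiffOn_f.contDiffAt (S.isOpen_Ω.mem_nhds (H j hj))).differentiableAt (by simp)
  rw [h1.fderiv]
  simp [RKTableau.gradL_eq, ← Matrix.dotProduct_mulVec, grad_dotProduct, sum_dotProduct]

/-- The hypothesis `h₂` says that `Φ` changes the form `p · dq` by the exact form `-dL`, so it
preserves the exterior derivative. Concretely, `h₂` is differentiated once more and antisymmetrised.
-/
theorem isSymplecticAt_of_generating {Φ : Phase → Phase} {z : Phase} {g : Vec → Vec} {L : Vec → ℝ}
    (hΦ : ContDiffAt ℝ ∞ Φ z) (hg : ContDiffAt ℝ ∞ g z.1) (hL : ContDiffAt ℝ ∞ L z.1)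
    (h₁ : ∀ y, (Φ y).1 = g y.1)
    (h₂ : ∀ᶠ y in 𝓝 z, ∀ w, (Φ y).2 ⬝ᵥ fderiv ℝ g y.1 w = y.2 ⬝ᵥ w - fderiv ℝ L y.1 w) :
    IsSymplecticAt Φ z := by
  have hΦ' := (hΦ.differentiableAt (by simp)).hasFDerivAt
  have hfst : HasFDerivAt (Prod.fst : Phase → Vec) (ContinuousLinearMap.fst ℝ Vec Vec) z :=
    hasFDerivAt_fst
  have e₁ : ∀ u, (fderiv ℝ Φ z u).1 = fderiv ℝ g z.1 u.1 := fun u => by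
    have a := ((hg.differentiableAt (by simp)).hasFDerivAt.comp z hfst)
    have b := hΦ'.fst
    have e : (fun y => (Φ y).1) = g ∘ Prod.fst := funext h₁
    rw [e] at b
    exact congrArg (fun L => L u) (b.unique a)
  have dg : HasFDerivAt (fderiv ℝ g) (fderiv ℝ (fderiv ℝ g) z.1) z.1 :=
    ((hg.fderiv_right (m := ∞) (by simp)).differentiableAt (by simp)).hasFDerivAt
  have dL : HasFDerivAt (fderiv ℝ L) (fderiv ℝ (fderiv ℝ L) z.1) z.1 :=
    ((hL.fderiv_right (m := ∞) (by simp)).differentiableAt (by simp)).hasFDerivAt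
  have e₂ : ∀ u w, (fderiv ℝ Φ z u).2 ⬝ᵥ fderiv ℝ g z.1 w = u.2 ⬝ᵥ w -
      fderiv ℝ (fderiv ℝ L) z.1 u.1 w - (Φ z).2 ⬝ᵥ fderiv ℝ (fderiv ℝ g) z.1 u.1 w := fun u w => by
    have dgw : HasFDerivAt (fun y : Phase => fderiv ℝ g y.1 w) _ z :=
      ((dg.comp z hfst).clm_apply (hasFDerivAt_const w z))
    obtain ⟨A, hA, hA'⟩ := hasFDerivAt_dotProduct hΦ'.snd dgw
    obtain ⟨B, hB, hB'⟩ := hasFDerivAt_dotProduct (hasFDerivAt_snd (𝕜 := ℝ) (p := z))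
      (hasFDerivAt_const w z)
    have dLw : HasFDerivAt (fun y : Phase => fderiv ℝ L y.1 w) _ z :=
      ((dL.comp z hfst).clm_apply (hasFDerivAt_const w z))
    have key := congrArg (fun L => L u) (hA.unique
      ((hB.sub dLw).congr_of_eventuallyEq (h₂.mono fun y hy => hy w)))
    simp [hA', hB'] at key
    linarith
  have two : minSmoothness ℝ 2 ≤ ∞ := by
    rw [minSmoothness_of_isRCLikeNormedField]; exact WithTop.coe_le_coe.2 le_top
  refine ⟨hΦ, fun u v => ?_⟩
  -- The only terms beyond the symplectic form are second derivatives of `g` and `L`, and they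
  -- cancel by symmetry.
  have s₁ := (hg.isSymmSndFDerivAt two).eq u.1 v.1
  have s₂ := (hL.isSymmSndFDerivAt two).eq u.1 v.1
  simp only [symplecticForm]
  rw [e₁, e₁, dotProduct_comm, e₂, e₂, s₁, s₂, dotProduct_comm u.1]
  ring

/-- The momentum update is exactly `P · dQ = p · dq - dL` with `L` the discrete action, solved for
`P`. -/
theorem isSymplecticAt_psi₂ {t₁ t₀ : ℝ} {z : Phase} (H : Psi₂Defined T S t₁ t₀ z) :
    IsSymplecticAt (psi₂ T S t₁ t₀) z := by
  have hz : ContDiffAt ℝ ∞ (fun y : Phase => y) z := contDiffAt_id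
  have hev := eventually_psi₂Defined (contDiffAt_const (c := t₁)) (contDiffAt_const (c := t₀)) hz H
  refine isSymplecticAt_of_generating
    (g := fun y => y + (t₁ - t₀) • ∑ i ∈ Finset.range T.s, T.b i • T.k S t₀ (t₁ - t₀) y i)
    (L := action T S t₀ (t₁ - t₀))
    (contDiffAt_psi₂ contDiffAt_const contDiffAt_const hz H) ?_ (contDiffAt_action H.1)
    (fun _ => rfl) (hev.mono fun y hy w => ?_)
  · exact contDiffAt_id.add (ContDiffAt.smul (f := fun _ : Vec => t₁ - t₀) contDiffAt_const
      (ContDiffAt.sum (f := fun j (y : Vec) => T.b j • T.k S t₀ (t₁ - t₀) y j) fun j hj =>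
        ContDiffAt.const_smul _ (contDiffAt_k contDiffAt_const contDiffAt_const contDiffAt_id H.1
          (Finset.mem_range.1 hj))))
  · rw [fderiv_action hy.1, (hasFDerivAt_step hy.1).fderiv, ← sub_dotProduct]
    simp only [psi₂, LinearMap.coe_toContinuousLinearMap', Matrix.mulVecLin_apply]
    rw [Matrix.dotProduct_mulVec, Matrix.vecMul_vecMul, Matrix.nonsing_inv_mul _ hy.2,
      Matrix.vecMul_one]

theorem IsSymplecticAt.comp {Φ Ψ : Phase → Phase} {z : Phase} (hΦ : IsSymplecticAt Φ (Ψ z))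
    (hΨ : IsSymplecticAt Ψ z) : IsSymplecticAt (fun y => Φ (Ψ y)) z := by
  refine ⟨hΦ.1.comp z hΨ.1, fun u v => ?_⟩
  have h := fderiv_comp z (hΦ.1.differentiableAt (by simp)) (hΨ.1.differentiableAt (by simp))
  change fderiv ℝ (fun y => Φ (Ψ y)) z = _ at h
  rw [h, ← hΨ.2 u v]
  exact hΦ.2 _ _

theorem isSymplecticAt_psi₁ (t₁ t₀ : ℝ) (z : Phase) : IsSymplecticAt (psi₁ S t₁ t₀) z := by
  refine ⟨contDiffAt_psi₁ contDiffAt_const contDiffAt_const contDiffAt_id, fun u v => ?_⟩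
  have h : HasFDerivAt (psi₁ S t₁ t₀) _ z :=
    ((hasFDerivAt_fst (𝕜 := ℝ) (p := z)).fun_add
      ((hasFDerivAt_snd (𝕜 := ℝ) (p := z)).const_smul ((t₁ - t₀) / S.m))).prodMk
      (hasFDerivAt_snd (𝕜 := ℝ) (p := z))
  rw [h.fderiv]
  simp only [symplecticForm, ContinuousLinearMap.prod_apply, add_apply,
    smul_apply, ContinuousLinearMap.coe_fst', ContinuousLinearMap.coe_snd',
    add_dotProduct, dotProduct_add, smul_dotProduct, dotProduct_smul]
  ring

theorem isSymplecticAt_theta (n : ℕ) {t₁ t₀ : ℝ} {z : Phase} (H : ThetaDefined T S n t₁ t₀ z) :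
    IsSymplecticAt (theta T S n t₁ t₀) z := by
  induction n generalizing t₁ t₀ z with
  | zero =>
    exact (isSymplecticAt_psi₁ _ _ _).comp
      (IsSymplecticAt.comp (Φ := psi₂ T S _ _) (isSymplecticAt_psi₂ H) (isSymplecticAt_psi₁ _ _ _))
  | succ n ih =>
    obtain ⟨d₁, d₂, d₃⟩ := H
    refine (ih d₃).comp (Ψ := fun y => theta T S n (t₀ + (1 - gam (2 * n + 2)) * (t₁ - t₀))
      (t₀ + gam (2 * n + 2) * (t₁ - t₀)) (theta T S n (t₀ + gam (2 * n + 2) * (t₁ - t₀)) t₀ y)) ?_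
    exact (ih d₂).comp (ih d₁)

end Symplectic

/-! ### Local existence on a common time interval -/

section LocalExistence

variable {E : Type*} [NormedAddCommGroup E] [NormedSpace ℝ E] [CompleteSpace E]

/-- Solutions through all points near a given one exist on a common interval of times, and stay
near that point. -/
theorem exists_solution_of_contDiffAt {X : ℝ × E → E} {W : Set (ℝ × E)} (hW : IsOpen W)
    {y₀ : ℝ × E} (hy₀ : y₀ ∈ W) (hX : ContDiffAt ℝ ∞ X y₀) :
    ∃ V ∈ 𝓝 y₀, ∃ h₀ > 0, ∀ y ∈ V, ∃ ζ : ℝ → E, ζ y.1 = y.2 ∧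
      ∀ τ ∈ Icc (y.1 - h₀) (y.1 + h₀),
        HasDerivWithinAt ζ (X (τ, ζ τ)) (Icc (y.1 - h₀) (y.1 + h₀)) τ ∧ (τ, ζ τ) ∈ W := by
  -- Time is adjoined as a variable with derivative `1`, which makes the system autonomous.
  -- Picard–Lindelöf then gives solutions jointly continuous in initial value and time, whence one
  -- interval on which all nearby solutions stay in `W`.
  have hY : ContDiffAt ℝ 1 (fun y : ℝ × E => ((1 : ℝ), X y)) y₀ :=
    contDiffAt_const.prodMk (hX.of_le (by simp))
  obtain ⟨ε, hε, a, r, L, K, hr, hP⟩ := IsPicardLindelof.of_contDiffAt_one hY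
  obtain ⟨α, hα, hαc⟩ := (hP 0).exists_forall_mem_closedBall_eq_hasDerivWithinAt_continuousOn
  simp only [zero_sub, zero_add] at hα hαc
  have hα₀ : α (y₀, 0) = y₀ := (hα y₀ (Metric.mem_closedBall_self r.2)).1
  have hnhds : Metric.closedBall y₀ r ×ˢ Icc (-ε) ε ∈ 𝓝 (y₀, (0 : ℝ)) :=
    prod_mem_nhds (Metric.closedBall_mem_nhds _ hr) (Icc_mem_nhds (by linarith) hε)
  have hc : ContinuousAt α (y₀, 0) := hαc.continuousAt hnhds
  have hev : ∀ᶠ x in 𝓝 (y₀, (0 : ℝ)), α x ∈ W ∧ x ∈ Metric.closedBall y₀ r ×ˢ Icc (-ε) ε :=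
    (hc.eventually (by rw [hα₀]; exact hW.mem_nhds hy₀)).and hnhds
  obtain ⟨A, hA, B, hB, hAB⟩ := mem_nhds_prod_iff.1 hev
  obtain ⟨δ, hδ, hδB⟩ := Metric.mem_nhds_iff.1 hB
  refine ⟨A, hA, δ / 2, by linarith, fun y hy => ?_⟩
  have hs : ∀ s ∈ Icc (-(δ / 2)) (δ / 2), α (y, s) ∈ W ∧ y ∈ Metric.closedBall y₀ r ∧ s ∈ Icc (-ε) ε := by
    intro s hs
    have : s ∈ B := hδB (by rw [Metric.mem_ball, Real.dist_eq, abs_lt]; constructor <;>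
      linarith [hs.1, hs.2])
    exact ⟨(hAB (mk_mem_prod hy this)).1, (hAB (mk_mem_prod hy this)).2⟩
  have hI : Icc (-(δ / 2)) (δ / 2) ⊆ Icc (-ε) ε := fun s h => (hs s h).2.2
  have h0 : (0 : ℝ) ∈ Icc (-(δ / 2)) (δ / 2) := ⟨by linarith, by linarith⟩
  obtain ⟨hy0, hyd⟩ := hα y (hs 0 h0).2.1
  have hd : ∀ s ∈ Icc (-(δ / 2)) (δ / 2),
      HasDerivWithinAt (fun s => α (y, s)) (1, X (α (y, s))) (Icc (-(δ / 2)) (δ / 2)) s :=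
    fun s h => (hyd s (hI h)).mono hI
  have hfst : ∀ s ∈ Icc (-(δ / 2)) (δ / 2), (α (y, s)).1 = y.1 + s := by
    intro s h
    have h1 : ∀ s ∈ Icc (-(δ / 2)) (δ / 2), HasDerivWithinAt (fun s => (α (y, s)).1 - s) (0 : ℝ)
        (Icc (-(δ / 2)) (δ / 2)) s := fun s h => by
      simpa using! ((hasFDerivAt_fst (𝕜 := ℝ) (p := α (y, s))).comp_hasDerivWithinAt s
        (hd s h)).sub (hasDerivWithinAt_id s _)
    have h2 := (convex_Icc (-(δ / 2)) (δ / 2)).norm_image_sub_le_of_norm_hasDerivWithin_le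
      (C := 0) h1 (by simp) h0 h
    rw [zero_mul, norm_le_zero_iff, hy0] at h2
    linarith
  refine ⟨fun τ => (α (y, τ - y.1)).2, by simp [hy0], fun τ hτ => ?_⟩
  have hτ' : τ - y.1 ∈ Icc (-(δ / 2)) (δ / 2) := ⟨by linarith [hτ.1], by linarith [hτ.2]⟩
  have e : (τ, (α (y, τ - y.1)).2) = α (y, τ - y.1) :=
    Prod.ext (by rw [hfst _ hτ']; ring) rfl
  simp only [e]
  refine ⟨?_, (hs _ hτ').1⟩
  have h1 := ((hasFDerivAt_snd (𝕜 := ℝ) (p := α (y, τ - y.1))).comp_hasDerivWithinAt _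
        (hd _ hτ')).scomp_of_eq τ (t' := Icc (-(δ / 2)) (δ / 2)) (s := Icc (y.1 - δ / 2) (y.1 + δ / 2))
      ((hasDerivWithinAt_id τ _).sub_const y.1)
      (fun x hx => show x - y.1 ∈ _ from ⟨by linarith [hx.1], by linarith [hx.2]⟩) rfl
  simpa using! h1

end LocalExistence

/-! ### Runge–Kutta methods in other finite-dimensional spaces -/

section Transfer

variable {E F : Type*} [NormedAddCommGroup E] [NormedSpace ℝ E] [NormedAddCommGroup F]
  [NormedSpace ℝ F]

/-- Runge–Kutta stages commute with linear changes of variables. This carries the order, defined on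
`Fin n → ℝ`, to the augmented system on `Vec × Mat × Vec`. -/
theorem RKTableau.stage_equiv (T : RKTableau) (e : E ≃L[ℝ] F) (X : E → ℝ → E) (t h : ℝ) (x : E)
    (i : ℕ) : T.stage (fun y τ => e (X (e.symm y) τ)) t h (e x) i = e (T.stage X t h x i) := by
  induction i using Nat.strong_induction_on with
  | _ i ih =>
    rw [RKTableau.stage_eq, RKTableau.stage_eq (F := X), Finset.sum_congr rfl fun j hj => by
      rw [ih j (Finset.mem_range.1 hj), ← map_smul], ← map_sum, ← map_smul, ← map_add,
      e.symm_apply_apply]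

theorem RKTableau.step_equiv (T : RKTableau) (e : E ≃L[ℝ] F) (X : E → ℝ → E) (t h : ℝ) (x : E) :
    T.step (fun y τ => e (X (e.symm y) τ)) t h (e x) = e (T.step X t h x) := by
  simp only [RKTableau.step, RKTableau.stage_equiv, map_add, map_smul, map_sum]

/-- The order of a method can be tested in any finite-dimensional space. -/
theorem RKTableau.HasOrder.isBigO [FiniteDimensional ℝ E] {T : RKTableau} {p : ℕ}
    (hT : T.HasOrder p) {U : Set (E × ℝ)} {X : E → ℝ → E} (hU : IsOpen U)
    (hX : ContDiffOn ℝ ∞ (fun x : E × ℝ => X x.1 x.2) U) {t : ℝ} {y : ℝ → E} (hy : (y t, t) ∈ U)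
    (hd : ∀ᶠ τ in 𝓝 t, HasDerivAt y (X (y τ) τ) τ) :
    (fun h : ℝ => T.step X t h (y t) - y (t + h)) =O[𝓝 0] fun h : ℝ => h ^ (p + 1) := by
  let e : E ≃L[ℝ] (Fin (Module.finrank ℝ E) → ℝ) := ContinuousLinearEquiv.ofFinrankEq (by simp)
  have hφ : ContDiff ℝ ∞ fun x : (Fin (Module.finrank ℝ E) → ℝ) × ℝ => (e.symm x.1, x.2) :=
    (e.symm.contDiff.comp contDiff_fst).prodMk contDiff_snd
  have h1 := hT _ ((fun x : (Fin (Module.finrank ℝ E) → ℝ) × ℝ => (e.symm x.1, x.2)) ⁻¹' U)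
    (fun y τ => e (X (e.symm y) τ)) (hU.preimage hφ.continuous)
    (e.contDiff.comp_contDiffOn (hX.comp hφ.contDiffOn fun _ h => h)) t (fun τ => e (y τ))
    (by simpa using hy)
    (hd.mono fun τ hτ => by simpa using! e.toContinuousLinearMap.hasFDerivAt.comp_hasDerivAt τ hτ)
  simp only [RKTableau.step_equiv, ← map_sub] at h1
  refine IsBigO.trans ?_ h1
  simpa using! e.symm.toContinuousLinearMap.isBigO_comp
    (fun h : ℝ => e (T.step X t h (y t) - y (t + h))) (𝓝 0)

end Transfer

/-! ### The split Hamiltonian vector fields and the augmented system -/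

namespace ChargedParticle

variable (S : ChargedParticle)

/-- The points `(t, (q, p))` with `(q, t)` in the domain of the fields. -/
def phaseDomain : Set (ℝ × Phase) := {y | (y.2.1, y.1) ∈ S.Ω}

/-- The Hamiltonian vector field of `H₁`. -/
noncomputable def kineticField (y : ℝ × Phase) : Phase := ((1 / S.m) • y.2.2, 0)

/-- The Hamiltonian vector field of `H - H₁`. -/
noncomputable def potentialField (y : ℝ × Phase) : Phase :=
  (S.velocity y.2.1 y.1, -((-(S.e / S.m)) •
    Matrix.vecMul y.2.2 (jac (fun x => S.A x y.1) y.2.1) + grad (fun x => S.f x y.1) y.2.1))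

theorem isOpen_phaseDomain : IsOpen S.phaseDomain :=
  S.isOpen_Ω.preimage (f := fun y : ℝ × Phase => (y.2.1, y.1)) (by fun_prop)

theorem isTrajectory_iff {s : Set ℝ} {ζ : ℝ → Phase} (h : ∀ τ ∈ s, ((ζ τ).1, τ) ∈ S.Ω) :
    IsTrajectory S.H s ζ ↔ ∀ τ ∈ s, HasDerivWithinAt ζ
      (S.kineticField (τ, ζ τ) + S.potentialField (τ, ζ τ)) s τ := by
  refine forall₂_congr fun τ hτ => ?_
  rw [S.grad_H_momentum, S.grad_H_position (h τ hτ)]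
  simp [kineticField, potentialField]

theorem contDiffAt_kineticField (y : ℝ × Phase) : ContDiffAt ℝ ∞ S.kineticField y := by
  unfold kineticField; fun_prop

theorem contDiffAt_potentialField {y : ℝ × Phase} (hy : y ∈ S.phaseDomain) :
    ContDiffAt ℝ ∞ S.potentialField y := by
  have hq : ContDiffAt ℝ ∞ (fun y : ℝ × Phase => y.2.1) y := by fun_prop
  have hp : ContDiffAt ℝ ∞ (fun y : ℝ × Phase => y.2.2) y := by fun_prop
  have ht : ContDiffAt ℝ ∞ (fun y : ℝ × Phase => y.1) y := by fun_prop
  exact (contDiffAt_velocity_comp hq ht hy).prodMk (((contDiffAt_vecMul hp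
    (contDiffAt_jac_comp hq ht hy)).const_smul _).add (contDiffAt_grad_comp hq ht hy)).neg

/-- The flow of the position component of the field of `H - H₁`, together with its derivative
and with the gradient of the action. -/
noncomputable def variationField (x : Vec × Mat × Vec) (t : ℝ) : Vec × Mat × Vec :=
  (S.velocity x.1 t, (-(S.e / S.m)) • (jac (fun y => S.A y t) x.1 * x.2.1),
    Matrix.vecMul (grad (fun y => S.f y t) x.1) x.2.1)

end ChargedParticle

/-! ### The shadowed map as a Runge–Kutta step of the augmented system -/

section Variation

attribute [local instance] Matrix.normedAddCommGroup Matrix.normedSpace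

variable {T : RKTableau} {S : ChargedParticle}

theorem sum_smul_triple (s : Finset ℕ) (c : ℕ → ℝ) (u : ℕ → Vec) (M : ℕ → Mat) (w : ℕ → Vec) :
    ∑ j ∈ s, c j • ((u j, M j, w j) : Vec × Mat × Vec) =
      (∑ j ∈ s, c j • u j, ∑ j ∈ s, c j • M j, ∑ j ∈ s, c j • w j) := by
  refine Prod.ext ?_ (Prod.ext ?_ ?_) <;> simp [Prod.fst_sum, Prod.snd_sum]

/-- The recursions for `k`, `k'` and `gradL` are the three components of a single Runge–Kutta
recursion, started from `J = I` and `w = 0`; the field does not depend on `w`. -/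
theorem stage_variationField (t h : ℝ) (q : Vec) (i : ℕ) :
    T.stage S.variationField t h (q, 1, 0) i =
      (T.k S t h q i, T.k' S t h q i, T.gradL S t h q i) := by
  induction i using Nat.strong_induction_on with
  | _ i ih =>
    rw [RKTableau.stage_eq, Finset.sum_congr rfl fun j hj => by rw [ih j (Finset.mem_range.1 hj)],
      sum_smul_triple, RKTableau.k_eq, RKTableau.k'_eq, RKTableau.gradL_eq, RKTableau.stagePoint_eq,
      show t + h * ∑ j ∈ Finset.range i, T.a i j = T.stageTime t h i by
        rw [RKTableau.stageTime, Finset.sum_range]]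
    rfl

theorem step_variationField (t h : ℝ) (q : Vec) :
    T.step S.variationField t h (q, 1, 0) =
      (q + h • ∑ i ∈ Finset.range T.s, T.b i • T.k S t h q i, T.updateMat S t h q,
        h • ∑ i ∈ Finset.range T.s, T.b i • T.gradL S t h q i) := by
  simp only [RKTableau.step, stage_variationField, sum_smul_triple]
  refine Prod.ext rfl (Prod.ext rfl ?_)
  simp

theorem contDiffAt_variationField {x : (Vec × Mat × Vec) × ℝ} (hx : (x.1.1, x.2) ∈ S.Ω) :
    ContDiffAt ℝ ∞ (fun x : (Vec × Mat × Vec) × ℝ => S.variationField x.1 x.2) x := by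
  have hq : ContDiffAt ℝ ∞ (fun y : (Vec × Mat × Vec) × ℝ => y.1.1) x := by fun_prop
  have hJ : ContDiffAt ℝ ∞ (fun y : (Vec × Mat × Vec) × ℝ => y.1.2.1) x := by fun_prop
  have ht : ContDiffAt ℝ ∞ (fun y : (Vec × Mat × Vec) × ℝ => y.2) x := by fun_prop
  exact (S.contDiffAt_velocity_comp hq ht hx).prodMk (((contDiffAt_matrix_mul
    (S.contDiffAt_jac_comp hq ht hx) hJ).const_smul _).prodMk
      (contDiffAt_vecMul (S.contDiffAt_grad_comp hq ht hx) hJ))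

theorem hasDerivAt_vecMul {v : ℝ → Vec} {M : ℝ → Mat} {v' : Vec} {M' : Mat} {t : ℝ}
    (hv : HasDerivAt v v' t) (hM : HasDerivAt M M' t) :
    HasDerivAt (fun τ => Matrix.vecMul (v τ) (M τ))
      (Matrix.vecMul v' (M t) + Matrix.vecMul (v t) M') t := by
  have hM' : ∀ i j, HasDerivAt (fun τ => M τ i j) (M' i j) t := fun i j =>
    hasDerivAt_pi.1 (hasDerivAt_pi.1 hM i) j
  rw [hasDerivAt_pi] at hv ⊢
  intro j
  have := HasDerivAt.fun_sum (u := Finset.univ) fun i _ => (hv i).mul (hM' i j)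
  refine this.congr_deriv ?_
  simp only [Pi.add_apply, Matrix.vecMul, dotProduct, Finset.sum_add_distrib]

/-- The momentum part of a flow, from its position part, the derivative and the action. -/
noncomputable def shadow (p : Vec) (x : Vec × Mat × Vec) : Phase :=
  (x.1, Matrix.vecMul (p - x.2.2) x.2.1⁻¹)

theorem contDiffAt_shadow (p : Vec) {x : Vec × Mat × Vec} (hx : IsUnit x.2.1.det) :
    ContDiffAt ℝ ∞ (shadow p) x := by
  have hq : ContDiffAt ℝ ∞ (fun y : Vec × Mat × Vec => y.1) x := by fun_prop
  have hJ : ContDiffAt ℝ ∞ (fun y : Vec × Mat × Vec => y.2.1) x := by fun_prop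
  have hw : ContDiffAt ℝ ∞ (fun y : Vec × Mat × Vec => y.2.2) x := by fun_prop
  exact hq.prodMk (contDiffAt_vecMul (contDiffAt_const.sub hw) (contDiffAt_matrix_inv hJ hx))

theorem hasDerivAt_shadow (p : Vec) {y : ℝ → Vec × Mat × Vec} {t : ℝ}
    (hy : HasDerivAt y (S.variationField (y t) t) t) (hu : IsUnit (y t).2.1.det) :
    HasDerivAt (fun τ => shadow p (y τ)) (S.potentialField (t, shadow p (y t))) t := by
  have hJ : HasDerivAt (fun τ => (y τ).2.1) _ t := hy.snd.fst
  have hw : HasDerivAt (fun τ => (y τ).2.2) _ t := hy.snd.snd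
  have h1 := ((contDiffAt_shadow p hu).differentiableAt (by simp)).hasFDerivAt.comp_hasDerivAt t hy
  have hP : HasDerivAt (fun τ => (shadow p (y τ)).2) _ t := h1.snd
  have hq : HasDerivAt (fun τ => (shadow p (y τ)).1) _ t := hy.fst
  refine hq.prodMk (hP.congr_deriv ?_)
  have hdet : ContinuousAt (fun τ => (y τ).2.1.det) t := by
    have hM : ContDiffAt ℝ ∞ (fun x : Vec × Mat × Vec => x.2.1) (y t) := by fun_prop
    exact ContinuousAt.comp (g := fun x : Vec × Mat × Vec => x.2.1.det)
      (contDiffAt_det hM).continuousAt hy.continuousAt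
  -- Differentiating `P J = p - w` avoids differentiating the inverse: it gives `P' J = -∇f J - P
  -- J'`, and multiplication by `J⁻¹` yields Hamilton's equation for `P`.
  have hev : (fun τ => Matrix.vecMul (shadow p (y τ)).2 (y τ).2.1) =ᶠ[𝓝 t] fun τ => p - (y τ).2.2 := by
    filter_upwards [hdet.eventually_ne hu.ne_zero] with τ hτ
    simp only [shadow]
    rw [Matrix.vecMul_vecMul, Matrix.nonsing_inv_mul _ (isUnit_iff_ne_zero.2 hτ), Matrix.vecMul_one]
  have key := (hasDerivAt_vecMul hP hJ).unique ((hw.const_sub p).congr_of_eventuallyEq hev)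
  have h2 := congrArg (fun v => Matrix.vecMul v ((y t).2.1)⁻¹) (eq_sub_of_add_eq key)
  simp only [ChargedParticle.variationField, Matrix.sub_vecMul, Matrix.neg_vecMul,
    Matrix.vecMul_vecMul, Matrix.smul_mul, Matrix.mul_assoc, Matrix.mul_nonsing_inv _ hu,
    Matrix.vecMul_one, Matrix.mul_one] at h2
  refine h2.trans ?_
  simp only [shadow, Matrix.vecMul_smul, Matrix.vecMul_vecMul]
  abel

/-- The map `shadow` is smooth, hence Lipschitz, near invertible `J`. It therefore carries the order
estimate of the augmented system to phase space. -/
theorem exists_isBigO_psi₂_sub {p : ℕ} (hT : T.HasOrder p) {t : ℝ} {z : Phase}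
    (hz : (z.1, t) ∈ S.Ω) :
    ∃ ζ : ℝ → Phase, ζ t = z ∧ (∀ᶠ τ in 𝓝 t, HasDerivAt ζ (S.potentialField (τ, ζ τ)) τ) ∧
      (fun h => psi₂ T S (t + h) t z - ζ (t + h)) =O[𝓝 0] fun h : ℝ => h ^ (p + 1) := by
  have hU : IsOpen {x : (Vec × Mat × Vec) × ℝ | (x.1.1, x.2) ∈ S.Ω} :=
    S.isOpen_Ω.preimage (f := fun x : (Vec × Mat × Vec) × ℝ => (x.1.1, x.2)) (by fun_prop)
  have hs : ContDiff ℝ ∞ (Prod.swap : ℝ × (Vec × Mat × Vec) → _) := contDiff_snd.prodMk contDiff_fst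
  obtain ⟨V, hV, h₀, hh₀, H⟩ := exists_solution_of_contDiffAt
    (X := fun x : ℝ × (Vec × Mat × Vec) => S.variationField x.2 x.1) (y₀ := (t, (z.1, 1, 0)))
    (hU.preimage hs.continuous) hz
    ((contDiffAt_variationField (x := ((z.1, 1, 0), t)) hz).comp (t, ((z.1, 1, 0) : Vec × Mat × Vec))
      (f := Prod.swap) hs.contDiffAt)
  obtain ⟨y, hyt, hy⟩ := H _ (mem_of_mem_nhds hV)
  simp only at hyt hy
  have hd : ∀ᶠ τ in 𝓝 t, HasDerivAt y (S.variationField (y τ) τ) τ := by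
    filter_upwards [Ioo_mem_nhds (show t - h₀ < t by linarith) (show t < t + h₀ by linarith)]
      with τ hτ
    exact (hy τ (Ioo_subset_Icc_self hτ)).1.hasDerivAt (Icc_mem_nhds hτ.1 hτ.2)
  have hyc : ContinuousAt y t := hd.self_of_nhds.continuousAt
  have hu : IsUnit (y t).2.1.det := by rw [hyt]; simp
  have hdet : ∀ᶠ τ in 𝓝 t, IsUnit (y τ).2.1.det := by
    have hM : ContDiffAt ℝ ∞ (fun x : Vec × Mat × Vec => x.2.1) (y t) := by fun_prop
    have : ContinuousAt (fun τ => (y τ).2.1.det) t :=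
      ContinuousAt.comp (g := fun x : Vec × Mat × Vec => x.2.1.det)
        (contDiffAt_det hM).continuousAt hyc
    filter_upwards [this.eventually_ne hu.ne_zero] with τ hτ using isUnit_iff_ne_zero.2 hτ
  refine ⟨fun τ => shadow z.2 (y τ), by simp [hyt, shadow], ?_, ?_⟩
  · filter_upwards [hd, hdet] with τ h1 h2 using hasDerivAt_shadow z.2 h1 h2
  have h1 := hT.isBigO hU (fun x hx => (contDiffAt_variationField hx).contDiffWithinAt)
    (show (y t, t) ∈ {x : (Vec × Mat × Vec) × ℝ | (x.1.1, x.2) ∈ S.Ω} by rw [hyt]; exact hz) hd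
  have hyh : Tendsto (fun h => y (t + h)) (𝓝 0) (𝓝 (y t)) :=
    hyc.tendsto.comp (by simpa using (continuous_const_add t).tendsto (0 : ℝ))
  have hstep : Tendsto (fun h => T.step S.variationField t h (y t)) (𝓝 0) (𝓝 (y t)) := by
    have h2 : Tendsto (fun h : ℝ => h ^ (p + 1)) (𝓝 0) (𝓝 0) := by
      simpa using (continuous_pow (M := ℝ) (p + 1)).tendsto 0
    simpa using! (h1.trans_tendsto h2).add hyh
  refine (((isBigO_comp_sub (contDiffAt_shadow z.2 hu) hstep hyh).trans h1).congr_left fun h => ?_)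
  rw [hyt, step_variationField]
  simp only [shadow, psi₂, add_sub_cancel_left]

end Variation

/-! ### The integrators as step maps -/

section StepMaps

variable {T : RKTableau} {S : ChargedParticle}

theorem psi₂Defined_self {t : ℝ} {z : Phase} (hz : (z.1, t) ∈ S.Ω) : Psi₂Defined T S t t z := by
  refine ⟨fun i _ => ?_, ?_⟩
  · simpa [RKTableau.stagePoint_eq, RKTableau.stageTime] using hz
  · simp [RKTableau.updateMat]

theorem psi₂_self (t : ℝ) (z : Phase) : psi₂ T S t t z = z := by
  simp [psi₂, RKTableau.updateMat]

theorem psi₁_self (t : ℝ) (z : Phase) : psi₁ S t t z = z := by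
  simp [psi₁]

theorem theta_self (n : ℕ) (t : ℝ) (z : Phase) : theta T S n t t z = z := by
  induction n with
  | zero => simp [theta, psi₁_self, psi₂_self]
  | succ n ih => simp [theta, ih]

theorem thetaDefined_self (n : ℕ) {t : ℝ} {z : Phase} (hz : (z.1, t) ∈ S.Ω) :
    ThetaDefined T S n t t z := by
  induction n with
  | zero => simpa [ThetaDefined, psi₁_self] using psi₂Defined_self hz
  | succ n ih => simpa [ThetaDefined, theta_self] using ih

/-- The kinetic shift over the time from `t` to `t + h`, as a step map. -/
noncomputable def kineticStep (S : ChargedParticle) (x : (ℝ × Phase) × ℝ) : Phase :=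
  psi₁ S (x.1.1 + x.2) x.1.1 x.1.2

/-- The map `ψ₂` over the time from `t` to `t + h`, as a step map. -/
noncomputable def shadowedStep (T : RKTableau) (S : ChargedParticle) (x : (ℝ × Phase) × ℝ) : Phase :=
  psi₂ T S (x.1.1 + x.2) x.1.1 x.1.2

theorem isApproxFlow_kineticStep (N : ℕ) :
    IsApproxFlow S.phaseDomain S.kineticField N (kineticStep S) := by
  have hc : ∀ x, ContDiffAt ℝ ∞ (kineticStep S) x := fun x => contDiffAt_psi₁
    (σ := fun x : (ℝ × Phase) × ℝ => x.1.1 + x.2) (τ := fun x => x.1.1) (Z := fun x => x.1.2)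
    (by fun_prop) (by fun_prop) (by fun_prop)
  refine ⟨⟨fun y _ => hc _, fun y _ => by simp [kineticStep, psi₁_self]⟩, fun y _ => ?_⟩
  refine (isBigO_zero (E' := Phase) _ _).congr_left fun x => ?_
  have h1 := hasDerivAt_partialStep ((hc x).differentiableAt (by simp))
  have h2 : HasDerivAt (fun h => kineticStep S (x.1, h)) (S.kineticField (x.1.1 + x.2, kineticStep S x))
      x.2 := by
    have h3 : (fun h => kineticStep S (x.1, h)) =
        fun h => (x.1.2.1 + (h / S.m) • x.1.2.2, x.1.2.2) := by
      ext1 h; simp [kineticStep, psi₁]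
    rw [h3]
    exact ((((hasDerivAt_id x.2).div_const S.m).smul_const x.1.2.2).const_add x.1.2.1).prodMk
      (hasDerivAt_const _ _)
  rw [h1.unique h2, sub_self]

theorem isStepMap_shadowedStep : IsStepMap S.phaseDomain (shadowedStep T S) := by
  refine ⟨fun y hy => contDiffAt_psi₂ (x₀ := (y, (0 : ℝ)))
    (σ := fun x : (ℝ × Phase) × ℝ => x.1.1 + x.2) (τ := fun x => x.1.1) (Z := fun x => x.1.2)
    (by fun_prop) (by fun_prop) (by fun_prop) ?_, fun y _ => by simp [shadowedStep, psi₂_self]⟩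
  simpa using psi₂Defined_self hy

theorem theta_eq_composed (n : ℕ) (x : (ℝ × Phase) × ℝ) :
    theta T S n (x.1.1 + x.2) x.1.1 x.1.2 = composed (kineticStep S) (shadowedStep T S) n x := by
  induction n generalizing x with
  | zero =>
    simp only [theta, composed, sandwich, reached, kineticStep, shadowedStep]
    ring_nf
  | succ n ih =>
    simp only [composed, sandwich, reached, ← ih, theta]
    ring_nf

/-- At each single point both maps are compared with the trajectory through it; since their
difference is smooth, `isBigO_of_pointwise` makes the estimate locally uniform. -/
theorem agreesTo_shadowedStep {p N : ℕ} (hT : T.HasOrder p) {φ : (ℝ × Phase) × ℝ → Phase}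
    (hφ : IsApproxFlow S.phaseDomain S.potentialField N φ) (hN : p ≤ N) :
    AgreesTo S.phaseDomain (p + 1) (shadowedStep T S) φ := by
  intro y hy
  refine isBigO_of_pointwise S.isOpen_phaseDomain (E := fun x => shadowedStep T S x - φ x)
    (fun y hy => (isStepMap_shadowedStep.contDiffAt y hy).sub (hφ.contDiffAt y hy)) ?_ hy
  intro y hy
  obtain ⟨ζ, hζ, hd, hO⟩ := exists_isBigO_psi₂_sub hT (t := y.1) (z := y.2) hy
  obtain ⟨V, hV, h₀, hh₀, C, hC⟩ := hφ.exists_norm_sub_le S.isOpen_phaseDomain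
    (fun y hy => S.contDiffAt_potentialField hy) hy
  obtain ⟨δ, hδ, hδd⟩ := Metric.eventually_nhds_iff_ball.1 hd
  have h1 : (fun h => φ (y, h) - ζ (y.1 + h)) =O[𝓝 0] fun h : ℝ => h ^ (N + 1) := by
    refine IsBigO.of_bound C ?_
    filter_upwards [Metric.ball_mem_nhds (0 : ℝ) (lt_min hh₀ hδ)] with h hh
    rw [mem_ball_zero_iff, Real.norm_eq_abs, lt_min_iff] at hh
    rw [norm_pow, Real.norm_eq_abs]
    refine hC y (mem_of_mem_nhds hV) h hh.1.le ζ hζ fun τ hτ => (hδd τ ?_).hasDerivWithinAt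
    rw [Metric.mem_ball, Real.dist_eq]
    refine lt_of_le_of_lt ?_ hh.2
    simpa using abs_sub_left_of_mem_uIcc hτ
  exact (hO.sub (h1.trans (isBigO_pow_of_le (by omega)))).congr_left fun h => by
    simp only [shadowedStep]; abel

end StepMaps

/-! ### Local error, uniformly on compact sets -/

section LocalError

variable {T : RKTableau} {S : ChargedParticle}

/-- The assertion on the local error of a step from `(t, z)`, with the constants `h₀` and `C`. -/
def LocalErrorAt (T : RKTableau) (S : ChargedParticle) (n : ℕ) (h₀ C t : ℝ) (z : Phase) : Prop :=
  (∃ ζ : ℝ → Phase, ζ t = z ∧ IsTrajectory S.H (Set.Icc (t - h₀) (t + h₀)) ζ ∧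
    ∀ τ ∈ Set.Icc (t - h₀) (t + h₀), ((ζ τ).1, τ) ∈ S.Ω) ∧
  ∀ h : ℝ, |h| ≤ h₀ →
    ThetaDefined T S n (t + h) t z ∧
    ∀ ζ : ℝ → Phase, ζ t = z → IsTrajectory S.H (Set.uIcc t (t + h)) ζ →
      (∀ τ ∈ Set.uIcc t (t + h), ((ζ τ).1, τ) ∈ S.Ω) →
      ‖theta T S n (t + h) t z - ζ (t + h)‖ ≤ C * |h| ^ (2 * n + 3)

/-- The assertion on the local error, uniformly on a set. -/
def HasLocalError (T : RKTableau) (S : ChargedParticle) (n : ℕ) (K : Set (ℝ × Phase)) : Prop :=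
  ∃ h₀ > 0, ∃ C : ℝ, ∀ t : ℝ, ∀ z : Phase, (t, z) ∈ K → LocalErrorAt T S n h₀ C t z

theorem IsTrajectory.mono {H : Vec → Vec → ℝ → ℝ} {s s' : Set ℝ} {ζ : ℝ → Phase}
    (h : IsTrajectory H s ζ) (hs : s' ⊆ s) : IsTrajectory H s' ζ :=
  fun τ hτ => (h τ (hs hτ)).mono hs

theorem LocalErrorAt.mono {n : ℕ} {h₀ h₁ C C₁ t : ℝ} {z : Phase} (H : LocalErrorAt T S n h₁ C₁ t z)
    (hh : h₀ ≤ h₁) (hC : C₁ ≤ C) : LocalErrorAt T S n h₀ C t z := by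
  obtain ⟨⟨ζ, e, hζ, hΩ⟩, hB⟩ := H
  have hI : Icc (t - h₀) (t + h₀) ⊆ Icc (t - h₁) (t + h₁) :=
    Icc_subset_Icc (by linarith) (by linarith)
  refine ⟨⟨ζ, e, hζ.mono hI, fun τ hτ => hΩ τ (hI hτ)⟩, fun h hh' => ?_⟩
  obtain ⟨d, b⟩ := hB h (hh'.trans hh)
  exact ⟨d, fun ζ e hζ hΩ => (b ζ e hζ hΩ).trans (mul_le_mul_of_nonneg_right hC (by positivity))⟩

theorem HasLocalError.union {n : ℕ} {K K' : Set (ℝ × Phase)} (hK : HasLocalError T S n K)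
    (hK' : HasLocalError T S n K') : HasLocalError T S n (K ∪ K') := by
  obtain ⟨h₁, hh₁, C₁, H₁⟩ := hK
  obtain ⟨h₂, hh₂, C₂, H₂⟩ := hK'
  refine ⟨min h₁ h₂, lt_min hh₁ hh₂, max C₁ C₂, fun t z hz => ?_⟩
  rcases hz with hz | hz
  · exact (H₁ t z hz).mono (min_le_left _ _) (le_max_left _ _)
  · exact (H₂ t z hz).mono (min_le_right _ _) (le_max_right _ _)

theorem exists_hasLocalError_nhds {n : ℕ} (hT : T.HasOrder (2 * n + 2)) {y₀ : ℝ × Phase}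
    (hy₀ : y₀ ∈ S.phaseDomain) : ∃ V ∈ 𝓝 y₀, HasLocalError T S n V := by
  have hW := S.isOpen_phaseDomain
  have hX₁ : ∀ y ∈ S.phaseDomain, ContDiffAt ℝ ∞ S.kineticField y :=
    fun y _ => S.contDiffAt_kineticField y
  have hX₂ : ∀ y ∈ S.phaseDomain, ContDiffAt ℝ ∞ S.potentialField y :=
    fun y hy => S.contDiffAt_potentialField hy
  have hX : ∀ y ∈ S.phaseDomain, ContDiffAt ℝ ∞ (fun y => S.kineticField y + S.potentialField y) y :=
    fun y hy => (hX₁ y hy).add (hX₂ y hy)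
  obtain ⟨φ, hφ⟩ := exists_isApproxFlow hW hX₂ (2 * n + 3)
  obtain ⟨R, hR⟩ := exists_isApproxFlow hW hX (2 * n + 3)
  have hψ := isApproxFlow_kineticStep (S := S) (2 * n + 3)
  have h1 : AgreesTo S.phaseDomain (2 * n + 3) (composed (kineticStep S) (shadowedStep T S) n) R :=
    (agreesTo_composed hψ.toIsStepMap isStepMap_shadowedStep hφ.toIsStepMap
      (agreesTo_shadowedStep hT hφ (by omega)) n).trans
      (agreesTo_composed_flow hW hX₁ hX₂ hψ hφ hR n le_rfl)
  obtain ⟨M, hM⟩ := (h1 y₀ hy₀).bound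
  have hdef : ∀ᶠ x in 𝓝 (y₀, (0 : ℝ)), ThetaDefined T S n (x.1.1 + x.2) x.1.1 x.1.2 :=
    (contDiffAt_theta n (x₀ := (y₀, (0 : ℝ))) (σ := fun x : (ℝ × Phase) × ℝ => x.1.1 + x.2)
      (τ := fun x => x.1.1) (Z := fun x => x.1.2)
      (by fun_prop) (by fun_prop) (by fun_prop)
      (by simpa using thetaDefined_self n hy₀)).2
  obtain ⟨A, hA, B, hB, hAB⟩ := mem_nhds_prod_iff.1 (hM.and hdef)
  obtain ⟨δ, hδ, hδB⟩ := Metric.mem_nhds_iff.1 hB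
  obtain ⟨V₁, hV₁, h₁, hh₁, hex⟩ := exists_solution_of_contDiffAt hW hy₀ (hX y₀ hy₀)
  obtain ⟨V₂, hV₂, h₂, hh₂, C, hC⟩ := hR.exists_norm_sub_le hW hX hy₀
  -- The bound `δ / 2` puts `h` into the open ball, and the bound `1` lets the error `|h|^(2n+4)` of
  -- `R` be absorbed into `|h|^(2n+3)`.
  refine ⟨A ∩ V₁ ∩ V₂, inter_mem (inter_mem hA hV₁) hV₂, min (min h₁ h₂) (min (δ / 2) 1),
    by positivity, M + |C|, fun t z ⟨⟨hzA, hz₁⟩, hz₂⟩ => ⟨?_, fun h hh => ?_⟩⟩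
  · obtain ⟨ζ, hζ, hd⟩ := hex _ hz₁
    have hI : Icc (t - min (min h₁ h₂) (min (δ / 2) 1)) (t + min (min h₁ h₂) (min (δ / 2) 1)) ⊆
        Icc (t - h₁) (t + h₁) := by
      have : min (min h₁ h₂) (min (δ / 2) 1) ≤ h₁ := (min_le_left _ _).trans (min_le_left _ _)
      exact Icc_subset_Icc (by linarith) (by linarith)
    have hΩ : ∀ τ ∈ Icc (t - h₁) (t + h₁), ((ζ τ).1, τ) ∈ S.Ω := fun τ hτ => (hd τ hτ).2
    exact ⟨ζ, hζ, ((S.isTrajectory_iff hΩ).2 fun τ hτ => (hd τ hτ).1).mono hI,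
      fun τ hτ => hΩ τ (hI hτ)⟩
  · simp only [le_min_iff] at hh
    obtain ⟨⟨hh1, hh2⟩, hh3, hh4⟩ := hh
    have hhB : h ∈ B := hδB (by rw [mem_ball_zero_iff, Real.norm_eq_abs]; linarith)
    obtain ⟨hb, hd⟩ := hAB (mk_mem_prod hzA hhB)
    refine ⟨hd, fun ζ e hζ hΩ => ?_⟩
    have h3 := hC _ hz₂ h hh2 ζ e ((S.isTrajectory_iff hΩ).1 hζ)
    have h4 : C * |h| ^ (2 * n + 3 + 1) ≤ |C| * |h| ^ (2 * n + 3) := by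
      refine mul_le_mul (le_abs_self C) ?_ (by positivity) (abs_nonneg C)
      exact pow_le_pow_of_le_one (abs_nonneg h) hh4 (by omega)
    rw [norm_pow, Real.norm_eq_abs, ← theta_eq_composed] at hb
    calc ‖theta T S n (t + h) t z - ζ (t + h)‖
        ≤ ‖theta T S n (t + h) t z - R ((t, z), h)‖ + ‖R ((t, z), h) - ζ (t + h)‖ :=
          norm_sub_le_norm_sub_add_norm_sub _ _ _
      _ ≤ M * |h| ^ (2 * n + 3) + |C| * |h| ^ (2 * n + 3) := add_le_add hb (h3.trans h4)
      _ = (M + |C|) * |h| ^ (2 * n + 3) := by ring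

theorem IsCompact.hasLocalError {n : ℕ} (hT : T.HasOrder (2 * n + 2)) {K : Set (ℝ × Phase)}
    (hK : IsCompact K) (hKΩ : K ⊆ S.phaseDomain) : HasLocalError T S n K := by
  refine hK.induction_on (p := HasLocalError T S n) ?_ ?_ (fun _ _ h h' => h.union h') ?_
  · exact ⟨1, one_pos, 0, fun _ _ h => h.elim⟩
  · exact fun s s' hs ⟨h₀, hh₀, C, H⟩ => ⟨h₀, hh₀, C, fun t z hz => H t z (hs hz)⟩
  · intro y hy
    obtain ⟨V, hV, h⟩ := exists_hasLocalError_nhds hT (hKΩ hy)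
    exact ⟨V, mem_nhdsWithin_of_mem_nhds hV, h⟩

end LocalError

end ESSRK

/-! ### The main theorem -/

theorem mainTheorem1 :
    -- explicit Runge–Kutta methods exist at every order; the classical one has order four
    (∀ p : ℕ, ∃ T : RKTableau, T.HasOrder p) ∧ rk4.HasOrder 4 ∧
    -- `ψ₁` is the exact flow of `H₁`
    (∀ (S : ChargedParticle) (ζ : ℝ → Phase),
      IsTrajectory S.H₁ Set.univ ζ ↔ ∀ t₁ t₀ : ℝ, ζ t₁ = psi₁ S t₁ t₀ (ζ t₀)) ∧
    -- the seven substeps of the fourth-order method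
    (∀ (S : ChargedParticle) (t h : ℝ) (z : Phase), essrk4 S t h z = essrk rk4 S 4 (t + h) t z) ∧
    ∀ p : ℕ, Even p → 2 ≤ p →
      -- alternating composition of `ψ₁` and `ψ₂`, with nodes that depend on `p`, `t`, `h` only
      (∃ α β : ℕ → ℝ, α 0 = 0 ∧ β 0 = 0 ∧
        α (3 ^ (p / 2 - 1) + 1) = 1 ∧ β (3 ^ (p / 2 - 1)) = 1 ∧
        ∀ (T : RKTableau) (S : ChargedParticle) (t h : ℝ) (z : Phase),
          essrk T S p (t + h) t z =
            alternating T S (fun i => t + α i * h) (fun i => t + β i * h)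
              (3 ^ (p / 2 - 1)) z) ∧
      -- explicitness
      (∀ T : RKTableau, ∃ (Q P : Formula .vector), ∀ (S : ChargedParticle) (t₁ t₀ : ℝ) (z : Phase),
        EssrkDefined T S p t₁ t₀ z →
          essrk T S p t₁ t₀ z = (Q.eval S t₁ t₀ z, P.eval S t₁ t₀ z)) ∧
      -- symplecticity
      (∀ (T : RKTableau) (S : ChargedParticle) (t₁ t₀ : ℝ) (z : Phase),
        EssrkDefined T S p t₁ t₀ z → IsSymplecticAt (essrk T S p t₁ t₀) z) ∧
      -- local error
      (∀ T : RKTableau, T.HasOrder p → ∀ (S : ChargedParticle) (K : Set (ℝ × Phase)),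
        IsCompact K → (∀ x ∈ K, (x.2.1, x.1) ∈ S.Ω) →
        ∃ h₀ > 0, ∃ C : ℝ, ∀ t : ℝ, ∀ z : Phase, (t, z) ∈ K →
          (∃ ζ : ℝ → Phase, ζ t = z ∧ IsTrajectory S.H (Set.Icc (t - h₀) (t + h₀)) ζ ∧
            ∀ τ ∈ Set.Icc (t - h₀) (t + h₀), ((ζ τ).1, τ) ∈ S.Ω) ∧
          ∀ h : ℝ, |h| ≤ h₀ →
            EssrkDefined T S p (t + h) t z ∧
            ∀ ζ : ℝ → Phase, ζ t = z → IsTrajectory S.H (Set.uIcc t (t + h)) ζ →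
              (∀ τ ∈ Set.uIcc t (t + h), ((ζ τ).1, τ) ∈ S.Ω) →
              ‖essrk T S p (t + h) t z - ζ (t + h)‖ ≤ C * |h| ^ (p + 1)) := by
  refine ⟨exists_hasOrder, rk4_hasOrder, isTrajectory_H₁_iff, essrk4_eq, fun p hp h2 => ?_⟩
  -- The recursion depth is `n = p / 2 - 1`, so the error exponent `2 n + 3` is `p + 1`.
  obtain ⟨n, rfl⟩ : ∃ n, p = 2 * n + 2 := by
    obtain ⟨k, rfl⟩ := hp
    exact ⟨k - 1, by omega⟩
  have hn : (2 * n + 2) / 2 - 1 = n := by omega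
  simp only [essrk, EssrkDefined, hn]
  refine ⟨exists_alternating n, fun T => exists_formula_theta T n,
    fun T S t₁ t₀ z h => ?_, fun T hT S K hK hKΩ => ?_⟩
  · rw [show essrk T S (2 * n + 2) t₁ t₀ = theta T S n t₁ t₀ from
      funext fun z => by rw [essrk, hn]]
    exact isSymplecticAt_theta n h
  · exact IsCompact.hasLocalError hT hK fun x hx => hKΩ x hx
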